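/- **Notation.** For an integer $m\ge 0$ and $p,q\in\mathbb R$, write $f=O_m(|x|^{p}(\ln|x|)^{q})$ (as $|x|\to\infty$, $x\in\mathbb R^2$) if $f$ is of class $C^m$ near infinity and $|D^jf(x)|=O(|x|^{p-j}(\ln|x|)^{q})$ as $|x|\to\infty$ for all $0\le j\le m$. **Proposition 3.3.** Let $l\ge 1$ be an integer, $k_1>3$, $k_2\ge 0$ real numbers, and let $v$ be a classical ($C^2$) solution of $$\sum_{i,j=1}^2a_{ij}(x)D_{ij}v=g(x)\quad\text{in }\mathbb R^2\setminus\overline{B_1},$$ where $a_{ij}(x)-a_{ij}(\infty)=O_l(|x|^{-2})$ for some symmetric positive definite matrix $[a_{ij}(\infty)]$, $g=O_l(|x|^{-k_1}(\ln|x|)^{k_2})$, and $$v=d\ln(x^TQx)+O_l(|x|^{-1})$$ for some $d\in\mathbb R$ and some symmetric positive definite matrix $Q$. Then there exists $c>0$ such that the matrix $P:=c\,[a_{ij}(\infty)]^{-1}$ has the following properties. If $d\neq0$, then $Q=P$; that is, $Q$ equals $[a_{ij}(\infty)]^{-1}$ up to a positive factor (a factor that is $1$ if $Q$ is normalized by $\det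 Q\cdot\det[a_{ij}(\infty)]=1$). Moreover, there are constants $d_1,d_2\in\mathbb R$ such that, as $|x|\to\infty$, $$v=d\ln(x^TPx)+(x^TPx)^{-1/2}\left(d_1\cos\theta+d_2\sin\theta\right)+\begin{cases}O_{l+1}(|x|^{2-k_1}(\ln|x|)^{k_2+1}),&k_1\le4,\\ O_{l+1}(|x|^{-2}\ln|x|),&k_1>4,\end{cases}$$ where $\theta=\theta(x)$ is the angle given by $(\cos\theta,\sin\theta)^T=P^{1/2}x/(x^TPx)^{1/2}$. -/

import Mathlib

open Filter Asymptotics Bornology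
open scoped Matrix MatrixOrder

noncomputable section

/-- The Euclidean plane. -/
abbrev Plane : Type := EuclideanSpace ℝ (Fin 2)

/-- `f = O_m(|x|^p (ln |x|)^q)` as `|x| → ∞`: near infinity `f` is of class `C^m`, and
`|D^j f(x)| = O(|x|^(p - j) (ln |x|)^q)` for every `0 ≤ j ≤ m`. -/
def IsBigOm (m : ℕ) (p q : ℝ) (f : Plane → ℝ) : Prop :=
  (∀ᶠ x in cobounded Plane, ContDiffAt ℝ m f x) ∧
    ∀ j : ℕ, j ≤ m →
      (fun x => iteratedFDeriv ℝ j f x) =O[cobounded Plane]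
        fun x => ‖x‖ ^ (p - j) * Real.log ‖x‖ ^ q

/-- The second partial derivative `D_ij v`. -/
def partial2 (v : Plane → ℝ) (i j : Fin 2) (x : Plane) : ℝ :=
  iteratedFDeriv ℝ 2 v x ![EuclideanSpace.single i 1, EuclideanSpace.single j 1]

/-- `v` is a classical (that is, `C²`) solution of `a_ij(x) D_ij v = g(x)` in the complement of the
closed unit disc. -/
def IsClassicalSolution (a : Plane → Matrix (Fin 2) (Fin 2) ℝ) (g v : Plane → ℝ) : Prop :=
  ContDiffOn ℝ 2 v {x | 1 < ‖x‖} ∧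
    ∀ x : Plane, 1 < ‖x‖ → ∑ i, ∑ j, a x i j * partial2 v i j x = g x

/-- The quadratic form `xᵀ P x`. -/
def quadForm (P : Matrix (Fin 2) (Fin 2) ℝ) (x : Plane) : ℝ :=
  x.ofLp ⬝ᵥ (P *ᵥ x.ofLp)

/-- The vector `(cos θ, sin θ) = P^(1/2) x / (xᵀ P x)^(1/2)`, of length one for `x ≠ 0` if `P` is
positive definite; `CFC.sqrt P` is the positive semidefinite square root of `P`. -/
def direction (P : Matrix (Fin 2) (Fin 2) ℝ) (x : Plane) : Fin 2 → ℝ :=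
  (quadForm P x ^ (1 / 2 : ℝ))⁻¹ • (CFC.sqrt P *ᵥ x.ofLp)

/-- `d ln(xᵀPx) + (xᵀPx)^(-1/2) (d₁ cos θ + d₂ sin θ)`. -/
def expansion (P : Matrix (Fin 2) (Fin 2) ℝ) (d d₁ d₂ : ℝ) (x : Plane) : ℝ :=
  d * Real.log (quadForm P x) +
    quadForm P x ^ (-(1 / 2) : ℝ) * (d₁ * direction P x 0 + d₂ * direction P x 1)

end

open MeasureTheory Set Metric Topology
open scoped ComplexConjugate

/-! ### Regularized Cauchy and Beurling kernels -/

/-! Let `S` be the square root of the inverse of the limit matrix. In the coordinates z = Sx the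
operator becomes a perturbation of the Laplacian. Let U be the solution in these coordinates, on ℂ,
and put w = ∂U. Since U is real, the equation is a first-order system ∂̄w = μ∂w + conj(μ∂w) + h with
μ = O(|z|^-2) and h = O(|z|^-k (ln|z|)^q); this is `exists_beltrami`. Because μ∂w will be no better
than O(|z|^-4), decay of the right-hand side beyond order 4 brings no gain, and k₁ > 4 is treated
with k = 4, q = 0.

The asymptotics assumed for the solution give w = O(1/|z|). A Schauder estimate at infinity,
`FarO.of_beltrami`, extends this to derivatives, so ∂w = O(|z|^-2) and ∂̄w = O(|z|^-k (ln|z|)^q) for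
k ≤ 4. After a cutoff, w is the Cauchy transform of its ∂̄ (`cauchy_pompeiu`). As k > 3, the zeroth
and first moments of ∂̄w converge, and the expansion 1/(z - ζ) = 1/z + ζ/z² + ζ²/(z²(z - ζ)) yields
w = b₀/z + b₁/z² + O(|z|^(1-k) (ln|z|)^(q+1)); the additional logarithm comes from the potential
estimate `exists_potential_le`.

The term d ∂ln(xᵀQx) is homogeneous of degree -1 and differs from b₀/z by O(|z|^-2), so the two
coincide. For d ≠ 0 this is possible only if the form is a multiple of |z|², that is, Q is a
multiple of the inverse limit matrix (`round_of_qfDz`). Subtracting d ln(xᵀQx) and Re(-2b₁/z) leaves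
a real remainder r with ∂r = w - b₀/z - b₁/z². The Schauder estimate again controls the derivatives
of ∂r, and integration along rays from infinity, where r vanishes, controls r. This is
`planar_expansion`.

The Schauder estimate follows by rescaling discs of radius comparable to |z₀| about z₀ to unit size,
where the coefficient is small in C¹ and `SolFam.regularity` applies. That interior theory rests on
two a priori estimates for compactly supported solutions, `exists_holder_of_beltrami_bounded` and
`exists_holder_wirt_of_beltrami`: the solution is represented through the Cauchy and Beurling
transforms, which are bounded into C^(1/2), and the terms containing the small coefficient are
absorbed. Difference quotients provide the regularity that the a priori estimates presuppose.
Principal values are avoided by regularizing the kernels with a parameter t, proving bounds uniform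
in t, and letting t → 0. -/

/-- The regularized distance to the origin. -/
noncomputable def jap (t : ℝ) (z : ℂ) : ℝ := √(‖z‖ ^ 2 + t ^ 2)

/-- The regularized Cauchy kernel. -/
noncomputable def cauchyKer (t : ℝ) (z : ℂ) : ℂ := conj z / (z * conj z + (t : ℂ) ^ 2)

/-- The regularized Beurling kernel. -/
noncomputable def beurlingKer (t : ℝ) (z : ℂ) : ℂ := -(cauchyKer t z) ^ 2

/-- The approximate identity belonging to `cauchyKer`. -/
noncomputable def moll (t : ℝ) (z : ℂ) : ℂ := (t : ℂ) ^ 2 / (z * conj z + (t : ℂ) ^ 2) ^ 2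

lemma jap_sq (t : ℝ) (z : ℂ) : jap t z ^ 2 = ‖z‖ ^ 2 + t ^ 2 := Real.sq_sqrt (by positivity)

lemma jap_pos {t : ℝ} (ht : 0 < t) (z : ℂ) : 0 < jap t z := Real.sqrt_pos.2 (by positivity)

lemma norm_le_jap (t : ℝ) (z : ℂ) : ‖z‖ ≤ jap t z :=
  Real.le_sqrt_of_sq_le (by nlinarith [sq_nonneg t])

lemma le_jap {t : ℝ} (z : ℂ) : t ≤ jap t z :=
  Real.le_sqrt_of_sq_le (by nlinarith [sq_nonneg ‖z‖])

@[fun_prop]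
lemma continuous_jap (t : ℝ) : Continuous (jap t) := by unfold jap; fun_prop

lemma denom_eq (t : ℝ) (z : ℂ) : z * conj z + (t : ℂ) ^ 2 = ((jap t z ^ 2 : ℝ) : ℂ) := by
  rw [jap_sq, Complex.mul_conj, Complex.normSq_eq_norm_sq]; push_cast; rfl

lemma denom_ne {t : ℝ} (ht : 0 < t) (z : ℂ) : z * conj z + (t : ℂ) ^ 2 ≠ 0 := by
  rw [denom_eq]; exact_mod_cast (pow_pos (jap_pos ht z) 2).ne'

@[fun_prop]
lemma continuous_cauchyKer {t : ℝ} (ht : 0 < t) : Continuous (cauchyKer t) := by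
  unfold cauchyKer
  exact Continuous.div (by fun_prop) (by fun_prop) (denom_ne ht)

lemma continuous_beurlingKer {t : ℝ} (ht : 0 < t) : Continuous (beurlingKer t) :=
  ((continuous_cauchyKer ht).pow 2).neg

lemma continuous_moll {t : ℝ} (ht : 0 < t) : Continuous (moll t) := by
  unfold moll
  exact Continuous.div (by fun_prop) (by fun_prop) (fun z => pow_ne_zero 2 (denom_ne ht z))

lemma norm_cauchyKer (t : ℝ) (z : ℂ) : ‖cauchyKer t z‖ = ‖z‖ / jap t z ^ 2 := by
  rw [cauchyKer, denom_eq, norm_div, RCLike.norm_conj, Complex.norm_real, Real.norm_eq_abs,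
    abs_of_nonneg (sq_nonneg _)]

lemma norm_moll (t : ℝ) (z : ℂ) : ‖moll t z‖ = t ^ 2 / jap t z ^ 4 := by
  rw [moll, denom_eq, norm_div, norm_pow, norm_pow, Complex.norm_real, Complex.norm_real,
    Real.norm_eq_abs, Real.norm_eq_abs, sq_abs, sq_abs]; ring

lemma norm_cauchyKer_le {t : ℝ} (ht : 0 < t) (z : ℂ) : ‖cauchyKer t z‖ ≤ 1 / jap t z := by
  have := jap_pos ht z
  rw [norm_cauchyKer, div_le_div_iff₀ (by positivity) this]
  nlinarith [norm_le_jap t z]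

lemma norm_cauchyKer_le_inv {t : ℝ} (ht : 0 < t) (z : ℂ) : ‖cauchyKer t z‖ ≤ ‖z‖⁻¹ := by
  rcases eq_or_ne z 0 with rfl | hz
  · simp [cauchyKer]
  · refine (norm_cauchyKer_le ht z).trans ?_
    rw [one_div]
    exact inv_anti₀ (norm_pos_iff.2 hz) (norm_le_jap t z)

/-- Regularized form of |1/a - 1/b| = |a - b|/(|a||b|). The constant stays 1 by the Cauchy–Schwarz
inequality for the vectors (|a|, t) and (|b|, t). -/
lemma norm_cauchyKer_sub_le {t : ℝ} (ht : 0 < t) (a b : ℂ) :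
    ‖cauchyKer t a - cauchyKer t b‖ ≤ ‖a - b‖ / (jap t a * jap t b) := by
  have ha := jap_pos ht a
  have hb := jap_pos ht b
  have h1 : cauchyKer t a - cauchyKer t b =
      (conj a * conj b * (b - a) + (t : ℂ) ^ 2 * conj (a - b)) /
        ((jap t a ^ 2 * jap t b ^ 2 : ℝ) : ℂ) := by
    rw [cauchyKer, cauchyKer, div_sub_div _ _ (denom_ne ht a) (denom_ne ht b), denom_eq, denom_eq]
    push_cast
    rw [← Complex.ofReal_pow, ← Complex.ofReal_pow, ← denom_eq, ← denom_eq, map_sub]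
    congr 1
    ring
  rw [h1, norm_div, Complex.norm_real, Real.norm_eq_abs, abs_of_nonneg (by positivity),
    div_le_div_iff₀ (by positivity) (by positivity)]
  have h2 : ‖conj a * conj b * (b - a) + (t : ℂ) ^ 2 * conj (a - b)‖
      ≤ ‖a - b‖ * (‖a‖ * ‖b‖ + t ^ 2) := by
    refine (norm_add_le _ _).trans_eq ?_
    simp only [norm_mul, RCLike.norm_conj, norm_pow, Complex.norm_real, Real.norm_eq_abs, sq_abs]
    rw [norm_sub_rev b a]; ring
  have h3 : ‖a‖ * ‖b‖ + t ^ 2 ≤ jap t a * jap t b := by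
    refine abs_le_of_sq_le_sq' ?_ (by positivity) |>.2
    rw [mul_pow, jap_sq, jap_sq]
    nlinarith [sq_nonneg (‖a‖ * t - ‖b‖ * t)]
  calc _ ≤ (‖a - b‖ * (jap t a * jap t b)) * (jap t a * jap t b) := by gcongr; exact h2.trans (by gcongr)
    _ = _ := by ring

lemma jap_le_two_mul {t : ℝ} (ht : 0 < t) {a b : ℂ} (h : ‖a - b‖ ≤ t) :
    jap t a ≤ 2 * jap t b := by
  have h1 : ‖a‖ ≤ ‖b‖ + t := by
    have := norm_add_le b (a - b); rw [add_sub_cancel] at this; linarith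
  refine abs_le_of_sq_le_sq' ?_ (by have := jap_pos ht b; positivity) |>.2
  rw [mul_pow, jap_sq, jap_sq]
  nlinarith [sq_nonneg (‖b‖ - t), norm_nonneg a, norm_nonneg b]

/-- A translation by at most the regularization scale gains one order of decay. The resulting cubic
decay remains integrable in the plane against the square root of the distance. -/
lemma norm_beurlingKer_sub_le {t : ℝ} (ht : 0 < t) {a b : ℂ} (h : ‖a - b‖ ≤ t) :
    ‖beurlingKer t a - beurlingKer t b‖ ≤ 6 * ‖a - b‖ * (1 / jap t a ^ 3) := by
  have ha := jap_pos ht a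
  have hb := jap_pos ht b
  have h1 : beurlingKer t a - beurlingKer t b =
      -((cauchyKer t a - cauchyKer t b) * (cauchyKer t a + cauchyKer t b)) := by
    simp only [beurlingKer]; ring
  have h2 : 1 / jap t b ≤ 2 / jap t a := by
    rw [div_le_div_iff₀ hb ha]; linarith [jap_le_two_mul ht h]
  rw [h1, norm_neg, norm_mul]
  calc _ ≤ (‖a - b‖ / (jap t a * jap t b)) * (1 / jap t a + 1 / jap t b) := by
        gcongr
        · exact norm_cauchyKer_sub_le ht a b
        · exact (norm_add_le _ _).trans (add_le_add (norm_cauchyKer_le ht a) (norm_cauchyKer_le ht b))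
    _ = ‖a - b‖ * (1 / jap t a) * (1 / jap t b) * (1 / jap t a + 1 / jap t b) := by
        field_simp
    _ ≤ ‖a - b‖ * (1 / jap t a) * (2 / jap t a) * (1 / jap t a + 2 / jap t a) := by gcongr
    _ = _ := by field_simp; ring

/-- The bound does not involve `t`. Its singularity |z|^-2 at the origin becomes integrable after
multiplication by the square root of |z|, which a Hölder density supplies. -/
lemma norm_beurlingKer_sub_scale {t r : ℝ} (ht : 0 < t) (hr : t ≤ r) (z : ℂ) :
    ‖beurlingKer t z - beurlingKer r z‖ ≤ 2 * (r ^ 2 / (‖z‖ ^ 2 * (‖z‖ ^ 2 + r ^ 2))) := by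
  have hr0 : 0 < r := ht.trans_le hr
  rcases eq_or_ne z 0 with rfl | hz
  · simp [beurlingKer, cauchyKer]
  have hz' : 0 < ‖z‖ := norm_pos_iff.2 hz
  have h1 : beurlingKer t z - beurlingKer r z =
      conj z ^ 2 * (((1 / jap r z ^ 4 - 1 / jap t z ^ 4 : ℝ)) : ℂ) := by
    simp only [beurlingKer, cauchyKer, denom_eq]
    push_cast
    ring
  have e1 : jap r z ^ 4 = (‖z‖ ^ 2 + r ^ 2) ^ 2 := by rw [← jap_sq]; ring
  have e2 : jap t z ^ 4 = (‖z‖ ^ 2 + t ^ 2) ^ 2 := by rw [← jap_sq]; ring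
  have h2 : |1 / jap r z ^ 4 - 1 / jap t z ^ 4| =
      1 / (‖z‖ ^ 2 + t ^ 2) ^ 2 - 1 / (‖z‖ ^ 2 + r ^ 2) ^ 2 := by
    rw [abs_sub_comm, e1, e2, abs_of_nonneg]
    rw [sub_nonneg]
    gcongr
  rw [h1, norm_mul, norm_pow, RCLike.norm_conj, Complex.norm_real, Real.norm_eq_abs, h2]
  set A := ‖z‖ ^ 2 with hA
  have hA0 : 0 < A := by positivity
  have h3 : 1 / (A + t ^ 2) ^ 2 ≤ 1 / A ^ 2 := by gcongr; nlinarith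
  have h4 : 1 / A ^ 2 - 1 / (A + r ^ 2) ^ 2 ≤ 2 * (r ^ 2 / (A * (A + r ^ 2))) / A := by
    rw [div_sub_div _ _ (by positivity) (by positivity), ← mul_div_assoc, div_div,
      div_le_div_iff₀ (by positivity) (by positivity)]
    have : 0 ≤ A ^ 2 * (A + r ^ 2) * (r ^ 4) := by positivity
    nlinarith
  calc _ ≤ A * (2 * (r ^ 2 / (A * (A + r ^ 2))) / A) := by gcongr; linarith
    _ = _ := by field_simp

/-! ### Integrals of radial kernels -/

lemma integrableOn_norm_rpow_ball {s : ℝ} (hs : -2 < s) (R : ℝ) :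
    IntegrableOn (fun z : ℂ => ‖z‖ ^ s) (ball 0 R) := by
  rw [integrableOn_fun_norm_addHaar volume (f := fun y : ℝ => y ^ s)]
  rcases le_or_gt R 0 with hR | hR
  · simp [Ioo_eq_empty_of_le hR]
  have : IntegrableOn (fun y : ℝ => y ^ (s + 1)) (Ioo 0 R) :=
    (intervalIntegral.integrableOn_Ioo_rpow_iff hR).2 (by linarith)
  refine this.congr_fun (fun y hy => ?_) measurableSet_Ioo
  simp [Complex.finrank_real_complex, Real.rpow_add hy.1, mul_comm]

lemma integrable_comp_inv_smul_iff {f : ℂ → ℝ} {t : ℝ} (ht : 0 < t) (hf : Integrable f) :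
    Integrable (fun z => f (t⁻¹ • z)) :=
  (integrable_comp_smul_iff volume f (inv_ne_zero ht.ne')).2 hf

lemma integral_comp_inv_smul_complex (f : ℂ → ℝ) {t : ℝ} :
    ∫ z, f (t⁻¹ • z) = t ^ 2 * ∫ z, f z := by
  rw [Measure.integral_comp_inv_smul, Complex.finrank_real_complex, smul_eq_mul,
    abs_of_nonneg (sq_nonneg t)]

lemma jap_smul {t : ℝ} (ht : 0 < t) (z : ℂ) : jap t z = t * jap 1 (t⁻¹ • z) := by
  rw [jap, jap, ← Real.sqrt_sq ht.le, ← Real.sqrt_mul (sq_nonneg t), norm_smul, Real.sqrt_sq ht.le]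
  congr 1
  rw [Real.norm_eq_abs, abs_of_pos (inv_pos.2 ht)]
  field_simp

lemma one_add_norm_le_jap (z : ℂ) : 1 + ‖z‖ ≤ 2 * jap 1 z := by
  have := norm_le_jap 1 z
  have := le_jap (t := 1) z
  linarith

lemma integrable_of_le_one_add_norm {E : Type*} [NormedAddCommGroup E] {f : ℂ → E}
    (hf : AEStronglyMeasurable f)
    {C r : ℝ} (hr : 2 < r) (h : ∀ z, ‖f z‖ ≤ C * (1 + ‖z‖) ^ (-r)) : Integrable f := by
  have := integrable_one_add_norm (μ := (volume : Measure ℂ)) (r := r)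
    (by rw [Complex.finrank_real_complex]; exact_mod_cast hr)
  exact (this.const_mul C).mono' hf (Eventually.of_forall h)

lemma integrable_sqrt_norm_div_jap :
    Integrable (fun z : ℂ => √‖z‖ * (1 / jap 1 z ^ 3)) := by
  refine integrable_of_le_one_add_norm (C := 8) (r := 5 / 2) ?_ (by norm_num) fun z => ?_
  · exact (Continuous.mul (by fun_prop) (Continuous.div (by fun_prop) (by fun_prop)
      fun z => pow_ne_zero 3 (jap_pos one_pos z).ne')).aestronglyMeasurable
  · have h0 := jap_pos one_pos z
    rw [Real.norm_of_nonneg (by positivity)]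
    have h1 : √‖z‖ ≤ (1 + ‖z‖) ^ (1 / 2 : ℝ) := by
      rw [← Real.sqrt_eq_rpow]; exact Real.sqrt_le_sqrt (by linarith)
    have h2 : 1 / jap 1 z ^ 3 ≤ 8 * (1 + ‖z‖) ^ (-3 : ℝ) := by
      rw [Real.rpow_neg (by positivity), ← div_eq_mul_inv]
      rw [show (3 : ℝ) = (3 : ℕ) by norm_num, Real.rpow_natCast,
        div_le_div_iff₀ (by positivity) (by positivity)]
      have := pow_le_pow_left₀ (by positivity) (one_add_norm_le_jap z) 3
      nlinarith
    calc _ ≤ (1 + ‖z‖) ^ (1 / 2 : ℝ) * (8 * (1 + ‖z‖) ^ (-3 : ℝ)) := by gcongr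
      _ = 8 * ((1 + ‖z‖) ^ (1 / 2 : ℝ) * (1 + ‖z‖) ^ (-3 : ℝ)) := by ring
      _ = _ := by rw [← Real.rpow_add (by positivity)]; norm_num

lemma integrable_inv_jap_pow_three : Integrable (fun z : ℂ => 1 / jap 1 z ^ 3) := by
  refine integrable_of_le_one_add_norm (C := 8) (r := 3) ?_ (by norm_num) fun z => ?_
  · exact (Continuous.div (by fun_prop) (by fun_prop)
      fun z => pow_ne_zero 3 (jap_pos one_pos z).ne').aestronglyMeasurable
  · have h0 := jap_pos one_pos z
    rw [Real.norm_of_nonneg (by positivity), Real.rpow_neg (by positivity), ← div_eq_mul_inv]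
    rw [show (3 : ℝ) = (3 : ℕ) by norm_num, Real.rpow_natCast,
      div_le_div_iff₀ (by positivity) (by positivity)]
    have := pow_le_pow_left₀ (by positivity) (one_add_norm_le_jap z) 3
    nlinarith

lemma integrable_sqrt_norm_div_sq :
    Integrable (fun z : ℂ => √‖z‖ * (1 / (‖z‖ ^ 2 * (‖z‖ ^ 2 + 1)))) := by
  have h1 : Integrable ((ball (0 : ℂ) 1).indicator fun z : ℂ => ‖z‖ ^ (-3 / 2 : ℝ)) :=
    (integrable_indicator_iff measurableSet_ball).2 (integrableOn_norm_rpow_ball (by norm_num) 1)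
  have h2 := integrable_one_add_norm (μ := (volume : Measure ℂ)) (r := 7 / 2)
    (by rw [Complex.finrank_real_complex]; norm_num)
  refine (h1.add (h2.const_mul 16)).mono' ?_ (Eventually.of_forall fun z => ?_)
  · exact Measurable.aestronglyMeasurable (by fun_prop)
  · rw [Real.norm_of_nonneg (by positivity), Pi.add_apply]
    rcases eq_or_ne z 0 with rfl | hz
    · simp
    have hz' : 0 < ‖z‖ := norm_pos_iff.2 hz
    by_cases hb : z ∈ ball (0 : ℂ) 1
    · rw [indicator_of_mem hb]
      have : √‖z‖ * (1 / (‖z‖ ^ 2 * (‖z‖ ^ 2 + 1))) ≤ ‖z‖ ^ (-3 / 2 : ℝ) := by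
        calc _ ≤ √‖z‖ * (1 / (‖z‖ ^ 2 * 1)) := by gcongr; nlinarith
          _ = ‖z‖ ^ (1 / 2 : ℝ) * ‖z‖ ^ (-2 : ℝ) := by
            rw [Real.sqrt_eq_rpow, Real.rpow_neg hz'.le, one_div, one_div]; norm_num
          _ = _ := by rw [← Real.rpow_add hz']; norm_num
      have : 0 ≤ 16 * (1 + ‖z‖) ^ (-(7 / 2) : ℝ) := by positivity
      linarith
    · rw [indicator_of_notMem hb, zero_add]
      have hb1 : 1 ≤ ‖z‖ := by simpa using hb
      have h5 : √‖z‖ ≤ (1 + ‖z‖) ^ (1 / 2 : ℝ) := by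
        rw [← Real.sqrt_eq_rpow]; exact Real.sqrt_le_sqrt (by linarith)
      have h6 : 1 / (‖z‖ ^ 2 * (‖z‖ ^ 2 + 1)) ≤ 16 * (1 + ‖z‖) ^ (-4 : ℝ) := by
        rw [Real.rpow_neg (by positivity), ← div_eq_mul_inv]
        rw [show (4 : ℝ) = (4 : ℕ) by norm_num, Real.rpow_natCast,
          div_le_div_iff₀ (by positivity) (by positivity)]
        have : (1 + ‖z‖) ^ 4 ≤ (2 * ‖z‖) ^ 4 := by gcongr; linarith
        nlinarith [sq_nonneg ‖z‖]
      calc _ ≤ (1 + ‖z‖) ^ (1 / 2 : ℝ) * (16 * (1 + ‖z‖) ^ (-4 : ℝ)) := by gcongr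
        _ = 16 * ((1 + ‖z‖) ^ (1 / 2 : ℝ) * (1 + ‖z‖) ^ (-4 : ℝ)) := by ring
        _ = _ := by rw [← Real.rpow_add (by positivity)]; norm_num

/-- The dilation by `t` reduces everything to scale 1, and counting powers gives t^(1/2 - 3 + 2). -/
lemma exists_integral_sqrt_norm_div_jap : ∃ C, 0 ≤ C ∧ ∀ t : ℝ, 0 < t →
    Integrable (fun z : ℂ => √‖z‖ * (1 / jap t z ^ 3)) ∧
      ∫ z : ℂ, √‖z‖ * (1 / jap t z ^ 3) = C * (√t / t) := by
  refine ⟨∫ z : ℂ, √‖z‖ * (1 / jap 1 z ^ 3),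
    integral_nonneg fun z => by have := jap_pos one_pos z; positivity, fun t ht => ?_⟩
  have e : (fun z : ℂ => √‖z‖ * (1 / jap t z ^ 3)) = fun z : ℂ =>
      (√t / t ^ 3) * (fun w : ℂ => √‖w‖ * (1 / jap 1 w ^ 3)) (t⁻¹ • z) := by
    funext z
    have := jap_pos one_pos (t⁻¹ • z)
    have h : √‖z‖ = √t * √‖t⁻¹ • z‖ := by
      rw [← Real.sqrt_mul ht.le, norm_smul, Real.norm_eq_abs, abs_of_pos (inv_pos.2 ht),
        mul_inv_cancel_left₀ ht.ne']
    simp only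
    rw [jap_smul ht, h]
    field_simp
  rw [e]
  refine ⟨(integrable_comp_inv_smul_iff ht integrable_sqrt_norm_div_jap).const_mul _, ?_⟩
  rw [integral_const_mul,
    integral_comp_inv_smul_complex (fun w : ℂ => √‖w‖ * (1 / jap 1 w ^ 3))]
  field_simp

lemma exists_integral_inv_jap : ∃ C, 0 ≤ C ∧ ∀ t : ℝ, 0 < t →
    Integrable (fun z : ℂ => 1 / jap t z ^ 3) ∧ ∫ z : ℂ, 1 / jap t z ^ 3 = C / t := by
  refine ⟨∫ z : ℂ, 1 / jap 1 z ^ 3,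
    integral_nonneg fun z => by have := jap_pos one_pos z; positivity, fun t ht => ?_⟩
  have e : (fun z : ℂ => 1 / jap t z ^ 3) = fun z : ℂ =>
      (1 / t ^ 3) * (fun w : ℂ => 1 / jap 1 w ^ 3) (t⁻¹ • z) := by
    funext z
    have := jap_pos one_pos (t⁻¹ • z)
    simp only
    rw [jap_smul ht]
    field_simp
  rw [e]
  refine ⟨(integrable_comp_inv_smul_iff ht integrable_inv_jap_pow_three).const_mul _, ?_⟩
  rw [integral_const_mul, integral_comp_inv_smul_complex (fun w : ℂ => 1 / jap 1 w ^ 3)]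
  field_simp

lemma exists_integral_sqrt_norm_div_sq : ∃ C, 0 ≤ C ∧ ∀ t : ℝ, 0 < t →
    Integrable (fun z : ℂ => √‖z‖ * (t ^ 2 / (‖z‖ ^ 2 * (‖z‖ ^ 2 + t ^ 2)))) ∧
      ∫ z : ℂ, √‖z‖ * (t ^ 2 / (‖z‖ ^ 2 * (‖z‖ ^ 2 + t ^ 2))) = C * √t := by
  refine ⟨∫ z : ℂ, √‖z‖ * (1 / (‖z‖ ^ 2 * (‖z‖ ^ 2 + 1))),
    integral_nonneg fun z => by positivity, fun t ht => ?_⟩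
  have e : (fun z : ℂ => √‖z‖ * (t ^ 2 / (‖z‖ ^ 2 * (‖z‖ ^ 2 + t ^ 2)))) = fun z : ℂ =>
      (√t / t ^ 2) * (fun w : ℂ => √‖w‖ * (1 / (‖w‖ ^ 2 * (‖w‖ ^ 2 + 1)))) (t⁻¹ • z) := by
    funext z
    have hn : ‖z‖ = t * ‖t⁻¹ • z‖ := by
      rw [norm_smul, Real.norm_eq_abs, abs_of_pos (inv_pos.2 ht), mul_inv_cancel_left₀ ht.ne']
    have h : √‖z‖ = √t * √‖t⁻¹ • z‖ := by rw [← Real.sqrt_mul ht.le, ← hn]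
    simp only
    rw [h, hn]
    rcases eq_or_ne z 0 with rfl | hz
    · simp
    have : 0 < ‖t⁻¹ • z‖ := by
      rw [norm_pos_iff, smul_ne_zero_iff]; exact ⟨inv_ne_zero ht.ne', hz⟩
    field_simp
  rw [e]
  refine ⟨(integrable_comp_inv_smul_iff ht integrable_sqrt_norm_div_sq).const_mul _, ?_⟩
  rw [integral_const_mul,
    integral_comp_inv_smul_complex (fun w : ℂ => √‖w‖ * (1 / (‖w‖ ^ 2 * (‖w‖ ^ 2 + 1))))]
  field_simp

/-! ### Hölder bounds for the regularized singular integrals -/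

/-- Convolution of a kernel with a function. -/
noncomputable def conv (K G : ℂ → ℂ) (z : ℂ) : ℂ := ∫ ζ, K (z - ζ) * G ζ

lemma integrable_conv {K G : ℂ → ℂ} (hK : Continuous K) (hG : Continuous G)
    (hc : HasCompactSupport G) (z : ℂ) : Integrable fun ζ => K (z - ζ) * G ζ :=
  Continuous.integrable_of_hasCompactSupport (by fun_prop) hc.mul_left

/-- This bound degenerates as `t` tends to 0 but is integrable over the whole plane; it serves only
to justify integrability. -/
lemma norm_beurlingKer_sub_scale' {t r : ℝ} (ht : 0 < t) (hr : t ≤ r) (z : ℂ) :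
    ‖beurlingKer t z - beurlingKer r z‖ ≤ 2 * r ^ 2 / t * (1 / jap t z ^ 3) := by
  have hr0 : 0 < r := ht.trans_le hr
  have a0 := jap_pos ht z
  have b0 := jap_pos hr0 z
  have ab : jap t z ≤ jap r z := Real.sqrt_le_sqrt (by gcongr)
  have h1 : beurlingKer t z - beurlingKer r z =
      conj z ^ 2 * (((1 / jap r z ^ 4 - 1 / jap t z ^ 4 : ℝ)) : ℂ) := by
    simp only [beurlingKer, cauchyKer, denom_eq]
    push_cast
    ring
  have h2 : |1 / jap r z ^ 4 - 1 / jap t z ^ 4| = 1 / jap t z ^ 4 - 1 / jap r z ^ 4 := by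
    rw [abs_sub_comm, abs_of_nonneg]
    rw [sub_nonneg]
    gcongr
  rw [h1, norm_mul, norm_pow, RCLike.norm_conj, Complex.norm_real, Real.norm_eq_abs, h2]
  have h3 : ‖z‖ ^ 2 ≤ jap t z ^ 2 := by rw [jap_sq]; nlinarith [sq_nonneg t]
  have h4 : jap r z ^ 2 - jap t z ^ 2 ≤ r ^ 2 := by rw [jap_sq, jap_sq]; nlinarith [sq_nonneg t]
  set a := jap t z
  set b := jap r z
  have hta : t ≤ a := le_jap z
  calc ‖z‖ ^ 2 * (1 / a ^ 4 - 1 / b ^ 4) ≤ a ^ 2 * (1 / a ^ 4 - 1 / b ^ 4) := by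
        have : 0 ≤ 1 / a ^ 4 - 1 / b ^ 4 := by rw [sub_nonneg]; gcongr
        gcongr
    _ = (b ^ 2 - a ^ 2) * (b ^ 2 + a ^ 2) / (a ^ 2 * b ^ 4) := by field_simp; ring
    _ ≤ r ^ 2 * (b ^ 2 + b ^ 2) / (a ^ 2 * b ^ 4) := by
        gcongr
    _ = 2 * r ^ 2 / (a ^ 2 * b ^ 2) := by field_simp; ring
    _ ≤ 2 * r ^ 2 / (a ^ 2 * a ^ 2) := by gcongr
    _ ≤ 2 * r ^ 2 / (t * a ^ 3) := by
        have : t * a ^ 3 ≤ a ^ 2 * a ^ 2 := by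
          calc t * a ^ 3 ≤ a * a ^ 3 := by gcongr
            _ = _ := by ring
        gcongr
    _ = _ := by field_simp

lemma integrable_beurlingKer_sub_scale {t r : ℝ} (ht : 0 < t) (hr : t ≤ r) :
    Integrable fun z => beurlingKer t z - beurlingKer r z := by
  obtain ⟨C, -, hC⟩ := exists_integral_inv_jap
  exact ((hC t ht).1.const_mul (2 * r ^ 2 / t)).mono'
    ((continuous_beurlingKer ht).sub (continuous_beurlingKer (ht.trans_le hr))).aestronglyMeasurable
    (Eventually.of_forall fun z => norm_beurlingKer_sub_scale' ht hr z)

lemma beurlingKer_I_mul (t : ℝ) (z : ℂ) : beurlingKer t (Complex.I * z) = -beurlingKer t z := by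
  simp only [beurlingKer, cauchyKer, map_mul, Complex.conj_I]
  rw [show Complex.I * z * (-Complex.I * conj z) = z * conj z by
    linear_combination (-z * conj z) * Complex.I_mul_I]
  rw [div_pow, div_pow, mul_pow, neg_sq, Complex.I_sq]
  ring

/-- Rotation by `Complex.I` preserves the measure and changes the sign of the kernel, which is
homogeneous of angular type conj(z)². -/
lemma integral_beurlingKer_sub_scale (t r : ℝ) :
    ∫ z, (beurlingKer t z - beurlingKer r z) = 0 := by
  have hI : ‖Complex.I‖ = 1 := Complex.norm_I
  let e : ℂ ≃ₗᵢ[ℝ] ℂ := rotation ⟨Complex.I, by simp [Submonoid.unitSphere]⟩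
  have h := e.measurePreserving.integral_comp e.toHomeomorph.measurableEmbedding
    (fun z => beurlingKer t z - beurlingKer r z)
  have h2 : ∀ z, beurlingKer t (e z) - beurlingKer r (e z) =
      -(beurlingKer t z - beurlingKer r z) := fun z => by
    have : e z = Complex.I * z := rfl
    rw [this, beurlingKer_I_mul, beurlingKer_I_mul]; ring
  simp only [h2] at h
  rw [integral_neg] at h
  exact self_eq_neg.1 h.symm

lemma integrable_beurlingKer_sub_trans {t : ℝ} (ht : 0 < t) {z w : ℂ} (h : ‖z - w‖ ≤ t) :
    Integrable fun ζ => beurlingKer t (z - ζ) - beurlingKer t (w - ζ) := by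
  obtain ⟨C, -, hC⟩ := exists_integral_inv_jap
  refine (((hC t ht).1.comp_sub_left z).const_mul (6 * ‖z - w‖)).mono' ?_
    (Eventually.of_forall fun ζ => ?_)
  · have := continuous_beurlingKer ht
    exact Continuous.aestronglyMeasurable (by fun_prop)
  · simpa using norm_beurlingKer_sub_le ht (a := z - ζ) (b := w - ζ) (by simpa using h)

/-- Neither translate is absolutely integrable, so the integrals cannot be separated. The difference
of the kernels at scales t and R is integrable, hence translation invariant, so t may be replaced by
any larger R without changing the value; at scale R the integral is O(1/R). -/
lemma integral_beurlingKer_sub_trans {t : ℝ} (ht : 0 < t) {z w : ℂ} (h : ‖z - w‖ ≤ t) :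
    ∫ ζ, (beurlingKer t (z - ζ) - beurlingKer t (w - ζ)) = 0 := by
  obtain ⟨C, hC0, hC⟩ := exists_integral_inv_jap
  have key : ∀ R, t ≤ R →
      ‖∫ ζ, (beurlingKer t (z - ζ) - beurlingKer t (w - ζ))‖ ≤ 6 * ‖z - w‖ * C / R := by
    intro R hR
    have hR0 := ht.trans_le hR
    have hk := integrable_beurlingKer_sub_scale ht hR
    have e1 : ∫ ζ, (beurlingKer t (z - ζ) - beurlingKer t (w - ζ)) =
        ∫ ζ, (beurlingKer R (z - ζ) - beurlingKer R (w - ζ)) := by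
      rw [← sub_eq_zero, ← integral_sub (integrable_beurlingKer_sub_trans ht h)
        (integrable_beurlingKer_sub_trans hR0 (h.trans hR))]
      have h1 := integral_sub_left_eq_self (fun ζ => beurlingKer t ζ - beurlingKer R ζ) volume z
      have h2 := integral_sub_left_eq_self (fun ζ => beurlingKer t ζ - beurlingKer R ζ) volume w
      have h3 := integral_sub (hk.comp_sub_left z) (hk.comp_sub_left w)
      rw [h1, h2, sub_self] at h3
      rw [← h3]
      congr 1
      funext ζ
      ring
    rw [e1]
    have := norm_integral_le_of_norm_le (((hC R hR0).1.comp_sub_left z).const_mul (6 * ‖z - w‖))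
      (f := fun ζ => beurlingKer R (z - ζ) - beurlingKer R (w - ζ))
      (Eventually.of_forall fun ζ => by
        simpa using norm_beurlingKer_sub_le hR0 (a := z - ζ) (b := w - ζ) (by simpa using h.trans hR))
    refine this.trans_eq ?_
    rw [integral_const_mul, integral_sub_left_eq_self (fun ζ => 1 / jap R ζ ^ 3), (hC R hR0).2]
    ring
  have hlim : Tendsto (fun R : ℝ => 6 * ‖z - w‖ * C / R) atTop (𝓝 0) :=
    tendsto_const_nhds.div_atTop tendsto_id
  have := ge_of_tendsto hlim (eventually_atTop.2 ⟨t, key⟩)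
  exact norm_le_zero_iff.1 this

/-- The regularized Beurling transforms preserve the Hölder class of exponent `1/2`, uniformly. -/
lemma exists_holder_conv_beurlingKer : ∃ K, 0 ≤ K ∧ ∀ (G : ℂ → ℂ) (N : ℝ), Continuous G →
    HasCompactSupport G → (∀ z w, ‖G z - G w‖ ≤ N * √‖z - w‖) → ∀ t : ℝ, 0 < t → ∀ z w,
      ‖conv (beurlingKer t) G z - conv (beurlingKer t) G w‖ ≤ K * N * √‖z - w‖ := by
  obtain ⟨C₁, hC₁, h₁⟩ := exists_integral_sqrt_norm_div_jap
  obtain ⟨C₂, hC₂, h₂⟩ := exists_integral_sqrt_norm_div_sq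
  refine ⟨4 * C₂ + 6 * C₁, by positivity, fun G N hG hc hN => ?_⟩
  have hN0 : 0 ≤ N := by
    have := (norm_nonneg _).trans (hN 1 0)
    simpa using this
  -- For points closer than the scale, the vanishing integral of the kernel difference allows `G z`
  -- to be subtracted from the density.
  have near : ∀ t : ℝ, 0 < t → ∀ z w, ‖z - w‖ ≤ t →
      ‖conv (beurlingKer t) G z - conv (beurlingKer t) G w‖ ≤ 6 * C₁ * N * √‖z - w‖ := by
    intro t ht z w hzw
    have hI := fun x => integrable_conv (continuous_beurlingKer ht) hG hc x
    have e : conv (beurlingKer t) G z - conv (beurlingKer t) G w =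
        ∫ ζ, (beurlingKer t (z - ζ) - beurlingKer t (w - ζ)) * (G ζ - G z) := by
      have h3 : ∫ ζ, (beurlingKer t (z - ζ) - beurlingKer t (w - ζ)) * G z = 0 := by
        rw [integral_mul_const, integral_beurlingKer_sub_trans ht hzw, zero_mul]
      have i3 : Integrable fun ζ => beurlingKer t (z - ζ) * G ζ - beurlingKer t (w - ζ) * G ζ :=
        (hI z).sub (hI w)
      rw [conv, conv, ← integral_sub (hI z) (hI w), ← sub_zero (∫ _, _), ← h3,
        ← integral_sub i3 ((integrable_beurlingKer_sub_trans ht hzw).mul_const _)]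
      congr 1
      funext ζ
      ring
    rw [e]
    have hb := norm_integral_le_of_norm_le
      (((h₁ t ht).1.comp_sub_left z).const_mul (6 * ‖z - w‖ * N))
      (f := fun ζ => (beurlingKer t (z - ζ) - beurlingKer t (w - ζ)) * (G ζ - G z))
      (Eventually.of_forall fun ζ => by
        have a1 := norm_beurlingKer_sub_le ht (a := z - ζ) (b := w - ζ) (by simpa using hzw)
        have a2 := hN ζ z
        rw [norm_sub_rev ζ z] at a2
        rw [sub_sub_sub_cancel_right] at a1
        have := jap_pos ht (z - ζ)
        calc _ ≤ (6 * ‖z - w‖ * (1 / jap t (z - ζ) ^ 3)) * (N * √‖z - ζ‖) := by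
              rw [norm_mul]; gcongr
          _ = _ := by ring)
    refine hb.trans ?_
    rw [integral_const_mul, integral_sub_left_eq_self (fun ζ => √‖ζ‖ * (1 / jap t ζ ^ 3)),
      (h₁ t ht).2]
    have hs : ‖z - w‖ * (√t / t) ≤ √‖z - w‖ := by
      rw [Real.sqrt_div_self', mul_one_div, div_le_iff₀ (Real.sqrt_pos.2 ht),
        ← Real.sqrt_mul (norm_nonneg _)]
      exact Real.le_sqrt_of_sq_le (by rw [sq]; gcongr)
    calc _ = 6 * C₁ * N * (‖z - w‖ * (√t / t)) := by ring
      _ ≤ _ := by gcongr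
  intro t ht z w
  rcases le_or_gt ‖z - w‖ t with hzw | hzw
  · refine (near t ht z w hzw).trans ?_
    have : 0 ≤ C₂ * N * √‖z - w‖ := by positivity
    nlinarith
  · set r := ‖z - w‖ with hr
    have hr0 : 0 < r := ht.trans hzw
    -- For points farther apart than t, the kernel is first coarsened to the scale r equal to their
    -- distance. The mean-zero property again replaces the density by an increment.
    have scale : ∀ x, ‖conv (beurlingKer t) G x - conv (beurlingKer r) G x‖ ≤ 2 * C₂ * N * √r := by
      intro x
      have hk := integrable_beurlingKer_sub_scale ht hzw.le
      have e : conv (beurlingKer t) G x - conv (beurlingKer r) G x =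
          ∫ ζ, (beurlingKer t (x - ζ) - beurlingKer r (x - ζ)) * (G ζ - G x) := by
        have h3 : ∫ ζ, (beurlingKer t (x - ζ) - beurlingKer r (x - ζ)) * G x = 0 := by
          rw [integral_mul_const,
            integral_sub_left_eq_self (fun ζ => beurlingKer t ζ - beurlingKer r ζ),
            integral_beurlingKer_sub_scale, zero_mul]
        have i1 := integrable_conv (continuous_beurlingKer ht) hG hc x
        have i2 := integrable_conv (continuous_beurlingKer hr0) hG hc x
        have i3 : Integrable fun ζ => beurlingKer t (x - ζ) * G ζ - beurlingKer r (x - ζ) * G ζ :=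
          i1.sub i2
        rw [conv, conv, ← integral_sub i1 i2, ← sub_zero (∫ _, _), ← h3,
          ← integral_sub i3 ((hk.comp_sub_left x).mul_const _)]
        congr 1
        funext ζ
        ring
      rw [e]
      have hb := norm_integral_le_of_norm_le
        (((h₂ r hr0).1.comp_sub_left x).const_mul (2 * N))
        (f := fun ζ => (beurlingKer t (x - ζ) - beurlingKer r (x - ζ)) * (G ζ - G x))
        (Eventually.of_forall fun ζ => by
          have a1 := norm_beurlingKer_sub_scale ht hzw.le (x - ζ)
          have a2 := hN ζ x
          rw [norm_sub_rev ζ x] at a2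
          calc _ ≤ (2 * (r ^ 2 / (‖x - ζ‖ ^ 2 * (‖x - ζ‖ ^ 2 + r ^ 2)))) * (N * √‖x - ζ‖) := by
                rw [norm_mul]; gcongr
            _ = _ := by ring)
      refine hb.trans_eq ?_
      rw [integral_const_mul,
        integral_sub_left_eq_self (fun ζ => √‖ζ‖ * (r ^ 2 / (‖ζ‖ ^ 2 * (‖ζ‖ ^ 2 + r ^ 2)))),
        (h₂ r hr0).2]
      ring
    have n1 := near r hr0 z w le_rfl
    have n2 := scale z
    have n3 := scale w
    rw [norm_sub_rev] at n3
    have : conv (beurlingKer t) G z - conv (beurlingKer t) G w =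
        (conv (beurlingKer t) G z - conv (beurlingKer r) G z) +
        (conv (beurlingKer r) G z - conv (beurlingKer r) G w) +
        (conv (beurlingKer r) G w - conv (beurlingKer t) G w) := by ring
    rw [this]
    calc _ ≤ 2 * C₂ * N * √r + 6 * C₁ * N * √r + 2 * C₂ * N * √r :=
          (norm_add₃_le).trans (by gcongr)
      _ = _ := by ring

/-- Extracts half a power of the distance s from the Cauchy kernel difference s/(ab), leaving a
singularity of order 3/2 < 2. By the triangle inequality the larger of a and b is at least s/2. -/
lemma rpow_neg_three_half_bound {a b : ℝ} (ha : 0 < a) (hb : 0 < b) (s : ℝ) (hs : 0 ≤ s)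
    (hab : s ≤ a + b) :
    s / (a * b) ≤ 2 * √s * (a ^ (-(3 / 2) : ℝ) + b ^ (-(3 / 2) : ℝ)) := by
  have key : ∀ x y : ℝ, 0 < x → x ≤ y → s ≤ x + y →
      s / (x * y) ≤ 2 * √s * x ^ (-(3 / 2) : ℝ) := by
    intro x y hx hxy hs'
    have hy := hx.trans_le hxy
    have e : x ^ (-(3 / 2) : ℝ) = 1 / (x * √x) := by
      rw [Real.rpow_neg hx.le, show (3 / 2 : ℝ) = 1 + 1 / 2 by norm_num, Real.rpow_add hx,
        Real.rpow_one, ← Real.sqrt_eq_rpow, one_div]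
    have h1 : √s ≤ 2 * √y := by
      rw [show (2 : ℝ) = √4 by rw [show (4 : ℝ) = 2 ^ 2 by norm_num]; simp, ← Real.sqrt_mul (by norm_num)]
      exact Real.sqrt_le_sqrt (by linarith)
    have h2 : √x ≤ √y := Real.sqrt_le_sqrt hxy
    have hsx := Real.sqrt_pos.2 hx
    have hsy := Real.sqrt_pos.2 hy
    rw [e, mul_one_div, div_le_div_iff₀ (by positivity) (by positivity)]
    calc s * (x * √x) = (√s * √s) * x * √x := by rw [Real.mul_self_sqrt hs]; ring
      _ ≤ (√s * (2 * √y)) * x * √y := by gcongr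
      _ = 2 * √s * (x * (√y * √y)) := by ring
      _ = _ := by rw [Real.mul_self_sqrt hy.le]
  have ha' : 0 ≤ a ^ (-(3 / 2) : ℝ) := by positivity
  have hb' : 0 ≤ b ^ (-(3 / 2) : ℝ) := by positivity
  rcases le_total a b with h | h
  · refine (key a b ha h hab).trans ?_
    have : 0 ≤ 2 * √s := by positivity
    gcongr; linarith
  · rw [mul_comm a b]
    refine (key b a hb h (by linarith)).trans ?_
    have : 0 ≤ 2 * √s := by positivity
    gcongr; linarith

/-- Uniformity in the pole: the kernel is integrable within distance 1 of the pole and at most 1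
beyond. -/
lemma exists_integral_closedBall_rpow : ∃ C, 0 ≤ C ∧ ∀ z : ℂ,
    IntegrableOn (fun ζ => ‖z - ζ‖ ^ (-(3 / 2) : ℝ)) (closedBall 0 1) ∧
      ∫ ζ in closedBall (0 : ℂ) 1, ‖z - ζ‖ ^ (-(3 / 2) : ℝ) ≤ C := by
  set f : ℂ → ℝ := (ball (0 : ℂ) 1).indicator fun z => ‖z‖ ^ (-(3 / 2) : ℝ) with hf
  have hfi : Integrable f :=
    (integrable_indicator_iff measurableSet_ball).2 (integrableOn_norm_rpow_ball (by norm_num) 1)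
  have hf0 : ∀ z, 0 ≤ f z := fun z => indicator_nonneg (fun z _ => by positivity) z
  have hg : Integrable ((closedBall (0 : ℂ) 1).indicator fun _ => (1 : ℝ)) :=
    (integrable_indicator_iff measurableSet_closedBall).2
      (integrableOn_const measure_closedBall_lt_top.ne)
  have hg0 : ∀ z : ℂ, 0 ≤ (closedBall (0 : ℂ) 1).indicator (fun _ => (1 : ℝ)) z :=
    fun z => indicator_nonneg (fun z _ => zero_le_one) z
  refine ⟨(∫ z, f z) + ∫ z, (closedBall (0 : ℂ) 1).indicator (fun _ => (1 : ℝ)) z,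
    add_nonneg (integral_nonneg hf0) (integral_nonneg hg0), fun z => ?_⟩
  have hb : ∀ ζ, ‖(closedBall (0 : ℂ) 1).indicator (fun ζ => ‖z - ζ‖ ^ (-(3 / 2) : ℝ)) ζ‖ ≤
      f (z - ζ) + (closedBall (0 : ℂ) 1).indicator (fun _ => (1 : ℝ)) ζ := by
    intro ζ
    by_cases h : ζ ∈ closedBall (0 : ℂ) 1
    · rw [indicator_of_mem h, indicator_of_mem h, Real.norm_of_nonneg (by positivity)]
      by_cases h2 : z - ζ ∈ ball (0 : ℂ) 1
      · rw [hf, indicator_of_mem h2]; linarith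
      · rw [hf, indicator_of_notMem h2, zero_add]
        exact Real.rpow_le_one_of_one_le_of_nonpos (by simpa using h2) (by norm_num)
    · rw [indicator_of_notMem h, indicator_of_notMem h, norm_zero, add_zero]
      exact hf0 _
  have hi : Integrable fun ζ =>
      f (z - ζ) + (closedBall (0 : ℂ) 1).indicator (fun _ => (1 : ℝ)) ζ :=
    (hfi.comp_sub_left z).add hg
  have hI : Integrable ((closedBall (0 : ℂ) 1).indicator fun ζ => ‖z - ζ‖ ^ (-(3 / 2) : ℝ)) := by
    refine hi.mono' ?_ (Eventually.of_forall hb)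
    exact (Measurable.indicator (by fun_prop) measurableSet_closedBall).aestronglyMeasurable
  refine ⟨(integrable_indicator_iff measurableSet_closedBall).1 hI, ?_⟩
  rw [← integral_indicator measurableSet_closedBall]
  calc _ ≤ ∫ ζ, (f (z - ζ) + (closedBall (0 : ℂ) 1).indicator (fun _ => (1 : ℝ)) ζ) :=
        integral_mono hI hi fun ζ => (Real.le_norm_self _).trans (hb ζ)
    _ = _ := by rw [integral_add (hfi.comp_sub_left z) hg, integral_sub_left_eq_self f]

/-- The regularized Cauchy transforms map bounded functions to Hölder functions, uniformly. -/
lemma exists_holder_conv_cauchyKer : ∃ K, 0 ≤ K ∧ ∀ (F : ℂ → ℂ) (M : ℝ), Continuous F →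
    HasCompactSupport F → (∀ z, 1 < ‖z‖ → F z = 0) → (∀ z, ‖F z‖ ≤ M) → ∀ t : ℝ, 0 < t → ∀ z w,
      ‖conv (cauchyKer t) F z - conv (cauchyKer t) F w‖ ≤ K * M * √‖z - w‖ := by
  obtain ⟨C, hC0, hC⟩ := exists_integral_closedBall_rpow
  refine ⟨4 * C, by positivity, fun F M hF hc hs hM t ht z w => ?_⟩
  have hM0 : 0 ≤ M := (norm_nonneg _).trans (hM 0)
  have hI := fun x => integrable_conv (continuous_cauchyKer ht) hF hc x
  rw [conv, conv, ← integral_sub (hI z) (hI w)]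
  have hb : ∀ᵐ ζ : ℂ, ‖cauchyKer t (z - ζ) * F ζ - cauchyKer t (w - ζ) * F ζ‖ ≤
      2 * M * √‖z - w‖ * (closedBall (0 : ℂ) 1).indicator (fun ζ =>
        ‖z - ζ‖ ^ (-(3 / 2) : ℝ) + ‖w - ζ‖ ^ (-(3 / 2) : ℝ)) ζ := by
    have hz : ∀ᵐ ζ : ℂ, ζ ≠ z := by simp [ae_iff]
    have hw : ∀ᵐ ζ : ℂ, ζ ≠ w := by simp [ae_iff]
    filter_upwards [hz, hw] with ζ hz hw
    by_cases h : ζ ∈ closedBall (0 : ℂ) 1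
    · rw [indicator_of_mem h, ← sub_mul, norm_mul]
      have a0 : 0 < ‖z - ζ‖ := norm_pos_iff.2 (sub_ne_zero.2 hz.symm)
      have b0 : 0 < ‖w - ζ‖ := norm_pos_iff.2 (sub_ne_zero.2 hw.symm)
      have h1 := norm_cauchyKer_sub_le ht (z - ζ) (w - ζ)
      rw [sub_sub_sub_cancel_right] at h1
      have h2 : ‖z - w‖ / (jap t (z - ζ) * jap t (w - ζ)) ≤ ‖z - w‖ / (‖z - ζ‖ * ‖w - ζ‖) := by
        have := mul_le_mul (norm_le_jap t (z - ζ)) (norm_le_jap t (w - ζ)) (norm_nonneg _)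
          (jap_pos ht _).le
        gcongr
      have h3 := rpow_neg_three_half_bound a0 b0 ‖z - w‖ (norm_nonneg _) (by
        have := norm_sub_le (z - ζ) (w - ζ); rwa [sub_sub_sub_cancel_right] at this)
      calc _ ≤ (2 * √‖z - w‖ * (‖z - ζ‖ ^ (-(3 / 2) : ℝ) + ‖w - ζ‖ ^ (-(3 / 2) : ℝ))) * M := by
            gcongr
            · exact h1.trans (h2.trans h3)
            · exact hM ζ
        _ = _ := by ring
    · rw [indicator_of_notMem h, hs ζ (by simpa using h)]
      simp
  have hi := ((hC z).1.add (hC w).1)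
  have hi' : Integrable ((closedBall (0 : ℂ) 1).indicator (fun ζ =>
        ‖z - ζ‖ ^ (-(3 / 2) : ℝ) + ‖w - ζ‖ ^ (-(3 / 2) : ℝ))) :=
    (integrable_indicator_iff measurableSet_closedBall).2 hi
  refine (norm_integral_le_of_norm_le (hi'.const_mul _) hb).trans ?_
  rw [integral_const_mul, integral_indicator measurableSet_closedBall,
    integral_add (hC z).1 (hC w).1]
  have := (hC z).2
  have := (hC w).2
  calc _ ≤ 2 * M * √‖z - w‖ * (C + C) := by gcongr
    _ = _ := by ring

/-! ### Wirtinger derivatives -/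

/-- The operator `(∂₁ + c ∂₂) / 2`. -/
noncomputable def wirt (c : ℂ) (f : ℂ → ℂ) (z : ℂ) : ℂ :=
  (fderiv ℝ f z 1 + c * fderiv ℝ f z Complex.I) / 2

/-- The Wirtinger derivative `∂f/∂z`. -/
noncomputable abbrev dz (f : ℂ → ℂ) (z : ℂ) : ℂ := wirt (-Complex.I) f z

/-- The Wirtinger derivative `∂f/∂z̄`. -/
noncomputable abbrev dzbar (f : ℂ → ℂ) (z : ℂ) : ℂ := wirt Complex.I f z

lemma continuous_fderiv_apply {f : ℂ → ℂ} (hf : ContDiff ℝ 1 f) (e : ℂ) :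
    Continuous fun z => fderiv ℝ f z e :=
  (hf.continuous_fderiv (by simp)).clm_apply continuous_const

lemma continuous_wirt {f : ℂ → ℂ} (hf : ContDiff ℝ 1 f) (c : ℂ) : Continuous (wirt c f) := by
  have := continuous_fderiv_apply hf 1
  have := continuous_fderiv_apply hf Complex.I
  unfold wirt
  fun_prop

lemma HasCompactSupport.wirt {f : ℂ → ℂ} (hf : HasCompactSupport f) (c : ℂ) :
    HasCompactSupport (wirt c f) := by
  refine (hf.fderiv (𝕜 := ℝ)).mono fun z hz => ?_
  contrapose! hz
  simp [_root_.wirt, Function.notMem_support.1 hz]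

lemma norm_wirt_le {c : ℂ} (hc : ‖c‖ = 1) (f : ℂ → ℂ) (z : ℂ) : ‖wirt c f z‖ ≤ ‖fderiv ℝ f z‖ := by
  rw [wirt, norm_div, RCLike.norm_ofNat, div_le_iff₀ two_pos]
  have h1 := (fderiv ℝ f z).le_opNorm 1
  have h2 := (fderiv ℝ f z).le_opNorm Complex.I
  rw [norm_one, mul_one] at h1
  rw [Complex.norm_I, mul_one] at h2
  calc _ ≤ ‖fderiv ℝ f z 1‖ + ‖c * fderiv ℝ f z Complex.I‖ := norm_add_le _ _
    _ ≤ _ := by rw [norm_mul, hc, one_mul]; linarith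

lemma wirt_mul {f g : ℂ → ℂ} {z : ℂ} (c : ℂ) (hf : DifferentiableAt ℝ f z)
    (hg : DifferentiableAt ℝ g z) :
    wirt c (fun z => f z * g z) z = wirt c f z * g z + f z * wirt c g z := by
  simp only [wirt, fderiv_fun_mul hf hg, _root_.add_apply,
    _root_.smul_apply, smul_eq_mul]; ring

lemma fderiv_conj_apply {f : ℂ → ℂ} {z : ℂ} (hf : DifferentiableAt ℝ f z) (e : ℂ) :
    fderiv ℝ (fun z => conj (f z)) z e = conj (fderiv ℝ f z e) := by
  have := (Complex.conjCLE.toContinuousLinearMap.hasFDerivAt (x := f z)).comp z hf.hasFDerivAt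
  have h2 : (Complex.conjCLE.toContinuousLinearMap ∘ f) = fun z => conj (f z) := by
    funext z; simp
  rw [h2] at this
  rw [this.fderiv]
  simp

lemma wirt_conj {f : ℂ → ℂ} {z : ℂ} (c : ℂ) (hf : DifferentiableAt ℝ f z) :
    wirt c (fun z => conj (f z)) z = conj (wirt (conj c) f z) := by
  simp [wirt, fderiv_conj_apply hf, map_ofNat]

lemma contDiff_conj {f : ℂ → ℂ} {n : WithTop ℕ∞} (hf : ContDiff ℝ n f) :
    ContDiff ℝ n fun z => conj (f z) :=
  Complex.conjCLE.contDiff.comp hf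

lemma fderiv_div_apply {f g : ℂ → ℂ} {z : ℂ} (hf : DifferentiableAt ℝ f z)
    (hg : DifferentiableAt ℝ g z) (h : g z ≠ 0) (e : ℂ) :
    fderiv ℝ (fun z => f z / g z) z e =
      (fderiv ℝ f z e * g z - f z * fderiv ℝ g z e) / g z ^ 2 := by
  have h1 := ((hasDerivAt_inv h).hasFDerivAt.restrictScalars ℝ).comp z hg.hasFDerivAt
  have h2 := hf.hasFDerivAt.fun_mul h1
  have h3 : (fun z => f z / g z) = fun z => f z * (Inv.inv ∘ g) z := by
    funext z; simp [div_eq_mul_inv]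
  rw [h3, h2.fderiv]
  simp
  field_simp
  ring

/-! ### Integration by parts for convolutions -/

lemma differentiable_conj : Differentiable ℝ fun z : ℂ => conj z :=
  (contDiff_conj contDiff_id).differentiable one_ne_zero

lemma fderiv_conj_id (z e : ℂ) : fderiv ℝ (fun z : ℂ => conj z) z e = conj e := by
  have := fderiv_conj_apply (f := id) (z := z) differentiableAt_id e
  simpa using this

lemma fderiv_denom (t : ℝ) (z e : ℂ) :
    fderiv ℝ (fun z : ℂ => z * conj z + (t : ℂ) ^ 2) z e = e * conj z + z * conj e := by
  rw [fderiv_add_const, fderiv_fun_mul differentiableAt_fun_id (differentiable_conj z)]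
  simp [fderiv_conj_id]
  ring

lemma contDiff_cauchyKer {t : ℝ} (ht : 0 < t) {n : WithTop ℕ∞} : ContDiff ℝ n (cauchyKer t) := by
  have h := contDiff_conj (contDiff_id (𝕜 := ℝ) (E := ℂ) (n := n))
  rw [show cauchyKer t = fun z => conj z * (z * conj z + (t : ℂ) ^ 2)⁻¹ from rfl]
  exact h.mul (((contDiff_id.mul h).add contDiff_const).inv (denom_ne ht))

lemma contDiff_moll {t : ℝ} (ht : 0 < t) {n : WithTop ℕ∞} : ContDiff ℝ n (moll t) := by
  have h := contDiff_conj (contDiff_id (𝕜 := ℝ) (E := ℂ) (n := n))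
  rw [show moll t = fun z => (t : ℂ) ^ 2 * ((z * conj z + (t : ℂ) ^ 2) ^ 2)⁻¹ from rfl]
  exact contDiff_const.mul ((((contDiff_id.mul h).add contDiff_const).pow 2).inv
    (fun z => pow_ne_zero 2 (denom_ne ht z)))

lemma contDiff_beurlingKer {t : ℝ} (ht : 0 < t) {n : WithTop ℕ∞} :
    ContDiff ℝ n (beurlingKer t) := ((contDiff_cauchyKer ht).pow 2).neg

lemma differentiable_denom (t : ℝ) : Differentiable ℝ fun z : ℂ => z * conj z + (t : ℂ) ^ 2 :=
  (differentiable_id.mul differentiable_conj).add_const _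

lemma fderiv_cauchyKer {t : ℝ} (ht : 0 < t) (z e : ℂ) : fderiv ℝ (cauchyKer t) z e =
    ((t : ℂ) ^ 2 * conj e - conj z ^ 2 * e) / (z * conj z + (t : ℂ) ^ 2) ^ 2 := by
  unfold cauchyKer
  rw [fderiv_div_apply (differentiable_conj z) (differentiable_denom t z) (denom_ne ht z),
    fderiv_conj_id, fderiv_denom]
  congr 1
  ring

lemma dzbar_cauchyKer {t : ℝ} (ht : 0 < t) : dzbar (cauchyKer t) = moll t := by
  funext z
  have := denom_ne ht z
  simp only [wirt, fderiv_cauchyKer ht, moll, map_one, Complex.conj_I]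
  field_simp
  ring_nf
  simp only [Complex.I_sq]
  ring

lemma dz_cauchyKer {t : ℝ} (ht : 0 < t) : dz (cauchyKer t) = beurlingKer t := by
  funext z
  have := denom_ne ht z
  simp only [wirt, fderiv_cauchyKer ht, beurlingKer, cauchyKer, map_one, Complex.conj_I]
  field_simp
  ring_nf
  simp only [Complex.I_sq]
  ring

/-- Both sides are the mixed derivative ∂∂̄ of `cauchyKer`. This identity lets the regularized
Beurling transform send ∂̄U to a mollification of ∂U. -/
lemma dz_moll {t : ℝ} (ht : 0 < t) : dz (moll t) = dzbar (beurlingKer t) := by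
  funext z
  have h0 := denom_ne ht z
  have h1 : ∀ e, fderiv ℝ (moll t) z e =
      -2 * (t : ℂ) ^ 2 * (e * conj z + z * conj e) / (z * conj z + (t : ℂ) ^ 2) ^ 3 := fun e => by
    unfold moll
    have hd := differentiable_denom t z
    rw [fderiv_div_apply (f := fun _ => (t : ℂ) ^ 2)
      (g := fun z => (z * conj z + (t : ℂ) ^ 2) ^ 2) (by fun_prop) (hd.fun_pow 2)
      (pow_ne_zero 2 h0)]
    have : fderiv ℝ (fun z : ℂ => (z * conj z + (t : ℂ) ^ 2) ^ 2) z e =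
        2 * (z * conj z + (t : ℂ) ^ 2) * (e * conj z + z * conj e) := by
      simp only [sq (_ + _)]
      rw [fderiv_fun_mul hd hd]
      simp only [_root_.add_apply, _root_.smul_apply, smul_eq_mul,
        fderiv_denom]
      ring
    rw [this]
    simp only [fderiv_fun_const, Pi.zero_apply, _root_.zero_apply]
    field_simp
    ring
  have h2 : dzbar (beurlingKer t) z = -2 * cauchyKer t z * moll t z := by
    have hc := (contDiff_cauchyKer ht (n := 1)).differentiable one_ne_zero z
    have : beurlingKer t = fun z => (-1) * (cauchyKer t z * cauchyKer t z) := by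
      funext z; simp [beurlingKer]; ring
    rw [this, dzbar, wirt_mul (f := fun _ => -1) (g := fun z => cauchyKer t z * cauchyKer t z) _
      (by fun_prop) (hc.fun_mul hc), wirt_mul _ hc hc, ← dzbar_cauchyKer ht]
    simp [wirt]
    ring
  rw [h2]
  simp only [wirt, h1, cauchyKer, moll, map_one, Complex.conj_I]
  field_simp
  ring_nf
  simp only [Complex.I_sq]
  ring

lemma conv_fderiv_of_integrable {K U : ℂ → ℂ} {e z : ℂ} (hK : Differentiable ℝ K)
    (hU : Differentiable ℝ U) (h1 : Integrable fun ζ => fderiv ℝ K (z - ζ) e * U ζ)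
    (h2 : Integrable fun ζ => K (z - ζ) * fderiv ℝ U ζ e)
    (h3 : Integrable fun ζ => K (z - ζ) * U ζ) :
    ∫ ζ, K (z - ζ) * fderiv ℝ U ζ e = ∫ ζ, fderiv ℝ K (z - ζ) e * U ζ := by
  have hd : ∀ ζ, fderiv ℝ (fun ζ => K (z - ζ)) ζ e = -fderiv ℝ K (z - ζ) e := fun ζ => by
    have h := (hK (z - ζ)).hasFDerivAt.comp ζ ((hasFDerivAt_id (𝕜 := ℝ) ζ).const_sub z)
    have h' : HasFDerivAt (fun ζ => K (z - ζ)) _ ζ := h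
    rw [h'.fderiv]
    simp
  have := integral_mul_fderiv_eq_neg_fderiv_mul_of_integrable (μ := (volume : Measure ℂ))
    (f := fun ζ => K (z - ζ)) (g := U) (v := e)
    (by simp only [hd, neg_mul]; exact h1.neg) h2 h3
    (fun x _ => (hK (z - x)).comp x (by fun_prop)) (fun x _ => hU x)
  rw [this]
  simp only [hd, neg_mul]
  rw [integral_neg, neg_neg]

lemma conv_wirt_of_integrable {K U : ℂ → ℂ} (c : ℂ) {z : ℂ} (hK : Differentiable ℝ K)
    (hU : Differentiable ℝ U) (h1 : ∀ e, Integrable fun ζ => fderiv ℝ K (z - ζ) e * U ζ)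
    (h2 : ∀ e, Integrable fun ζ => K (z - ζ) * fderiv ℝ U ζ e)
    (h3 : Integrable fun ζ => K (z - ζ) * U ζ) :
    conv K (wirt c U) z = conv (wirt c K) U z := by
  have e1 := conv_fderiv_of_integrable hK hU (h1 1) (h2 1) h3
  have e2 := conv_fderiv_of_integrable hK hU (h1 Complex.I) (h2 Complex.I) h3
  have i1 : conv K (wirt c U) z = ((∫ ζ, K (z - ζ) * fderiv ℝ U ζ 1) +
      c * ∫ ζ, K (z - ζ) * fderiv ℝ U ζ Complex.I) / 2 := by
    rw [conv, ← integral_const_mul, ← integral_add (h2 1) ((h2 Complex.I).const_mul c),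
      ← integral_div]
    congr 1; funext ζ; simp only [wirt]; ring
  have i2 : conv (wirt c K) U z = ((∫ ζ, fderiv ℝ K (z - ζ) 1 * U ζ) +
      c * ∫ ζ, fderiv ℝ K (z - ζ) Complex.I * U ζ) / 2 := by
    rw [conv, ← integral_const_mul, ← integral_add (h1 1) ((h1 Complex.I).const_mul c),
      ← integral_div]
    congr 1; funext ζ; simp only [wirt]; ring
  rw [i1, i2, e1, e2]

lemma conv_wirt {K U : ℂ → ℂ} (c : ℂ) (z : ℂ) (hK : ContDiff ℝ 1 K) (hU : ContDiff ℝ 1 U)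
    (hc : HasCompactSupport U) : conv K (wirt c U) z = conv (wirt c K) U z :=
  conv_wirt_of_integrable c (hK.differentiable one_ne_zero) (hU.differentiable one_ne_zero)
    (fun e => integrable_conv (continuous_fderiv_apply hK e) hU.continuous hc z)
    (fun e => integrable_conv hK.continuous (continuous_fderiv_apply hU e) (hc.fderiv_apply ℝ e) z)
    (integrable_conv hK.continuous hU.continuous hc z)

lemma conv_add {K F G : ℂ → ℂ} {z : ℂ} (hF : Integrable fun ζ => K (z - ζ) * F ζ)
    (hG : Integrable fun ζ => K (z - ζ) * G ζ) :
    conv K (fun ζ => F ζ + G ζ) z = conv K F z + conv K G z := by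
  simp only [conv, mul_add]; exact integral_add hF hG

/-! ### The approximate identity -/

/-- The total mass of `moll`. -/
noncomputable def mollMass : ℂ := ∫ w, moll 1 w

lemma integrable_moll_one : Integrable (moll 1) := by
  refine integrable_inv_jap_pow_three.mono' (continuous_moll one_pos).aestronglyMeasurable
    (Eventually.of_forall fun z => ?_)
  have h0 := jap_pos one_pos z
  have h1 := le_jap (t := 1) z
  rw [norm_moll, one_pow]
  exact one_div_le_one_div_of_le (by positivity) (pow_le_pow_right₀ h1 (by norm_num))

lemma moll_eq_ofReal (t : ℝ) (z : ℂ) : moll t z = ((t ^ 2 / jap t z ^ 4 : ℝ) : ℂ) := by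
  rw [moll, denom_eq]; push_cast; ring

/-- Only nonvanishing matters: the mass enters as a normalizing factor to be divided out, so its
value is never computed. -/
lemma mollMass_ne_zero : mollMass ≠ 0 := by
  have h : mollMass = ((∫ w : ℂ, 1 / jap 1 w ^ 4 : ℝ) : ℂ) := by
    rw [mollMass]
    refine Eq.trans ?_ integral_ofReal
    congr 1; funext w; simp [moll_eq_ofReal]
  rw [h]
  have hi : Integrable fun w : ℂ => 1 / jap 1 w ^ 4 := by
    have := integrable_moll_one.norm
    simpa [norm_moll] using this
  have : 0 < ∫ w : ℂ, 1 / jap 1 w ^ 4 := by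
    rw [integral_pos_iff_support_of_nonneg (fun w => by have := jap_pos one_pos w; positivity) hi]
    have : (Function.support fun w : ℂ => 1 / jap 1 w ^ 4) = univ := by
      ext w
      have := jap_pos one_pos w
      simp [this.ne']
    rw [this]
    simp
  exact_mod_cast this.ne'

lemma moll_smul {t : ℝ} (ht : 0 < t) (w : ℂ) : moll t (t • w) = ((t ^ 2)⁻¹ : ℝ) * moll 1 w := by
  have h0 := jap_pos one_pos w
  rw [moll_eq_ofReal, moll_eq_ofReal, jap_smul ht, smul_smul, inv_mul_cancel₀ ht.ne', one_smul,
    ← Complex.ofReal_mul]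
  congr 1
  field_simp

lemma tendsto_conv_moll {U : ℂ → ℂ} (hU : Continuous U) {B : ℝ} (hB : ∀ z, ‖U z‖ ≤ B) (z : ℂ) :
    Tendsto (fun t => conv (moll t) U z) (𝓝[>] 0) (𝓝 (mollMass * U z)) := by
  have e : ∀ t : ℝ, 0 < t → conv (moll t) U z = ∫ w, moll 1 w * U (z - t • w) := by
    intro t ht
    have h1 : conv (moll t) U z = ∫ ζ, moll t ζ * U (z - ζ) := by
      rw [conv, ← integral_sub_left_eq_self _ volume z]
      simp
    have h2 := Measure.integral_comp_smul (volume : Measure ℂ)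
      (fun ζ => moll t ζ * U (z - ζ)) t
    rw [Complex.finrank_real_complex, abs_of_pos (by positivity)] at h2
    simp only [moll_smul ht, mul_assoc] at h2
    rw [integral_const_mul] at h2
    rw [h1]
    have h3 : (((t ^ 2)⁻¹ : ℝ) : ℂ) ≠ 0 := by
      exact_mod_cast (inv_pos.2 (pow_pos ht 2)).ne'
    rw [Complex.real_smul] at h2
    exact (mul_left_cancel₀ h3 h2).symm
  have h : Tendsto (fun t : ℝ => ∫ w, moll 1 w * U (z - t • w)) (𝓝[>] 0)
      (𝓝 (∫ w, moll 1 w * U z)) := by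
    refine tendsto_integral_filter_of_dominated_convergence (fun w => ‖moll 1 w‖ * B) ?_ ?_
      (integrable_moll_one.norm.mul_const B) ?_
    · refine Eventually.of_forall fun t => ?_
      have := continuous_moll one_pos
      exact Continuous.aestronglyMeasurable (by fun_prop)
    · refine Eventually.of_forall fun t => Eventually.of_forall fun w => ?_
      rw [norm_mul]
      gcongr
      exact hB _
    · refine Eventually.of_forall fun w => ?_
      have : Continuous fun t : ℝ => moll 1 w * U (z - t • w) := by fun_prop
      have h := this.tendsto 0
      simp only [zero_smul, sub_zero] at h
      exact h.mono_left nhdsWithin_le_nhds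
  rw [integral_mul_const] at h
  refine h.congr' ?_
  filter_upwards [self_mem_nhdsWithin] with t ht using (e t ht).symm

/-! ### A priori estimates for compactly supported solutions of the Beltrami system -/

/-- Hölder continuity of exponent `1/2` with constant `N`. -/
def HolderHalf (N : ℝ) (f : ℂ → ℂ) : Prop := ∀ z w, ‖f z - f w‖ ≤ N * √‖z - w‖

lemma HolderHalf.nonneg {N : ℝ} {f : ℂ → ℂ} (h : HolderHalf N f) : 0 ≤ N := by
  have := (norm_nonneg _).trans (h 1 0)
  simpa using this

/-- Iterating N ↦ N/2 + B from any finite starting constant converges to the fixed point 2B. The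
starting constant disappears, so qualitative regularity becomes a quantitative bound. -/
lemma HolderHalf.absorb {N₀ B : ℝ} {f : ℂ → ℂ} (h₀ : HolderHalf N₀ f)
    (h : ∀ N, HolderHalf N f → HolderHalf (N / 2 + B) f) : HolderHalf (2 * B) f := by
  have key : ∀ n : ℕ, HolderHalf (2 * B + (N₀ - 2 * B) * (1 / 2) ^ n) f := by
    intro n
    induction n with
    | zero => simpa using h₀
    | succ n ih =>
      convert h _ ih using 1
      ring
  intro z w
  have hl : Tendsto (fun n : ℕ => (2 * B + (N₀ - 2 * B) * (1 / 2) ^ n) * √‖z - w‖) atTop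
      (𝓝 ((2 * B + (N₀ - 2 * B) * 0) * √‖z - w‖)) :=
    ((tendsto_const_nhds.add (tendsto_const_nhds.mul
      (tendsto_pow_atTop_nhds_zero_of_lt_one (by norm_num) (by norm_num)))).mul_const _)
  have := ge_of_tendsto hl (Eventually.of_forall fun n => key n z w)
  simpa using this

/-- Comparison with the point 3, where f vanishes and whose distance to the unit disc is at most 4 =
2². -/
lemma HolderHalf.bound {N : ℝ} {f : ℂ → ℂ} (h : HolderHalf N f)
    (hs : ∀ z, 1 < ‖z‖ → f z = 0) (z : ℂ) : ‖f z‖ ≤ 2 * N := by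
  by_cases hz : 1 < ‖z‖
  · rw [hs z hz, norm_zero]; have := h.nonneg; positivity
  · have h3 := h z 3
    rw [hs 3 (by norm_num), sub_zero] at h3
    have h4 : ‖z - 3‖ ≤ 4 := by
      refine (norm_sub_le _ _).trans ?_
      norm_num; linarith
    have h5 : √‖z - 3‖ ≤ 2 := by
      rw [Real.sqrt_le_left (by norm_num)]; linarith
    have := h.nonneg
    nlinarith

lemma hasCompactSupport_of_eq_zero {f : ℂ → ℂ} (hs : ∀ z, 1 < ‖z‖ → f z = 0) :
    HasCompactSupport f :=
  HasCompactSupport.intro (isCompact_closedBall 0 1) fun z hz => hs z (by simpa using hz)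

lemma wirt_eq_zero {f : ℂ → ℂ} (hs : ∀ z, 1 < ‖z‖ → f z = 0) (c : ℂ) {z : ℂ} (hz : 1 < ‖z‖) :
    wirt c f z = 0 := by
  have : f =ᶠ[𝓝 z] fun _ => 0 := by
    filter_upwards [(isOpen_lt continuous_const continuous_norm).mem_nhds hz] with y hy
      using hs y hy
  simp [wirt, this.fderiv_eq]

lemma le_sqrt_of_le_one {s : ℝ} (h0 : 0 ≤ s) (h1 : s ≤ 1) : s ≤ √s :=
  Real.le_sqrt_of_sq_le (by nlinarith)

/-- A bounded Lipschitz function is Hölder. -/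
lemma sub_le_sqrt_of_lipschitz {f : ℂ → ℂ} {L B : ℝ} (hL : 0 ≤ L) {z w : ℂ}
    (h1 : ‖f z - f w‖ ≤ L * ‖z - w‖) (hz : ‖f z‖ ≤ B) (hw : ‖f w‖ ≤ B) :
    ‖f z - f w‖ ≤ max L (2 * B) * √‖z - w‖ := by
  rcases le_total ‖z - w‖ 1 with h | h
  · calc _ ≤ L * ‖z - w‖ := h1
      _ ≤ max L (2 * B) * √‖z - w‖ := by
        gcongr
        exacts [le_max_left _ _, le_sqrt_of_le_one (norm_nonneg _) h]
  · have h2 : 1 ≤ √‖z - w‖ := by rw [Real.one_le_sqrt]; exact h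
    calc _ ≤ 2 * B := (norm_sub_le _ _).trans (by linarith)
      _ ≤ max L (2 * B) * 1 := by rw [mul_one]; exact le_max_right _ _
      _ ≤ _ := by gcongr

lemma lipschitz_of_fderiv_le {f : ℂ → ℂ} (hf : Differentiable ℝ f) {L : ℝ}
    (h : ∀ z, ‖fderiv ℝ f z‖ ≤ L) (z w : ℂ) : ‖f z - f w‖ ≤ L * ‖z - w‖ :=
  Convex.norm_image_sub_le_of_norm_fderiv_le (𝕜 := ℝ) (fun x _ => hf x) (fun x _ => h x)
    convex_univ (mem_univ w) (mem_univ z)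

lemma HolderHalf.of_contDiff {f : ℂ → ℂ} (hf : ContDiff ℝ 1 f) (hc : HasCompactSupport f) :
    ∃ N, HolderHalf N f := by
  obtain ⟨B, hB⟩ := hc.exists_bound_of_continuous hf.continuous
  obtain ⟨L, hL⟩ := (hc.fderiv (𝕜 := ℝ)).exists_bound_of_continuous
    (hf.continuous_fderiv (by simp))
  exact ⟨max L (2 * B), fun z w => sub_le_sqrt_of_lipschitz ((norm_nonneg _).trans (hL 0))
    (lipschitz_of_fderiv_le (hf.differentiable one_ne_zero) hL z w)
    (hB z) (hB w)⟩

/-- Multiplication by a coefficient that is small in `C¹` makes Hölder constants small. -/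
lemma HolderHalf.small_mul {ε N : ℝ} {μ f : ℂ → ℂ} (hμ : Differentiable ℝ μ)
    (h1 : ∀ z, ‖μ z‖ ≤ ε) (h2 : ∀ z, ‖fderiv ℝ μ z‖ ≤ ε) (hf : HolderHalf N f)
    (hs : ∀ z, 1 < ‖z‖ → f z = 0) : HolderHalf (5 * ε * N) fun z => μ z * f z := by
  intro z w
  have hN := hf.nonneg
  have hε : 0 ≤ ε := (norm_nonneg _).trans (h1 0)
  have h3 := sub_le_sqrt_of_lipschitz hε (lipschitz_of_fderiv_le hμ h2 z w) (h1 z) (h1 w)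
  rw [max_eq_right (by linarith)] at h3
  have e : μ z * f z - μ w * f w = μ z * (f z - f w) + (μ z - μ w) * f w := by ring
  rw [e]
  calc _ ≤ ‖μ z‖ * ‖f z - f w‖ + ‖μ z - μ w‖ * ‖f w‖ := by
        refine (norm_add_le _ _).trans_eq ?_; rw [norm_mul, norm_mul]
    -- The coefficient has Hölder constant 2ε, being bounded and Lipschitz with constant ε, and f is
    -- bounded by 2N; together 5 = 1 + 2·2.
    _ ≤ ε * (N * √‖z - w‖) + (2 * ε * √‖z - w‖) * (2 * N) := by
        gcongr
        exacts [h1 z, hf z w, hf.bound hs w]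
    _ = _ := by ring

lemma HolderHalf.conj {N : ℝ} {f : ℂ → ℂ} (hf : HolderHalf N f) :
    HolderHalf N fun z => conj (f z) := fun z w => by
  rw [← map_sub, RCLike.norm_conj]; exact hf z w

lemma HolderHalf.add {N M : ℝ} {f g : ℂ → ℂ} (hf : HolderHalf N f) (hg : HolderHalf M g) :
    HolderHalf (N + M) fun z => f z + g z := fun z w => by
  rw [add_sub_add_comm, add_mul]
  exact (norm_add_le _ _).trans (add_le_add (hf z w) (hg z w))

lemma HolderHalf.mono {N M : ℝ} {f : ℂ → ℂ} (hf : HolderHalf N f) (h : N ≤ M) :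
    HolderHalf M f := fun z w => (hf z w).trans (by gcongr)

/-- The Beltrami operator of `μ`. -/
noncomputable def beltrami (μ U : ℂ → ℂ) (z : ℂ) : ℂ :=
  dzbar U z - (μ z * dz U z + conj (μ z * dz U z))

lemma holderHalf_of_tendsto_conv {f : ℂ → ℂ} {B : ℝ} {g : ℝ → ℂ → ℂ}
    (hl : ∀ z, Tendsto (fun t => g t z) (𝓝[>] 0) (𝓝 (mollMass * f z)))
    (hg : ∀ t, 0 < t → HolderHalf B (g t)) : HolderHalf (B / ‖mollMass‖) f := by
  intro z w
  have hm : 0 < ‖mollMass‖ := norm_pos_iff.2 mollMass_ne_zero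
  have h := le_of_tendsto ((hl z).sub (hl w)).norm
    (by filter_upwards [self_mem_nhdsWithin] with t ht using hg t ht z w)
  rw [← mul_sub, norm_mul] at h
  rw [div_mul_eq_mul_div, le_div_iff₀ hm]
  linarith

/-- In divergence form the equation reads ∂̄U = ∂(μU) + ∂̄(conj(μU)) + F with F bounded. Inverting
∂̄ expresses U through the Beurling transform of μU, the function conj(μU) itself and the Cauchy
transform of F. No derivative of U has to be estimated, so a bounded right-hand side suffices, and
smallness of μ permits absorption. -/
lemma exists_holder_of_beltrami_bounded : ∃ ε₀ > 0, ∃ C, 0 ≤ C ∧ ∀ (U μ : ℂ → ℂ) (ε M : ℝ),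
    ContDiff ℝ 1 U → (∀ z, 1 < ‖z‖ → U z = 0) → ContDiff ℝ 1 μ → ε ≤ ε₀ → (∀ z, ‖μ z‖ ≤ ε) →
    (∀ z, ‖fderiv ℝ μ z‖ ≤ ε) → (∀ z, ‖beltrami μ U z‖ ≤ M) → HolderHalf (C * M) U := by
  obtain ⟨K₁, hK₁, k₁⟩ := exists_holder_conv_beurlingKer
  obtain ⟨K₂, hK₂, k₂⟩ := exists_holder_conv_cauchyKer
  set m := ‖mollMass‖ with hm
  have hm0 : 0 < m := norm_pos_iff.2 mollMass_ne_zero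
  -- The total coefficient of εN below: 5 from conj(μU), 5K₁ from the Beurling transform of μU, 4K₂
  -- from the part of F containing ∂μ.
  set D := 5 + (5 * K₁ + 4 * K₂) / m with hD
  have hD0 : 0 < D := by positivity
  refine ⟨1 / (2 * D), by positivity, 2 * (K₂ / m), by positivity, ?_⟩
  intro U μ ε M hU hs hμ hε hμ1 hμ2 hH
  have hε0 : 0 ≤ ε := (norm_nonneg _).trans (hμ1 0)
  have hM0 : 0 ≤ M := (norm_nonneg _).trans (hH 0)
  have hc := hasCompactSupport_of_eq_zero hs
  have hUd := hU.differentiable one_ne_zero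
  have hμd := hμ.differentiable one_ne_zero
  obtain ⟨N₀, hN₀⟩ := HolderHalf.of_contDiff hU hc
  rw [mul_assoc]
  refine hN₀.absorb fun N hN => ?_
  set G : ℂ → ℂ := fun z => μ z * U z with hG
  have hGc : ContDiff ℝ 1 G := hμ.mul hU
  have hGs : ∀ z, 1 < ‖z‖ → G z = 0 := fun z hz => by simp [hG, hs z hz]
  have hGsc := hasCompactSupport_of_eq_zero hGs
  have hGH : HolderHalf (5 * ε * N) G := hN.small_mul hμd hμ1 hμ2 hs
  set G' : ℂ → ℂ := fun z => conj (G z) with hG'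
  have hG'c : ContDiff ℝ 1 G' := contDiff_conj hGc
  have hG's : ∀ z, 1 < ‖z‖ → G' z = 0 := fun z hz => by simp [hG', hGs z hz]
  have hG'sc := hasCompactSupport_of_eq_zero hG's
  set F : ℂ → ℂ := fun z => dzbar U z - dz G z - dzbar G' z with hF
  have hFc : Continuous F :=
    ((continuous_wirt hU _).sub (continuous_wirt hGc _)).sub (continuous_wirt hG'c _)
  have hFs : ∀ z, 1 < ‖z‖ → F z = 0 := fun z hz => by
    simp [hF, wirt_eq_zero hs _ hz, wirt_eq_zero hGs _ hz, wirt_eq_zero hG's _ hz]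
  have hFsc := hasCompactSupport_of_eq_zero hFs
  have hFb : ∀ z, ‖F z‖ ≤ M + 4 * ε * N := by
    intro z
    have e1 : dz G z = dz μ z * U z + μ z * dz U z := wirt_mul _ (hμd z) (hUd z)
    -- Conjugation exchanges ∂ and ∂̄, which brings the conjugated term of the system into
    -- divergence form as well.
    have e2 : dzbar G' z = conj (dz G z) := by
      rw [hG', dzbar, wirt_conj _ (hGc.differentiable one_ne_zero z)]; simp
    have e3 : F z = beltrami μ U z - (dz μ z * U z + conj (dz μ z * U z)) := by
      simp only [hF, e2, e1, beltrami, map_add]; ring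
    have h1 : ‖dz μ z * U z‖ ≤ ε * (2 * N) := by
      rw [norm_mul]
      have : 0 ≤ N := hN.nonneg
      gcongr
      · exact (norm_wirt_le (by simp) _ _).trans (hμ2 z)
      · exact hN.bound hs z
    rw [e3]
    calc _ ≤ ‖beltrami μ U z‖ + (‖dz μ z * U z‖ + ‖conj (dz μ z * U z)‖) :=
          (norm_sub_le _ _).trans (by gcongr; exact norm_add_le _ _)
      _ ≤ M + (ε * (2 * N) + ε * (2 * N)) := by
          rw [RCLike.norm_conj]; gcongr; exact hH z
      _ = _ := by ring
  have hid : ∀ t, 0 < t → ∀ z, conv (moll t) U z - conv (moll t) G' z =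
      conv (beurlingKer t) G z + conv (cauchyKer t) F z := by
    intro t ht z
    have hk := contDiff_cauchyKer ht (n := 1)
    have a1 : conv (moll t) U z = conv (cauchyKer t) (dzbar U) z := by
      rw [← dzbar_cauchyKer ht, conv_wirt _ _ hk hU hc]
    have a2 : conv (moll t) G' z = conv (cauchyKer t) (dzbar G') z := by
      rw [← dzbar_cauchyKer ht, conv_wirt _ _ hk hG'c hG'sc]
    have a3 : conv (beurlingKer t) G z = conv (cauchyKer t) (dz G) z := by
      rw [← dz_cauchyKer ht, conv_wirt _ _ hk hGc hGsc]
    have i1 := integrable_conv hk.continuous (continuous_wirt hG'c Complex.I) (hG'sc.wirt _) z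
    have i2 := integrable_conv hk.continuous (continuous_wirt hGc (-Complex.I)) (hGsc.wirt _) z
    have i3 := integrable_conv hk.continuous hFc hFsc z
    have e : dzbar U = fun z => dzbar G' z + (dz G z + F z) := by
      funext z; simp only [hF]; ring
    rw [a1, a2, a3, e, conv_add i1, conv_add i2 i3]
    · ring
    · simp only [mul_add]; exact i2.add i3
  obtain ⟨BU, hBU⟩ := hc.exists_bound_of_continuous hU.continuous
  obtain ⟨BG, hBG⟩ := hG'sc.exists_bound_of_continuous hG'c.continuous
  have hlim : ∀ z, Tendsto (fun t => conv (moll t) U z - conv (moll t) G' z) (𝓝[>] 0)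
      (𝓝 (mollMass * (U z - G' z))) := fun z => by
    rw [mul_sub]
    exact (tendsto_conv_moll hU.continuous hBU z).sub (tendsto_conv_moll hG'c.continuous hBG z)
  have hdiff := holderHalf_of_tendsto_conv hlim
    (B := K₁ * (5 * ε * N) + K₂ * (M + 4 * ε * N)) fun t ht => by
      simp only [funext (hid t ht)]
      exact HolderHalf.add (k₁ G _ hGc.continuous hGsc hGH t ht) (k₂ F _ hFc hFsc hFs hFb t ht)
  have hfin := hdiff.add hGH.conj
  have eU : (fun z => U z - G' z + conj (G z)) = U := by funext z; simp [hG']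
  rw [eU] at hfin
  refine hfin.mono ?_
  have hεD : ε * D ≤ 1 / 2 := by
    calc ε * D ≤ 1 / (2 * D) * D := by gcongr
      _ = _ := by field_simp
  have hN0 := hN.nonneg
  calc _ = (ε * D) * N + K₂ / m * M := by rw [hD, ← hm]; field_simp; ring
    _ ≤ 1 / 2 * N + K₂ / m * M := by gcongr
    _ = _ := by ring

/-- Up to normalization ∂U is the Beurling transform of ∂̄U, and the equation bounds the Hölder
constant of ∂̄U by M plus a small multiple of that of ∂U. Absorption needs the latter to be finite,
which is the qualitative hypothesis on `dz U`. -/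
lemma exists_holder_wirt_of_beltrami : ∃ ε₀ > 0, ∃ C, 0 ≤ C ∧ ∀ (U μ : ℂ → ℂ) (ε M : ℝ),
    ContDiff ℝ 1 U → (∀ z, 1 < ‖z‖ → U z = 0) → (∃ N, HolderHalf N (dz U)) → ContDiff ℝ 1 μ →
    ε ≤ ε₀ → (∀ z, ‖μ z‖ ≤ ε) → (∀ z, ‖fderiv ℝ μ z‖ ≤ ε) → HolderHalf M (beltrami μ U) →
    HolderHalf (C * M) (dz U) ∧ HolderHalf (C * M) (dzbar U) := by
  obtain ⟨K, hK, k⟩ := exists_holder_conv_beurlingKer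
  set m := ‖mollMass‖ with hm
  have hm0 : 0 < m := norm_pos_iff.2 mollMass_ne_zero
  set D := 1 + 10 * K / m with hD
  have hD0 : 0 < D := by positivity
  refine ⟨1 / (2 * D), by positivity, 10 * (K / m) + 1 + 2 * (K / m), by positivity, ?_⟩
  intro U μ ε M hU hs hN₀ hμ hε hμ1 hμ2 hH
  obtain ⟨N₀, hN₀⟩ := hN₀
  have hε0 : 0 ≤ ε := (norm_nonneg _).trans (hμ1 0)
  have hM0 : 0 ≤ M := hH.nonneg
  have hc := hasCompactSupport_of_eq_zero hs
  have hUd := hU.differentiable one_ne_zero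
  have hμd := hμ.differentiable one_ne_zero
  have hbar : ∀ N, HolderHalf N (dz U) → HolderHalf (M + 10 * ε * N) (dzbar U) := by
    intro N hN
    have hG := hN.small_mul hμd hμ1 hμ2 fun z hz => wirt_eq_zero hs _ hz
    have := hH.add (hG.add hG.conj)
    have e : (fun z => beltrami μ U z + (μ z * dz U z + conj (μ z * dz U z))) = dzbar U := by
      funext z; simp only [beltrami]; ring
    rw [e] at this
    exact this.mono (by linarith)
  have hεD : ε * D ≤ 1 / 2 := by
    calc ε * D ≤ 1 / (2 * D) * D := by gcongr
      _ = _ := by field_simp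
  have hmain : HolderHalf (2 * (K / m * M)) (dz U) := by
    refine hN₀.absorb fun N hN => ?_
    have hF := hbar N hN
    obtain ⟨B, hB⟩ := (hc.wirt (-Complex.I)).exists_bound_of_continuous (continuous_wirt hU _)
    have hdiff := holderHalf_of_tendsto_conv
      (fun z => tendsto_conv_moll (continuous_wirt hU (-Complex.I)) hB z)
      (B := K * (M + 10 * ε * N)) fun t ht => by
        have e : conv (moll t) (dz U) = conv (beurlingKer t) (dzbar U) := by
          funext z
          rw [conv_wirt _ _ (contDiff_moll ht) hU hc, conv_wirt _ _ (contDiff_beurlingKer ht) hU hc]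
          exact congrArg (fun k => conv k U z) (dz_moll ht)
        rw [e]
        exact k _ _ (continuous_wirt hU _) (hc.wirt _) hF t ht
    refine hdiff.mono ?_
    have hN0 := hN.nonneg
    have h1 : ε * (10 * K / m) ≤ 1 / 2 := by
      refine le_trans ?_ hεD
      rw [hD]; gcongr; linarith
    calc _ = (ε * (10 * K / m)) * N + K / m * M := by rw [← hm]; field_simp; ring
      _ ≤ 1 / 2 * N + K / m * M := by gcongr
      _ = _ := by ring
  have hKm : 0 ≤ K / m := by positivity
  have hε1 : ε ≤ 1 / 2 := by
    refine le_trans ?_ hεD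
    rw [hD, mul_add, mul_one]
    have : 0 ≤ ε * (10 * K / m) := by positivity
    linarith
  refine ⟨hmain.mono ?_, (hbar _ hmain).mono ?_⟩
  · have : 0 ≤ K / m * M := by positivity
    nlinarith
  · have h0 : 0 ≤ K / m * M := by positivity
    have : ε * (K / m * M) ≤ 1 / 2 * (K / m * M) := by gcongr
    nlinarith

/-! ### Families of functions that are uniformly bounded in `C^{k,1/2}` of a disc -/

/-- Uniform boundedness of a family on the disc of radius `r`. -/
def BddFam {ι : Type*} (r : ℝ) (F : ι → ℂ → ℂ) : Prop :=
  ∃ C, ∀ i, ∀ z ∈ ball (0 : ℂ) r, ‖F i z‖ ≤ C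

/-- Uniform Hölder continuity, of exponent `1/2`, of a family on the disc of radius `r`. -/
def HolderFam {ι : Type*} (r : ℝ) (F : ι → ℂ → ℂ) : Prop :=
  ∃ C, ∀ i, ∀ z ∈ ball (0 : ℂ) r, ∀ w ∈ ball (0 : ℂ) r, ‖F i z - F i w‖ ≤ C * √‖z - w‖

/-- Uniform boundedness in `C^{k,1/2}` of a family on the disc of radius `r`. -/
def HolderBdd {ι : Type*} (r : ℝ) : ℕ → (ι → ℂ → ℂ) → Prop
  | 0, F => BddFam r F ∧ HolderFam r F
  | k + 1, F => BddFam r F ∧ (∀ i, ∀ z ∈ ball (0 : ℂ) r, DifferentiableAt ℝ (F i) z) ∧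
      HolderBdd r k (fun i z => fderiv ℝ (F i) z 1) ∧
      HolderBdd r k (fun i z => fderiv ℝ (F i) z Complex.I)

section Calculus
variable {ι κ : Type*} {r r' : ℝ} {k : ℕ} {F G : ι → ℂ → ℂ}

lemma BddFam.exists_nonneg (h : BddFam r F) :
    ∃ C, 0 ≤ C ∧ ∀ i, ∀ z ∈ ball (0 : ℂ) r, ‖F i z‖ ≤ C := by
  obtain ⟨C, hC⟩ := h
  exact ⟨|C|, abs_nonneg C, fun i z hz => (hC i z hz).trans (le_abs_self C)⟩

lemma HolderFam.exists_nonneg (h : HolderFam r F) : ∃ C, 0 ≤ C ∧ ∀ i, ∀ z ∈ ball (0 : ℂ) r,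
    ∀ w ∈ ball (0 : ℂ) r, ‖F i z - F i w‖ ≤ C * √‖z - w‖ := by
  obtain ⟨C, hC⟩ := h
  exact ⟨|C|, abs_nonneg C, fun i z hz w hw => (hC i z hz w hw).trans
    (by gcongr; exact le_abs_self C)⟩

lemma HolderBdd.bdd (h : HolderBdd r k F) : BddFam r F := by cases k <;> exact h.1

lemma BddFam.mono (h : BddFam r F) (hr : r' ≤ r) : BddFam r' F := by
  obtain ⟨C, hC⟩ := h
  exact ⟨C, fun i z hz => hC i z (ball_subset_ball hr hz)⟩

lemma HolderFam.mono (h : HolderFam r F) (hr : r' ≤ r) : HolderFam r' F := by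
  obtain ⟨C, hC⟩ := h
  exact ⟨C, fun i z hz w hw => hC i z (ball_subset_ball hr hz) w (ball_subset_ball hr hw)⟩

lemma HolderBdd.mono (h : HolderBdd r k F) (hr : r' ≤ r) : HolderBdd r' k F := by
  induction k generalizing F with
  | zero => exact ⟨h.1.mono hr, h.2.mono hr⟩
  | succ k ih => exact ⟨h.1.mono hr, fun i z hz => h.2.1 i z (ball_subset_ball hr hz),
      ih h.2.2.1, ih h.2.2.2⟩

lemma HolderBdd.reindex (h : HolderBdd r k F) (f : κ → ι) : HolderBdd r k fun i => F (f i) := by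
  induction k generalizing F with
  | zero =>
    obtain ⟨⟨C, hC⟩, D, hD⟩ := h
    exact ⟨⟨C, fun i => hC _⟩, D, fun i => hD _⟩
  | succ k ih =>
    obtain ⟨⟨C, hC⟩, h2, h3, h4⟩ := h
    exact ⟨⟨C, fun i => hC _⟩, fun i => h2 _, ih h3, ih h4⟩

lemma fderiv_congr_ball {f g : ℂ → ℂ} (h : ∀ z ∈ ball (0 : ℂ) r, f z = g z) {z : ℂ}
    (hz : z ∈ ball (0 : ℂ) r) : fderiv ℝ f z = fderiv ℝ g z :=
  Filter.EventuallyEq.fderiv_eq (by filter_upwards [isOpen_ball.mem_nhds hz] with y hy using h y hy)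

lemma HolderBdd.congr (h : HolderBdd r k F) (hFG : ∀ i, ∀ z ∈ ball (0 : ℂ) r, F i z = G i z) :
    HolderBdd r k G := by
  induction k generalizing F G with
  | zero =>
    obtain ⟨⟨C, hC⟩, D, hD⟩ := h
    refine ⟨⟨C, fun i z hz => ?_⟩, D, fun i z hz w hw => ?_⟩
    · rw [← hFG i z hz]; exact hC i z hz
    · rw [← hFG i z hz, ← hFG i w hw]; exact hD i z hz w hw
  | succ k ih =>
    obtain ⟨⟨C, hC⟩, h2, h3, h4⟩ := h
    refine ⟨⟨C, fun i z hz => ?_⟩, fun i z hz => ?_, ih h3 fun i z hz => ?_,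
      ih h4 fun i z hz => ?_⟩
    · rw [← hFG i z hz]; exact hC i z hz
    · refine (h2 i z hz).congr_of_eventuallyEq ?_
      filter_upwards [isOpen_ball.mem_nhds hz] with y hy using (hFG i y hy).symm
    · rw [fderiv_congr_ball (hFG i) hz]
    · rw [fderiv_congr_ball (hFG i) hz]

lemma norm_clm_le (T : ℂ →L[ℝ] ℂ) : ‖T‖ ≤ ‖T 1‖ + ‖T Complex.I‖ := by
  refine ContinuousLinearMap.opNorm_le_bound _ (by positivity) fun z => ?_
  have : T z = z.re • T 1 + z.im • T Complex.I := by
    rw [← map_smul, ← map_smul, ← map_add]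
    congr 1
    simp [Complex.re_add_im]
  rw [this]
  calc _ ≤ ‖z.re • T 1‖ + ‖z.im • T Complex.I‖ := norm_add_le _ _
    _ = |z.re| * ‖T 1‖ + |z.im| * ‖T Complex.I‖ := by simp
    _ ≤ ‖z‖ * ‖T 1‖ + ‖z‖ * ‖T Complex.I‖ := by
      gcongr
      exacts [Complex.abs_re_le_norm z, Complex.abs_im_le_norm z]
    _ = _ := by ring

lemma HolderFam.of_fderiv_bdd (hd : ∀ i, ∀ z ∈ ball (0 : ℂ) r, DifferentiableAt ℝ (F i) z)
    {B L : ℝ} (hB : ∀ i, ∀ z ∈ ball (0 : ℂ) r, ‖F i z‖ ≤ B)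
    (hL : ∀ i, ∀ z ∈ ball (0 : ℂ) r, ‖fderiv ℝ (F i) z‖ ≤ L) : HolderFam r F := by
  refine ⟨max L (2 * B), fun i z hz w hw => ?_⟩
  refine sub_le_sqrt_of_lipschitz ((norm_nonneg _).trans (hL i z hz)) ?_ (hB i z hz) (hB i w hw)
  exact Convex.norm_image_sub_le_of_norm_fderiv_le (𝕜 := ℝ) (hd i) (hL i)
    (convex_ball _ _) hw hz

lemma HolderBdd.exists_fderiv_le (h : HolderBdd r (k + 1) F) :
    ∃ L, 0 ≤ L ∧ ∀ i, ∀ z ∈ ball (0 : ℂ) r, ‖fderiv ℝ (F i) z‖ ≤ L := by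
  obtain ⟨C₁, h0, h1⟩ := h.2.2.1.bdd.exists_nonneg
  obtain ⟨C₂, h0', h2⟩ := h.2.2.2.bdd.exists_nonneg
  exact ⟨C₁ + C₂, by positivity, fun i z hz =>
    (norm_clm_le _).trans (add_le_add (h1 i z hz) (h2 i z hz))⟩

lemma HolderBdd.pred (h : HolderBdd r (k + 1) F) : HolderBdd r k F := by
  induction k generalizing F with
  | zero =>
    obtain ⟨B, hB⟩ := h.bdd
    obtain ⟨L, -, hL⟩ := h.exists_fderiv_le
    exact ⟨h.1, HolderFam.of_fderiv_bdd h.2.1 hB hL⟩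
  | succ k ih => exact ⟨h.1, h.2.1, ih h.2.2.1, ih h.2.2.2⟩

lemma HolderBdd.of_le {l : ℕ} (h : HolderBdd r k F) (hl : l ≤ k) : HolderBdd r l F := by
  induction k with
  | zero => rwa [Nat.le_zero.1 hl]
  | succ k ih =>
    rcases Nat.le_succ_iff.1 hl with h' | h'
    · exact ih h.pred h'
    · rwa [h']

lemma HolderBdd.add (hF : HolderBdd r k F) (hG : HolderBdd r k G) :
    HolderBdd r k fun i z => F i z + G i z := by
  induction k generalizing F G with
  | zero =>
    obtain ⟨⟨C, hC⟩, D, hD⟩ := hF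
    obtain ⟨⟨C', hC'⟩, D', hD'⟩ := hG
    refine ⟨⟨C + C', fun i z hz => ?_⟩, D + D', fun i z hz w hw => ?_⟩
    · exact (norm_add_le _ _).trans (add_le_add (hC i z hz) (hC' i z hz))
    · rw [add_sub_add_comm, add_mul]
      exact (norm_add_le _ _).trans (add_le_add (hD i z hz w hw) (hD' i z hz w hw))
  | succ k ih =>
    obtain ⟨⟨C, hC⟩, h2, h3, h4⟩ := hF
    obtain ⟨⟨C', hC'⟩, h2', h3', h4'⟩ := hG
    refine ⟨⟨C + C', fun i z hz => ?_⟩, fun i z hz => (h2 i z hz).fun_add (h2' i z hz),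
      (ih h3 h3').congr fun i z hz => ?_, (ih h4 h4').congr fun i z hz => ?_⟩
    · exact (norm_add_le _ _).trans (add_le_add (hC i z hz) (hC' i z hz))
    all_goals rw [fderiv_fun_add (h2 i z hz) (h2' i z hz)]; rfl

lemma HolderBdd.mul (hF : HolderBdd r k F) (hG : HolderBdd r k G) :
    HolderBdd r k fun i z => F i z * G i z := by
  induction k generalizing F G with
  | zero =>
    obtain ⟨C, hC0, hC⟩ := hF.1.exists_nonneg
    obtain ⟨D, hD0, hD⟩ := hF.2.exists_nonneg
    obtain ⟨C', hC'0, hC'⟩ := hG.1.exists_nonneg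
    obtain ⟨D', hD'0, hD'⟩ := hG.2.exists_nonneg
    refine ⟨⟨C * C', fun i z hz => ?_⟩, C * D' + D * C', fun i z hz w hw => ?_⟩
    · rw [norm_mul]
      exact mul_le_mul (hC i z hz) (hC' i z hz) (norm_nonneg _) hC0
    · have e : F i z * G i z - F i w * G i w =
          F i z * (G i z - G i w) + (F i z - F i w) * G i w := by ring
      rw [e]
      calc _ ≤ ‖F i z‖ * ‖G i z - G i w‖ + ‖F i z - F i w‖ * ‖G i w‖ := by
            refine (norm_add_le _ _).trans_eq ?_; rw [norm_mul, norm_mul]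
        _ ≤ C * (D' * √‖z - w‖) + (D * √‖z - w‖) * C' := by
            gcongr
            exacts [hC i z hz, hD' i z hz w hw, hD i z hz w hw, hC' i w hw]
        _ = _ := by ring
  | succ k ih =>
    have hF' := hF.pred
    have hG' := hG.pred
    obtain ⟨C, hC0, hC⟩ := hF.bdd.exists_nonneg
    obtain ⟨C', hC'0, hC'⟩ := hG.bdd.exists_nonneg
    obtain ⟨-, h2, h3, h4⟩ := hF
    obtain ⟨-, h2', h3', h4'⟩ := hG
    refine ⟨⟨C * C', fun i z hz => ?_⟩, fun i z hz => (h2 i z hz).fun_mul (h2' i z hz),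
      ((ih hF' h3').add (ih h3 hG')).congr fun i z hz => ?_,
      ((ih hF' h4').add (ih h4 hG')).congr fun i z hz => ?_⟩
    · rw [norm_mul]
      exact mul_le_mul (hC i z hz) (hC' i z hz) (norm_nonneg _) hC0
    all_goals
      rw [fderiv_fun_mul (h2 i z hz) (h2' i z hz)]
      simp only [_root_.add_apply, _root_.smul_apply, smul_eq_mul]
      ring

lemma HolderBdd.const (c : ℂ) : HolderBdd r k fun (_ : ι) (_ : ℂ) => c := by
  induction k generalizing c with
  | zero => exact ⟨⟨‖c‖, fun _ _ _ => le_rfl⟩, 0, fun _ _ _ _ _ => by simp⟩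
  | succ k ih =>
    refine ⟨⟨‖c‖, fun _ _ _ => le_rfl⟩, fun _ _ _ => by fun_prop, ?_, ?_⟩
    all_goals simpa using ih 0

lemma HolderBdd.conj (hF : HolderBdd r k F) : HolderBdd r k fun i z => conj (F i z) := by
  induction k generalizing F with
  | zero =>
    obtain ⟨⟨C, hC⟩, D, hD⟩ := hF
    refine ⟨⟨C, fun i z hz => ?_⟩, D, fun i z hz w hw => ?_⟩
    · rw [RCLike.norm_conj]; exact hC i z hz
    · rw [← map_sub, RCLike.norm_conj]; exact hD i z hz w hw
  | succ k ih =>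
    obtain ⟨⟨C, hC⟩, h2, h3, h4⟩ := hF
    refine ⟨⟨C, fun i z hz => ?_⟩, fun i z hz => ?_, (ih h3).congr fun i z hz => ?_,
      (ih h4).congr fun i z hz => ?_⟩
    · rw [RCLike.norm_conj]; exact hC i z hz
    · exact Complex.conjCLE.differentiableAt.comp z (h2 i z hz)
    all_goals rw [fderiv_conj_apply (h2 i z hz)]

lemma HolderBdd.wirt (hF : HolderBdd r (k + 1) F) (c : ℂ) :
    HolderBdd r k fun i => wirt c (F i) := by
  refine (((HolderBdd.const (1 / 2)).mul
    (hF.2.2.1.add ((HolderBdd.const c).mul hF.2.2.2)))).congr fun i z hz => ?_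
  simp only [_root_.wirt]; ring

lemma HolderBdd.of_wirt (hF : BddFam r F)
    (hd : ∀ i, ∀ z ∈ ball (0 : ℂ) r, DifferentiableAt ℝ (F i) z)
    (h1 : HolderBdd r k fun i => dz (F i)) (h2 : HolderBdd r k fun i => dzbar (F i)) :
    HolderBdd r (k + 1) F := by
  refine ⟨hF, hd, (h1.add h2).congr fun i z hz => ?_,
    ((HolderBdd.const Complex.I).mul (h1.add ((HolderBdd.const (-1)).mul h2))).congr
      fun i z hz => ?_⟩
  · simp only [_root_.wirt]; ring
  · simp only [_root_.wirt]; ring_nf; simp only [Complex.I_sq]; ring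

lemma HolderBdd.contDiffOn (hF : HolderBdd r k F) (i : ι) : ContDiffOn ℝ k (F i) (ball 0 r) := by
  induction k generalizing F with
  | zero =>
    obtain ⟨D, hD0, hD⟩ := hF.2.exists_nonneg
    refine contDiffOn_zero.2 fun z hz => ?_
    refine tendsto_iff_norm_sub_tendsto_zero.2 ?_
    have hl : Tendsto (fun w => D * √‖w - z‖) (𝓝[ball 0 r] z) (𝓝 0) := by
      have : Continuous fun w => D * √‖w - z‖ := by fun_prop
      simpa using (this.tendsto z).mono_left nhdsWithin_le_nhds
    refine squeeze_zero' (Eventually.of_forall fun _ => norm_nonneg _) ?_ hl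
    filter_upwards [self_mem_nhdsWithin] with w hw using hD i w hw z hz
  | succ k ih =>
    obtain ⟨-, h2, h3, h4⟩ := hF
    rw [Nat.cast_succ, contDiffOn_succ_iff_fderiv_of_isOpen isOpen_ball]
    refine ⟨fun z hz => (h2 i z hz).differentiableWithinAt, by simp, ?_⟩
    have e : fderiv ℝ (F i) = fun z => Complex.reCLM.smulRight (fderiv ℝ (F i) z 1) +
        Complex.imCLM.smulRight (fderiv ℝ (F i) z Complex.I) := by
      funext z
      ext1 y
      simp only [_root_.add_apply, ContinuousLinearMap.smulRight_apply, Complex.reCLM_apply,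
        Complex.imCLM_apply]
      rw [← map_smul, ← map_smul, ← map_add]
      congr 1
      simp [Complex.re_add_im]
    rw [e]
    exact (contDiffOn_const.smulRight (ih h3)).add (contDiffOn_const.smulRight (ih h4))

end Calculus

/-! ### Interior estimates -/

/-- A smallness of the coefficient for which the a priori estimates hold. -/
noncomputable def smallness : ℝ :=
  min (Classical.choose exists_holder_of_beltrami_bounded)
    (Classical.choose exists_holder_wirt_of_beltrami)

lemma smallness_pos : 0 < smallness :=
  lt_min (Classical.choose_spec exists_holder_of_beltrami_bounded).1
    (Classical.choose_spec exists_holder_wirt_of_beltrami).1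

/-- A family of solutions, on the disc of radius `r`, of Beltrami systems whose coefficients are
small in `C¹`. -/
structure SolFam {ι : Type*} (r : ℝ) (μ h W : ι → ℂ → ℂ) : Prop where
  coeff : ∀ i, ContDiff ℝ 1 (μ i)
  small : ∀ i z, ‖μ i z‖ ≤ smallness
  small' : ∀ i z, ‖fderiv ℝ (μ i) z‖ ≤ smallness
  reg : ∀ i, ContDiffOn ℝ 1 (W i) (ball 0 r)
  eq : ∀ i, ∀ z ∈ ball (0 : ℂ) r, beltrami (μ i) (W i) z = h i z

lemma SolFam.mono {ι : Type*} {r r' : ℝ} {μ h W : ι → ℂ → ℂ} (H : SolFam r μ h W) (hr : r' ≤ r) :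
    SolFam r' μ h W :=
  ⟨H.coeff, H.small, H.small', fun i => (H.reg i).mono (ball_subset_ball hr),
    fun i z hz => H.eq i z (ball_subset_ball hr hz)⟩

lemma SolFam.differentiableAt {ι : Type*} {r : ℝ} {μ h W : ι → ℂ → ℂ} (H : SolFam r μ h W) (i : ι)
    {z : ℂ} (hz : z ∈ ball (0 : ℂ) r) : DifferentiableAt ℝ (W i) z :=
  ((H.reg i).contDiffAt (isOpen_ball.mem_nhds hz)).differentiableAt one_ne_zero

/-- A real cutoff function between two concentric discs. -/
lemma exists_cutoff {r R : ℝ} (hr : 0 < r) (hR : r < R) : ∃ (η : ℂ → ℂ) (r' : ℝ), r' < R ∧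
    ContDiff ℝ 2 η ∧ (∀ z, conj (η z) = η z) ∧ (∀ z ∈ ball (0 : ℂ) r, η =ᶠ[𝓝 z] 1) ∧
    ∀ z, r' ≤ ‖z‖ → η =ᶠ[𝓝 z] 0 := by
  let b : ContDiffBump (0 : ℂ) := ⟨r, (r + R) / 2, hr, by linarith⟩
  refine ⟨fun z => (b z : ℂ), (r + 3 * R) / 4, by linarith, ?_, fun z => Complex.conj_ofReal _,
    fun z hz => ?_, fun z hz => ?_⟩
  · exact Complex.ofRealCLM.contDiff.comp b.contDiff
  · filter_upwards [isOpen_ball.mem_nhds hz] with y hy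
    rw [b.one_of_mem_closedBall (ball_subset_closedBall hy)]; simp
  · have : (r + R) / 2 < ‖z‖ := by linarith
    filter_upwards [(isOpen_lt continuous_const continuous_norm).mem_nhds this] with y hy
    have : b y = 0 := b.zero_of_le_dist (by simpa using le_of_lt hy)
    simp [this]

lemma HolderBdd.of_contDiff {ι : Type*} {r : ℝ} {k : ℕ} {f : ℂ → ℂ}
    (hf : ContDiff ℝ (k + 1 : ℕ) f) (hc : HasCompactSupport f) :
    HolderBdd r k fun _ : ι => f := by
  obtain ⟨B, hB⟩ := hc.exists_bound_of_continuous hf.continuous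
  induction k generalizing f B with
  | zero =>
    obtain ⟨N, hN⟩ := HolderHalf.of_contDiff (by simpa using hf) hc
    exact ⟨⟨B, fun _ z _ => hB z⟩, N, fun _ z _ w _ => hN z w⟩
  | succ k ih =>
    have hd := hf.differentiable (by simp)
    have hf' : ∀ e, ContDiff ℝ (k + 1 : ℕ) fun z => fderiv ℝ f z e := fun e =>
      (hf.fderiv_right (m := (k + 1 : ℕ)) (by norm_cast)).clm_apply contDiff_const
    have hc' := fun e => hc.fderiv_apply ℝ e
    obtain ⟨B₁, hB₁⟩ := (hc' 1).exists_bound_of_continuous (hf' 1).continuous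
    obtain ⟨B₂, hB₂⟩ := (hc' Complex.I).exists_bound_of_continuous (hf' Complex.I).continuous
    exact ⟨⟨B, fun _ z _ => hB z⟩, fun _ z _ => hd z, ih (hf' 1) (hc' 1) B₁ hB₁,
      ih (hf' _) (hc' _) B₂ hB₂⟩

/-- A pair with one point outside radius R either gives zero or is separated by at least R - r, in
which case the sup bound suffices. -/
lemma HolderFam.holderHalf {ι : Type*} {r R : ℝ} {f : ι → ℂ → ℂ} (hf : HolderBdd R 0 f)
    (hr : r < R) (hs : ∀ i z, r ≤ ‖z‖ → f i z = 0) : ∃ N, ∀ i, HolderHalf N (f i) := by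
  obtain ⟨B, hB0, hB⟩ := hf.1.exists_nonneg
  obtain ⟨D, hD0, hD⟩ := hf.2.exists_nonneg
  have hp : 0 < √(R - r) := Real.sqrt_pos.2 (by linarith)
  have hout : ∀ i z w, R ≤ ‖w‖ → ‖f i z - f i w‖ ≤ (D + B / √(R - r)) * √‖z - w‖ := by
    intro i z w hw
    rw [hs i w (by linarith), sub_zero]
    by_cases hz : r ≤ ‖z‖
    · rw [hs i z hz, norm_zero]; positivity
    · push Not at hz
      have h1 : R - r ≤ ‖z - w‖ := by
        have := norm_sub_norm_le w z
        rw [norm_sub_rev] at this; linarith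
      have h2 : √(R - r) ≤ √‖z - w‖ := Real.sqrt_le_sqrt h1
      calc ‖f i z‖ ≤ B := hB i z (by simpa using hz.trans hr)
        _ = B / √(R - r) * √(R - r) := by field_simp
        _ ≤ (D + B / √(R - r)) * √‖z - w‖ := by gcongr; linarith
  refine ⟨D + B / √(R - r), fun i z w => ?_⟩
  by_cases hw : R ≤ ‖w‖
  · exact hout i z w hw
  by_cases hz : R ≤ ‖z‖
  · rw [norm_sub_rev, norm_sub_rev z]; exact hout i w z hz
  · push Not at hw hz
    refine (hD i z (by simpa using hz) w (by simpa using hw)).trans ?_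
    gcongr
    have : 0 ≤ B / √(R - r) := by positivity
    linarith

lemma contDiff_cutoff_mul {r R : ℝ} {η f : ℂ → ℂ} (hr : r < R) (hη : ContDiff ℝ 2 η)
    (h0 : ∀ z, r ≤ ‖z‖ → η =ᶠ[𝓝 z] 0) (hf : ContDiffOn ℝ 1 f (ball 0 R)) :
    ContDiff ℝ 1 fun z => η z * f z := by
  rw [contDiff_iff_contDiffAt]
  intro z
  by_cases hz : ‖z‖ < R
  · exact (hη.contDiffAt.of_le (by norm_num)).mul
      (hf.contDiffAt (isOpen_ball.mem_nhds (by simpa using hz)))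
  · have : (fun z => η z * f z) =ᶠ[𝓝 z] fun _ => 0 := by
      filter_upwards [h0 z (by linarith)] with y hy
      simp [hy]
    exact contDiffAt_const.congr_of_eventuallyEq this

/-- The right hand side of the Beltrami system for a truncated solution. -/
noncomputable def cutoffRhs (η μ h W : ℂ → ℂ) (z : ℂ) : ℂ :=
  η z * h z + (dzbar η z * W z +
    (-1) * (μ z * dz η z * W z + conj (μ z * dz η z * W z)))

lemma beltrami_cutoff {ι : Type*} {r R : ℝ} {μ h W : ι → ℂ → ℂ} (H : SolFam R μ h W) {η : ℂ → ℂ}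
    (hr : r < R) (hη : ContDiff ℝ 2 η) (hre : ∀ z, conj (η z) = η z)
    (h0 : ∀ z, r ≤ ‖z‖ → η =ᶠ[𝓝 z] 0) (i : ι) (z : ℂ) :
    beltrami (μ i) (fun z => η z * W i z) z = cutoffRhs η (μ i) (h i) (W i) z := by
  by_cases hz : ‖z‖ < R
  · have hz' : z ∈ ball (0 : ℂ) R := by simpa using hz
    have hd := hη.differentiable (by norm_num) z
    have e := H.eq i z hz'
    simp only [beltrami, cutoffRhs, dzbar, dz] at e ⊢
    rw [wirt_mul _ hd (H.differentiableAt i hz'), wirt_mul _ hd (H.differentiableAt i hz'), ← e]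
    simp only [map_mul, map_add, hre]
    ring
  · have h1 := h0 z (by linarith)
    have : (fun z => η z * W i z) =ᶠ[𝓝 z] fun _ => 0 := by
      filter_upwards [h1] with y hy
      simp [hy]
    simp [beltrami, cutoffRhs, wirt, this.fderiv_eq, h1.fderiv_eq, h1.eq_of_nhds]

section Interior
variable {ι : Type*} {r R : ℝ} {μ h W : ι → ℂ → ℂ}

lemma SolFam.coeff_holderBdd (H : SolFam R μ h W) : HolderBdd R 0 μ :=
  ⟨⟨smallness, fun i z _ => H.small i z⟩, HolderFam.of_fderiv_bdd
    (fun i z _ => (H.coeff i).differentiable one_ne_zero z) (fun i z _ => H.small i z)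
    fun i z _ => H.small' i z⟩

/-- The truncation ηW solves the same system globally, and its right-hand side contains W but no
derivative of W, hence is bounded. Since η is real, it passes through the conjugated term. -/
lemma SolFam.holder (H : SolFam R μ h W) (hr : 0 < r) (hrR : r < R) (hR : R ≤ 1)
    (hW : BddFam R W) (hh : BddFam R h) : HolderBdd r 0 W := by
  refine ⟨hW.mono hrR.le, ?_⟩
  obtain ⟨-, C, -, hC⟩ := Classical.choose_spec exists_holder_of_beltrami_bounded
  obtain ⟨η, r', hr', hη, hre, h1, h0⟩ := exists_cutoff hr hrR
  have hηc : HasCompactSupport η := HasCompactSupport.intro (isCompact_closedBall 0 r')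
    fun z hz => (h0 z (le_of_lt (by simpa using hz))).eq_of_nhds
  obtain ⟨A, hA⟩ := hηc.exists_bound_of_continuous hη.continuous
  obtain ⟨A', hA'⟩ := (hηc.fderiv (𝕜 := ℝ)).exists_bound_of_continuous
    (hη.continuous_fderiv (by simp))
  have hA0 : 0 ≤ A := (norm_nonneg _).trans (hA 0)
  have hA0' : 0 ≤ A' := (norm_nonneg _).trans (hA' 0)
  obtain ⟨B, hB0, hB⟩ := hW.exists_nonneg
  obtain ⟨B', hB0', hB'⟩ := hh.exists_nonneg
  set s := smallness
  have hs0 : 0 ≤ s := smallness_pos.le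
  refine ⟨C * (A * B' + (A' * B + (s * A' * B + s * A' * B))), fun i z hz w hw => ?_⟩
  have key := hC (fun z => η z * W i z) (μ i) s (A * B' + (A' * B + (s * A' * B + s * A' * B)))
    (contDiff_cutoff_mul hr' hη h0 (H.reg i))
    (fun z hz => by simp [(h0 z (by linarith)).eq_of_nhds]) (H.coeff i) (min_le_left _ _)
    (H.small i) (H.small' i) (fun z => by
      rw [beltrami_cutoff H hr' hη hre h0]
      by_cases hz : ‖z‖ < R
      · have hz' : z ∈ ball (0 : ℂ) R := by simpa using hz
        have n1 := (norm_wirt_le (c := Complex.I) (by simp) η z).trans (hA' z)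
        have n2 := (norm_wirt_le (c := -Complex.I) (by simp) η z).trans (hA' z)
        have n3 : ‖μ i z * dz η z * W i z‖ ≤ s * A' * B := by
          rw [norm_mul, norm_mul]
          gcongr
          exacts [H.small i z, hB i z hz']
        rw [cutoffRhs]
        refine (norm_add_le _ _).trans (add_le_add ?_ ((norm_add_le _ _).trans (add_le_add ?_ ?_)))
        · rw [norm_mul]
          gcongr
          exacts [hA z, hB' i z hz']
        · rw [norm_mul]
          gcongr
          exact hB i z hz'
        · rw [neg_one_mul, norm_neg]
          exact (norm_add_le _ _).trans (by rw [RCLike.norm_conj]; linarith)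
      · have h1 := h0 z (by linarith)
        have : cutoffRhs η (μ i) (h i) (W i) z = 0 := by
          simp [cutoffRhs, wirt, h1.fderiv_eq, h1.eq_of_nhds]
        rw [this, norm_zero]
        positivity)
  have := key z w
  simp only [(h1 z hz).eq_of_nhds, (h1 w hw).eq_of_nhds, Pi.one_apply, one_mul] at this
  exact this

/-- The hypothesis on individual members carries no uniformity; it only makes the absorption
legitimate, and the constant obtained does not depend on it. -/
lemma SolFam.holder_deriv (H : SolFam R μ h W) (hr : 0 < r) (hrR : r < R) (hR : R ≤ 1)
    (hW : HolderBdd R 0 W) (hh : HolderBdd R 0 h)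
    (hW' : ∀ i, HolderBdd R 1 fun _ : Unit => W i) : HolderBdd r 1 W := by
  obtain ⟨-, C, -, hC⟩ := Classical.choose_spec exists_holder_wirt_of_beltrami
  obtain ⟨η, r', hr', hη, hre, h1, h0⟩ := exists_cutoff hr hrR
  have hηc : HasCompactSupport η := HasCompactSupport.intro (isCompact_closedBall 0 r')
    fun z hz => (h0 z (le_of_lt (by simpa using hz))).eq_of_nhds
  have hη1 : HolderBdd R 1 fun _ : ι => η := HolderBdd.of_contDiff hη hηc
  have hE : HolderBdd R 0 fun i => cutoffRhs η (μ i) (h i) (W i) := by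
    have a := ((H.coeff_holderBdd.mul (hη1.wirt (-Complex.I))).mul hW)
    exact (hη1.pred.mul hh).add (((hη1.wirt Complex.I).mul hW).add
      ((HolderBdd.const (-1)).mul (a.add a.conj)))
  obtain ⟨M, hM⟩ := HolderFam.holderHalf hE hr' fun i z hz => by
    have h1 := h0 z hz
    simp [cutoffRhs, wirt, h1.fderiv_eq, h1.eq_of_nhds]
  have hN : ∀ i, ∃ N, HolderHalf N (dz fun z => η z * W i z) := by
    intro i
    have hp : HolderBdd R 1 fun (_ : Unit) z => η z * W i z := (HolderBdd.of_contDiff hη hηc).mul (hW' i)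
    obtain ⟨N, hN⟩ := HolderFam.holderHalf (hp.wirt (-Complex.I)) hr' fun _ z hz => by
      have : (fun z => η z * W i z) =ᶠ[𝓝 z] fun _ => 0 := by
        filter_upwards [h0 z hz] with y hy
        simp [hy]
      simp [wirt, this.fderiv_eq]
    exact ⟨N, hN ()⟩
  have hs0 : ∀ i z, 1 < ‖z‖ → η z * W i z = 0 := fun i z hz => by
    simp [(h0 z (by linarith)).eq_of_nhds]
  have key := fun i => hC (fun z => η z * W i z) (μ i) smallness M
    (contDiff_cutoff_mul hr' hη h0 (H.reg i)) (hs0 i) (hN i) (H.coeff i) (min_le_right _ _)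
    (H.small i) (H.small' i) (by
      rw [funext (beltrami_cutoff H hr' hη hre h0 i)]; exact hM i)
  have hloc : ∀ c i, ∀ z ∈ ball (0 : ℂ) r, wirt c (fun z => η z * W i z) z = wirt c (W i) z := by
    intro c i z hz
    have : (fun z => η z * W i z) =ᶠ[𝓝 z] W i := by
      filter_upwards [h1 z hz] with y hy
      simp [hy]
    simp [wirt, this.fderiv_eq]
  have hfin : ∀ c, (∀ i, HolderHalf (C * M) (wirt c fun z => η z * W i z)) →
      HolderBdd r 0 fun i => wirt c (W i) := fun c hg => by
    refine HolderBdd.congr (F := fun i => wirt c fun z => η z * W i z)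
      ⟨⟨2 * (C * M), fun i z _ => ?_⟩, C * M, fun i z _ w _ => hg i z w⟩ (hloc c)
    exact (hg i).bound (fun z hz => wirt_eq_zero (hs0 i) _ hz) z
  exact HolderBdd.of_wirt (hW.1.mono hrR.le)
    (fun i z hz => H.differentiableAt i (ball_subset_ball hrR.le hz))
    (hfin _ fun i => (key i).1) (hfin _ fun i => (key i).2)

end Interior

/-! ### Difference quotients -/

/-- The difference quotient of step `s` in direction `e`. -/
noncomputable def dq (s : ℝ) (e : ℂ) (f : ℂ → ℂ) (z : ℂ) : ℂ := (f (z + s * e) - f z) / s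

/-- Nonzero steps of size less than `δ`. -/
abbrev Steps (δ : ℝ) : Type := {s : ℝ // s ≠ 0 ∧ |s| < δ}

lemma norm_step {s : ℝ} {e : ℂ} (he : ‖e‖ = 1) : ‖(s : ℂ) * e‖ = |s| := by
  rw [norm_mul, he, mul_one, Complex.norm_real, Real.norm_eq_abs]

lemma shift_mem {r δ : ℝ} {s : Steps δ} {e z : ℂ} (he : ‖e‖ = 1) (hz : z ∈ ball (0 : ℂ) r) :
    z + (s : ℝ) * e ∈ ball (0 : ℂ) (r + δ) := by
  rw [mem_ball_zero_iff] at hz ⊢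
  calc _ ≤ ‖z‖ + ‖((s : ℝ) : ℂ) * e‖ := norm_add_le _ _
    _ < _ := by rw [norm_step he]; linarith [s.2.2]

lemma fderiv_shift (f : ℂ → ℂ) (a z : ℂ) :
    fderiv ℝ (fun z => f (z + a)) z = fderiv ℝ f (z + a) := fderiv_comp_add_right a

lemma HolderBdd.shift {ι : Type*} {r δ : ℝ} {k : ℕ} {F : ι → ℂ → ℂ} {e : ℂ} (he : ‖e‖ = 1)
    (hF : HolderBdd (r + δ) k F) :
    HolderBdd r k fun (p : Steps δ × ι) z => F p.2 (z + (p.1 : ℝ) * e) := by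
  induction k generalizing F with
  | zero =>
    obtain ⟨⟨C, hC⟩, D, hD⟩ := hF
    refine ⟨⟨C, fun p z hz => hC _ _ (shift_mem he hz)⟩, D, fun p z hz w hw => ?_⟩
    simpa using hD p.2 _ (shift_mem (s := p.1) he hz) _ (shift_mem (s := p.1) he hw)
  | succ k ih =>
    obtain ⟨⟨C, hC⟩, h2, h3, h4⟩ := hF
    refine ⟨⟨C, fun p z hz => hC _ _ (shift_mem he hz)⟩, fun p z hz => ?_, ?_, ?_⟩
    · exact (h2 p.2 _ (shift_mem he hz)).comp z (by fun_prop)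
    · simp only [fderiv_shift]; exact ih h3
    · simp only [fderiv_shift]; exact ih h4

section DiffQuot
variable {r δ : ℝ} {e : ℂ} {f : ℂ → ℂ}

lemma fderiv_dq (he : ‖e‖ = 1) (hf : ∀ z ∈ ball (0 : ℂ) (r + δ), DifferentiableAt ℝ f z)
    (s : Steps δ) {z : ℂ} (hz : z ∈ ball (0 : ℂ) r) (hδ : 0 < δ) :
    DifferentiableAt ℝ (dq s e f) z ∧
      ∀ e', fderiv ℝ (dq s e f) z e' = dq s e (fun z => fderiv ℝ f z e') z := by
  have h1 : DifferentiableAt ℝ (fun z => f (z + (s : ℝ) * e)) z :=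
    (hf _ (shift_mem he hz)).comp z (by fun_prop)
  have h2 := hf z (ball_subset_ball (by linarith) hz)
  have h3 : dq s e f = fun z => ((s : ℝ) : ℂ)⁻¹ * (f (z + (s : ℝ) * e) - f z) := by
    funext z; simp only [dq]; rw [div_eq_mul_inv, mul_comm]
  rw [h3]
  refine ⟨(h1.sub h2).const_mul _, fun e' => ?_⟩
  rw [fderiv_const_mul (h1.fun_sub h2), fderiv_fun_sub h1 h2, fderiv_shift]
  simp only [_root_.smul_apply, _root_.sub_apply, smul_eq_mul, dq]
  rw [div_eq_mul_inv, mul_comm]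

lemma wirt_dq (he : ‖e‖ = 1) (hf : ∀ z ∈ ball (0 : ℂ) (r + δ), DifferentiableAt ℝ f z)
    (s : Steps δ) {z : ℂ} (hz : z ∈ ball (0 : ℂ) r) (hδ : 0 < δ) (c : ℂ) :
    wirt c (dq s e f) z = dq s e (wirt c f) z := by
  simp only [wirt, (fderiv_dq he hf s hz hδ).2, dq]
  ring

lemma norm_dq_le (he : ‖e‖ = 1) (hf : ∀ z ∈ ball (0 : ℂ) (r + δ), DifferentiableAt ℝ f z) {B : ℝ}
    (hB : ∀ z ∈ ball (0 : ℂ) (r + δ), ‖fderiv ℝ f z‖ ≤ B) (s : Steps δ) {z : ℂ}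
    (hz : z ∈ ball (0 : ℂ) r) (hδ : 0 < δ) : ‖dq s e f z‖ ≤ B := by
  have h := Convex.norm_image_sub_le_of_norm_fderiv_le (𝕜 := ℝ) hf hB (convex_ball _ _)
    (ball_subset_ball (by linarith) hz) (shift_mem (s := s) he hz)
  rw [add_sub_cancel_left, norm_step he] at h
  rw [dq, norm_div, Complex.norm_real, Real.norm_eq_abs, div_le_iff₀ (abs_pos.2 s.2.1)]
  exact h

/-- The mean value inequality is applied to x ↦ f(x) - f(x + w - z), whose derivative is small by
the Hölder continuity of the derivative of f. -/
lemma HolderBdd.dq (he : ‖e‖ = 1) (hδ : 0 < δ) (hf : HolderBdd (r + δ) 1 fun _ : Unit => f) :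
    HolderBdd r 0 fun s : Steps δ => dq s e f := by
  obtain ⟨L, -, hL⟩ := hf.exists_fderiv_le
  have hd := hf.2.1 ()
  refine ⟨⟨L, fun s z hz => norm_dq_le he hd (hL ()) s hz hδ⟩, ?_⟩
  obtain ⟨C₁, h10, h1⟩ := hf.2.2.1.2.exists_nonneg
  obtain ⟨C₂, h20, h2⟩ := hf.2.2.2.2.exists_nonneg
  refine ⟨C₁ + C₂, fun s z hz w hw => ?_⟩
  -- The points x for which both x and its translate lie in the disc; convexity is what the mean
  -- value inequality requires.
  set S : Set ℂ := ball 0 (r + δ) ∩ (fun x => x + (w - z)) ⁻¹' ball 0 (r + δ) with hS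
  have hSc : Convex ℝ S :=
    (convex_ball _ _).inter ((convex_ball _ _).translate_preimage_left (w - z))
  have sub : r ≤ r + δ := by linarith
  have h := Convex.norm_image_sub_le_of_norm_fderiv_le (𝕜 := ℝ)
    (f := fun x => f x - f (x + (w - z))) (C := (C₁ + C₂) * √‖z - w‖) (s := S)
    (x := z) (y := z + (s : ℝ) * e) (fun x hx => ?_) (fun x hx => ?_) hSc ?_ ?_
  · rw [add_sub_cancel_left, norm_step he] at h
    change ‖_root_.dq s e f z - _root_.dq s e f w‖ ≤ _
    rw [_root_.dq, _root_.dq, ← sub_div, norm_div, Complex.norm_real, Real.norm_eq_abs,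
      div_le_iff₀ (abs_pos.2 s.2.1)]
    rw [add_sub_cancel, show z + (s : ℝ) * e + (w - z) = w + (s : ℝ) * e by ring] at h
    refine le_trans (le_of_eq ?_) h
    congr 1
    ring
  · exact (hd x hx.1).sub ((hd _ hx.2).comp x (by fun_prop))
  · have hx2 : DifferentiableAt ℝ (fun x => f (x + (w - z))) x :=
      (hd _ hx.2).comp x (by fun_prop)
    rw [fderiv_fun_sub (hd x hx.1) hx2, fderiv_shift]
    have e1 : ‖x - (x + (w - z))‖ = ‖z - w‖ := by congr 1; ring
    refine (norm_clm_le _).trans ?_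
    have a1 := h1 () x hx.1 _ hx.2
    have a2 := h2 () x hx.1 _ hx.2
    rw [e1] at a1 a2
    simp only [_root_.sub_apply]
    linarith
  · exact ⟨ball_subset_ball sub hz, by simpa using ball_subset_ball sub hw⟩
  · refine ⟨shift_mem he hz, ?_⟩
    have : z + (s : ℝ) * e + (w - z) = w + (s : ℝ) * e := by ring
    rw [mem_preimage, this]
    exact shift_mem he hw

/-- Difference quotients of a solution solve the Beltrami system with the same coefficient. -/
lemma SolFam.dq {μ h W : ℂ → ℂ} (he : ‖e‖ = 1) (hδ : 0 < δ)
    (H : SolFam (r + δ) (fun _ : Unit => μ) (fun _ => h) fun _ => W) :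
    SolFam r (fun _ : Steps δ => μ)
      (fun s z => dq s e h z + (dq s e μ z * dz W (z + (s : ℝ) * e) +
        conj (dq s e μ z * dz W (z + (s : ℝ) * e)))) fun s => dq s e W := by
  have hd := fun z hz => H.differentiableAt () (z := z) hz
  refine ⟨fun _ => H.coeff (), fun _ => H.small (), fun _ => H.small' (), fun s => ?_,
    fun s z hz => ?_⟩
  · have h1 : ContDiffOn ℝ 1 (fun z => W (z + (s : ℝ) * e)) (ball 0 r) :=
      (H.reg ()).comp (by fun_prop) fun z hz => shift_mem he hz
    have h2 := (H.reg ()).mono (ball_subset_ball (show r ≤ r + δ by linarith))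
    have h3 : _root_.dq s e W = fun z => ((s : ℝ) : ℂ)⁻¹ * (W (z + (s : ℝ) * e) - W z) := by
      funext z; simp only [_root_.dq]; rw [div_eq_mul_inv, mul_comm]
    rw [h3]
    exact contDiffOn_const.mul (h1.sub h2)
  · have e1 := H.eq () z (ball_subset_ball (by linarith) hz)
    have e2 := H.eq () _ (shift_mem (s := s) he hz)
    rw [beltrami, dzbar, dz, wirt_dq he hd s hz hδ, wirt_dq he hd s hz hδ]
    have hs : ((s : ℝ) : ℂ) ≠ 0 := by exact_mod_cast s.2.1
    simp only [_root_.dq, ← e1, ← e2, beltrami]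
    simp only [map_mul, map_div₀, map_sub, Complex.conj_ofReal]
    field_simp
    ring

end DiffQuot

lemma exists_fderiv_bound_of_contDiffOn {r R : ℝ} {f : ℂ → ℂ} (hf : ContDiffOn ℝ 1 f (ball 0 R))
    (hr : r < R) : ∃ B, ∀ z ∈ ball (0 : ℂ) r, ‖fderiv ℝ f z‖ ≤ B ∧ ‖f z‖ ≤ B := by
  have hsub : closedBall (0 : ℂ) r ⊆ ball 0 R := closedBall_subset_ball hr
  obtain ⟨B, hB⟩ := (isCompact_closedBall (0 : ℂ) r).exists_bound_of_continuousOn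
    ((hf.continuousOn_fderiv_of_isOpen isOpen_ball le_rfl).mono hsub)
  obtain ⟨B', hB'⟩ := (isCompact_closedBall (0 : ℂ) r).exists_bound_of_continuousOn
    (hf.continuousOn.mono hsub)
  exact ⟨max B B', fun z hz => ⟨(hB z (ball_subset_closedBall hz)).trans (le_max_left _ _),
    (hB' z (ball_subset_closedBall hz)).trans (le_max_right _ _)⟩⟩

lemma tendsto_dq {f : ℂ → ℂ} {z : ℂ} (hf : DifferentiableAt ℝ f z) (e : ℂ) :
    Tendsto (fun s : ℝ => dq s e f z) (𝓝[>] 0) (𝓝 (fderiv ℝ f z e)) := by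
  have h := hf.hasFDerivAt.hasLineDerivAt e
  have := h.tendsto_slope_zero_right
  refine this.congr fun s => ?_
  simp only [dq, Complex.real_smul]
  rw [Complex.ofReal_inv, div_eq_mul_inv, mul_comm]

/-- Solutions with `C¹` data are of class `C^{1,1/2}`. -/
lemma SolFam.holderBdd_one {r R : ℝ} {μ h W : ℂ → ℂ}
    (H : SolFam R (fun _ : Unit => μ) (fun _ => h) fun _ => W) (hh : ContDiffOn ℝ 1 h (ball 0 R))
    (hr : 0 < r) (hrR : r < R) (hR : R ≤ 1) : HolderBdd r 1 fun _ : Unit => W := by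
  set r₁ := (r + R) / 2 with hr₁
  set δ := (R - r₁) / 2 with hδ
  have hδ0 : 0 < δ := by rw [hδ]; linarith
  have hr₁R : r₁ + δ < R := by rw [hδ]; linarith
  obtain ⟨B, hB⟩ := exists_fderiv_bound_of_contDiffOn (H.reg ()) hr₁R
  obtain ⟨B', hB'⟩ := exists_fderiv_bound_of_contDiffOn hh hr₁R
  have H' := H.mono hr₁R.le
  have hd := fun z hz => H'.differentiableAt () (z := z) hz
  have hdh : ∀ z ∈ ball (0 : ℂ) (r₁ + δ), DifferentiableAt ℝ h z := fun z hz =>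
    (hh.contDiffAt (isOpen_ball.mem_nhds (ball_subset_ball hr₁R.le hz))).differentiableAt
      one_ne_zero
  have hd1 : ∀ z ∈ ball (0 : ℂ) r, DifferentiableAt ℝ W z := fun z hz =>
    hd z (ball_subset_ball (by linarith) hz)
  have hol : ∀ e, ‖e‖ = 1 → HolderBdd r 0 fun (_ : Unit) z => fderiv ℝ W z e := by
    intro e he
    -- The difference quotients solve systems whose right-hand sides are merely bounded uniformly in
    -- the step, so the estimate for bounded data applies. The Hölder bound then passes to the
    -- derivative.
    have hq := (H'.dq he hδ0).holder hr (by linarith) (by linarith)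
      ⟨B, fun s z hz => norm_dq_le he hd (fun z hz => (hB z hz).1) s hz hδ0⟩
      ⟨B' + (smallness * B + smallness * B), fun s z hz => by
        have n1 := norm_dq_le he hdh (fun z hz => (hB' z hz).1) s hz hδ0
        have n2 := norm_dq_le (r := r₁) he
          (fun z _ => (H.coeff ()).differentiable one_ne_zero z) (fun z _ => H.small' () z) s hz hδ0
        have n3 := (norm_wirt_le (c := -Complex.I) (by simp) W _).trans
          (hB _ (shift_mem (s := s) he hz)).1
        have n4 : ‖_root_.dq s e μ z * dz W (z + (s : ℝ) * e)‖ ≤ smallness * B := by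
          rw [norm_mul]
          exact mul_le_mul n2 n3 (norm_nonneg _) smallness_pos.le
        refine (norm_add_le _ _).trans (add_le_add n1 ((norm_add_le _ _).trans ?_))
        rw [RCLike.norm_conj]
        exact add_le_add n4 n4⟩
    obtain ⟨C, hC⟩ := hq.2
    refine ⟨⟨B, fun _ z hz => ?_⟩, C, fun _ z hz w hw => ?_⟩
    · have h1 := (hB z (ball_subset_ball (by linarith) hz)).1
      have := (fderiv ℝ W z).le_opNorm e
      rw [he, mul_one] at this
      exact this.trans h1
    · refine le_of_tendsto ((tendsto_dq (hd1 z hz) e).sub (tendsto_dq (hd1 w hw) e)).norm ?_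
      filter_upwards [Ioo_mem_nhdsGT hδ0] with s hs
      exact hC ⟨s, hs.1.ne', by rw [abs_of_pos hs.1]; exact hs.2⟩ z hz w hw
  exact ⟨⟨B, fun _ z hz => (hB z (ball_subset_ball (by linarith) hz)).2⟩, fun _ => hd1,
    hol 1 norm_one, hol Complex.I Complex.norm_I⟩

/-- A function whose difference quotients in one direction are uniformly Hölder has a Hölder
derivative in that direction. -/
lemma exists_deriv_of_dq {r δ : ℝ} {e : ℂ} (he : ‖e‖ = 1) (hδ : 0 < δ) {G : ℂ → ℂ}
    (hc : ContinuousOn G (ball 0 (r + δ + δ))) {B C : ℝ}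
    (hB : ∀ s : Steps δ, ∀ z ∈ ball (0 : ℂ) (r + δ), ‖dq s e G z‖ ≤ B)
    (hC : ∀ s : Steps δ, ∀ z ∈ ball (0 : ℂ) (r + δ), ∀ w ∈ ball (0 : ℂ) (r + δ),
      ‖dq s e G z - dq s e G w‖ ≤ C * √‖z - w‖) :
    ∃ k : ℂ → ℂ, (∀ z ∈ ball (0 : ℂ) r, ‖k z‖ ≤ B) ∧
      (∀ z ∈ ball (0 : ℂ) r, ∀ w ∈ ball (0 : ℂ) r, ‖k z - k w‖ ≤ C * √‖z - w‖) ∧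
      ∀ s : Steps δ, ∀ z ∈ ball (0 : ℂ) r, ‖dq s e G z - k z‖ ≤ 2 * C * √|(s : ℝ)| := by
  have hmul : ∀ s : Steps δ, ∀ z, ((s : ℝ) : ℂ) * dq s e G z = G (z + (s : ℝ) * e) - G z := by
    intro s z
    have : ((s : ℝ) : ℂ) ≠ 0 := by exact_mod_cast s.2.1
    rw [dq]; field_simp
  have sub : ball (0 : ℂ) r ⊆ ball 0 (r + δ) := ball_subset_ball (by linarith)
  have hC0 : ∀ z ∈ ball (0 : ℂ) r, 0 ≤ C := by
    intro z hz
    have h := (norm_nonneg _).trans (hC ⟨δ / 2, by positivity, by rw [abs_of_pos] <;> linarith⟩ z (sub hz)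
      (z + ((δ / 2 : ℝ) : ℂ) * e) (shift_mem (s := ⟨δ / 2, by positivity, by rw [abs_of_pos] <;> linarith⟩) he hz))
    rw [sub_add_cancel_left, norm_neg, norm_step he] at h
    exact nonneg_of_mul_nonneg_left h (Real.sqrt_pos.2 (by positivity))
  -- comparison of a step with its integral multiples
  have avg : ∀ u, 0 < u → ∀ m : ℕ, m * u < δ → ∀ z ∈ ball (0 : ℂ) r,
      ‖G (z + (m * u : ℝ) * e) - G z - m * (G (z + (u : ℝ) * e) - G z)‖ ≤
        m * (u * (C * √(m * u))) := by
    intro u hu m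
    induction m with
    | zero => intro _ z _; simp
    | succ m ih =>
      intro hm z hz
      have hmu : 0 ≤ m * u := by positivity
      push_cast at hm ⊢
      have hm' : (m : ℝ) * u < δ := by linarith
      have huδ : u < δ := by linarith
      have i1 := ih hm' z hz
      let s : Steps δ := ⟨u, hu.ne', by rwa [abs_of_pos hu]⟩
      have hz' : z + ((m * u : ℝ) : ℂ) * e ∈ ball (0 : ℂ) (r + δ) := by
        rw [mem_ball_zero_iff] at hz ⊢
        calc _ ≤ ‖z‖ + ‖((m * u : ℝ) : ℂ) * e‖ := norm_add_le _ _
          _ < _ := by rw [norm_step he, abs_of_nonneg hmu]; linarith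
      have i2 := hC s _ hz' z (sub hz)
      rw [add_sub_cancel_left, norm_step he, abs_of_nonneg hmu] at i2
      have i3 : ‖(G (z + ((m * u : ℝ) : ℂ) * e + (u : ℝ) * e) - G (z + ((m * u : ℝ) : ℂ) * e)) -
          (G (z + (u : ℝ) * e) - G z)‖ ≤ u * (C * √(m * u)) := by
        rw [← hmul s, ← hmul s z, ← mul_sub, norm_mul, Complex.norm_real, Real.norm_eq_abs,
          show |(s : ℝ)| = u from abs_of_pos hu]
        gcongr
      have hC0 := hC0 z hz
      have e1 : z + ((((m : ℝ) + 1) * u : ℝ) : ℂ) * e =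
          z + ((m * u : ℝ) : ℂ) * e + (u : ℝ) * e := by push_cast; ring
      have e2 : G (z + ((((m : ℝ) + 1) * u : ℝ) : ℂ) * e) - G z -
          ((m : ℂ) + 1) * (G (z + (u : ℝ) * e) - G z) =
          (G (z + ((m * u : ℝ) : ℂ) * e) - G z - m * (G (z + (u : ℝ) * e) - G z)) +
          ((G (z + ((m * u : ℝ) : ℂ) * e + (u : ℝ) * e) - G (z + ((m * u : ℝ) : ℂ) * e)) -
          (G (z + (u : ℝ) * e) - G z)) := by rw [e1]; ring
      push_cast at e2 i1 i3 ⊢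
      rw [e2]
      refine (norm_add_le _ _).trans ((add_le_add i1 i3).trans ?_)
      have : √(m * u) ≤ √((m + 1) * u) := Real.sqrt_le_sqrt (by nlinarith)
      calc _ = (m + 1) * (u * (C * √(m * u))) := by ring
        _ ≤ _ := by gcongr
  -- Compactness gives a limit k along some sequence of steps. Every step s is a limit of integral
  -- multiples of the steps of that sequence, so the telescoping comparison and continuity of G
  -- estimate the quotient of step s against k.
  have key : ∀ z ∈ ball (0 : ℂ) r, ∃ k : ℂ, ‖k‖ ≤ B ∧ ∀ s : ℝ, 0 < s → s < δ →
      ‖dq s e G z - k‖ ≤ C * √s := by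
    intro z hz
    let u : ℕ → ℝ := fun n => δ / (n + 2)
    have hu0 : ∀ n, 0 < u n := fun n => by positivity
    have huδ : ∀ n, u n < δ := fun n => by
      rw [div_lt_iff₀ (by positivity)]; nlinarith [(Nat.cast_nonneg n : (0 : ℝ) ≤ n)]
    have hul : Tendsto u atTop (𝓝 0) :=
      tendsto_const_nhds.div_atTop (tendsto_atTop_add_const_right _ _ tendsto_natCast_atTop_atTop)
    have hbd : ∀ n, dq (u n) e G z ∈ closedBall (0 : ℂ) B := fun n => by
      rw [mem_closedBall_zero_iff]
      exact hB ⟨u n, (hu0 n).ne', by rw [abs_of_pos (hu0 n)]; exact huδ n⟩ z (sub hz)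
    obtain ⟨k, hk, φ, hφ, hlim⟩ := (isCompact_closedBall (0 : ℂ) B).tendsto_subseq hbd
    refine ⟨k, by simpa using hk, fun s hs hsδ => ?_⟩
    have hC0 := hC0 z hz
    let v : ℕ → ℝ := fun n => u (φ n)
    have hv0 : ∀ n, 0 < v n := fun n => hu0 _
    have hvl : Tendsto v atTop (𝓝 0) := hul.comp hφ.tendsto_atTop
    -- Rounding down keeps m·v at most s, so the multiple stays below δ, while the error is less
    -- than v and tends to 0.
    let m : ℕ → ℕ := fun n => ⌊s / v n⌋₊
    have hm1 : ∀ n, m n * v n ≤ s := fun n => by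
      rw [← le_div_iff₀ (hv0 n)]; exact Nat.floor_le (by have := hv0 n; positivity)
    have hm2 : ∀ n, s - v n ≤ m n * v n := fun n => by
      have := Nat.lt_floor_add_one (s / v n)
      rw [div_lt_iff₀ (hv0 n)] at this
      simp only [m]; linarith
    have hml : Tendsto (fun n => m n * v n) atTop (𝓝 s) := by
      refine tendsto_of_tendsto_of_tendsto_of_le_of_le ?_ tendsto_const_nhds hm2 hm1
      simpa using tendsto_const_nhds.sub hvl
    have hGc : ContinuousAt G (z + (s : ℝ) * e) := by
      have := shift_mem (s := ⟨s, hs.ne', by rwa [abs_of_pos hs]⟩) he hz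
      exact hc.continuousAt (isOpen_ball.mem_nhds (ball_subset_ball (by linarith) this))
    have hGl : Tendsto (fun n => G (z + ((m n * v n : ℝ) : ℂ) * e)) atTop
        (𝓝 (G (z + (s : ℝ) * e))) := by
      refine hGc.tendsto.comp (tendsto_const_nhds.add (Tendsto.mul_const _ ?_))
      exact (Complex.continuous_ofReal.tendsto s).comp hml
    have hml' : Tendsto (fun n => ((m n * v n : ℝ) : ℂ)) atTop (𝓝 (s : ℂ)) :=
      (Complex.continuous_ofReal.tendsto s).comp hml
    have hlim1 : Tendsto (fun n => ‖G (z + ((m n * v n : ℝ) : ℂ) * e) - G z -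
        ((m n * v n : ℝ) : ℂ) * dq (v n) e G z‖) atTop
        (𝓝 ‖G (z + (s : ℝ) * e) - G z - s * k‖) :=
      ((hGl.sub_const _).sub (hml'.mul hlim)).norm
    have hle : ‖G (z + (s : ℝ) * e) - G z - s * k‖ ≤ s * (C * √s) := by
      refine le_of_tendsto hlim1 (Eventually.of_forall fun n => ?_)
      have h1 := avg (v n) (hv0 n) (m n) ((hm1 n).trans_lt hsδ) z hz
      have e1 : ((m n * v n : ℝ) : ℂ) * dq (v n) e G z =
          m n * (G (z + (v n : ℝ) * e) - G z) := by
        have : ((v n : ℝ) : ℂ) ≠ 0 := by exact_mod_cast (hv0 n).ne'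
        rw [dq]; push_cast; field_simp
      rw [e1]
      refine h1.trans ?_
      have h2 := hm1 n
      rw [← mul_assoc]
      gcongr
    have hs0 : (s : ℂ) ≠ 0 := by exact_mod_cast hs.ne'
    have e2 : dq s e G z - k = (G (z + (s : ℝ) * e) - G z - s * k) / s := by
      rw [dq]; field_simp
    rw [e2, norm_div, Complex.norm_real, Real.norm_eq_abs, abs_of_pos hs, div_le_iff₀ hs]
    linarith
  choose! k hk1 hk2 using key
  refine ⟨k, hk1, fun z hz w hw => ?_, fun s z hz => ?_⟩
  · have hC0 := hC0 z hz
    have h : ∀ s : ℝ, s ∈ Ioo 0 δ → ‖k z - k w‖ ≤ C * √‖z - w‖ + 2 * C * √s := by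
      intro s hs
      have a1 := hk2 z hz s hs.1 hs.2
      have a2 := hk2 w hw s hs.1 hs.2
      have a3 := hC ⟨s, hs.1.ne', by rw [abs_of_pos hs.1]; exact hs.2⟩ z (sub hz) w (sub hw)
      rw [norm_sub_rev] at a1
      have : k z - k w = (k z - dq s e G z) + (dq s e G z - dq s e G w) +
          (dq s e G w - k w) := by ring
      rw [this]
      refine norm_add₃_le.trans ?_
      simp only at a3
      linarith
    have hl : Tendsto (fun s : ℝ => C * √‖z - w‖ + 2 * C * √s) (𝓝[>] 0)
        (𝓝 (C * √‖z - w‖)) := by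
      have : Continuous fun s : ℝ => C * √‖z - w‖ + 2 * C * √s := by fun_prop
      simpa using (this.tendsto 0).mono_left nhdsWithin_le_nhds
    refine ge_of_tendsto hl ?_
    filter_upwards [Ioo_mem_nhdsGT hδ] with s hs using h s hs
  · have hC0 := hC0 z hz
    rcases lt_or_gt_of_ne s.2.1 with hs | hs
    -- A quotient of negative step at z is the quotient of opposite step at the shifted point.
    -- Moving the point back costs one Hölder increment, whence the factor 2 in the bound.
    · let s' : Steps δ := ⟨-s, neg_ne_zero.2 s.2.1, by rw [abs_neg]; exact s.2.2⟩
      have e1 : dq s e G z = dq s' e G (z + (s : ℝ) * e) := by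
        have : (((s : ℝ)) : ℂ) ≠ 0 := by exact_mod_cast s.2.1
        simp only [dq, s']
        push_cast
        rw [show z + ((s : ℝ) : ℂ) * e + -((s : ℝ) : ℂ) * e = z by ring]
        field_simp
        ring
      have a1 := hC s' _ (shift_mem (s := s) he hz) z (sub hz)
      have a2 := hk2 z hz s' (neg_pos.2 hs) (by have := s.2.2; rwa [abs_of_neg hs] at this)
      rw [add_sub_cancel_left, norm_step he, ← e1] at a1
      have e3 : (s' : ℝ) = |(s : ℝ)| := (abs_of_neg hs).symm
      rw [e3] at a1 a2
      have : dq s e G z - k z = (dq s e G z - dq |(s : ℝ)| e G z) + (dq |(s : ℝ)| e G z - k z) := by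
        ring
      rw [this]
      exact (norm_add_le _ _).trans (by linarith)
    · have a2 := hk2 z hz s hs (by have := s.2.2; rwa [abs_of_pos hs] at this)
      rw [abs_of_pos hs]
      have : 0 ≤ C * √(s : ℝ) := by positivity
      linarith

/-! ### Higher regularity -/

/-- The difference quotients in the two coordinate directions converge to Hölder partial
derivatives, and continuous partial derivatives give differentiability. -/
lemma HolderBdd.of_dq {r δ : ℝ} (hδ : 0 < δ) {G : ℂ → ℂ}
    (hG : HolderBdd (r + δ + δ) 0 fun _ : Unit => G)
    (hq : ∀ e : ℂ, ‖e‖ = 1 → HolderBdd (r + δ) 0 fun s : Steps δ => _root_.dq s e G) :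
    HolderBdd r 1 fun _ : Unit => G := by
  have hc : ContinuousOn G (ball 0 (r + δ + δ)) := (hG.contDiffOn ()).continuousOn
  obtain ⟨B₁, hB₁⟩ := (hq 1 norm_one).1
  obtain ⟨C₁, hC₁0, hC₁⟩ := (hq 1 norm_one).2.exists_nonneg
  obtain ⟨B₂, hB₂⟩ := (hq Complex.I Complex.norm_I).1
  obtain ⟨C₂, hC₂0, hC₂⟩ := (hq Complex.I Complex.norm_I).2.exists_nonneg
  obtain ⟨k₁, a1, a2, a3⟩ := exists_deriv_of_dq norm_one hδ hc hB₁ hC₁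
  obtain ⟨k₂, b1, b2, b3⟩ := exists_deriv_of_dq Complex.norm_I hδ hc hB₂ hC₂
  have step : ∀ (e : ℂ) (C : ℝ) (k : ℂ → ℂ) (_ : 0 ≤ C) (_ : ∀ s : Steps δ, ∀ z ∈ ball (0 : ℂ) r,
      ‖_root_.dq s e G z - k z‖ ≤ 2 * C * √|(s : ℝ)|) (a : ℝ) (_ : |a| < δ) (z : ℂ)
      (_ : z ∈ ball (0 : ℂ) r), ‖G (z + a * e) - G z - a * k z‖ ≤ |a| * (2 * C * √|a|) := by
    intro e C k hC hk a ha z hz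
    rcases eq_or_ne a 0 with rfl | h0
    · simp
    · have h := hk ⟨a, h0, ha⟩ z hz
      have h0' : (a : ℂ) ≠ 0 := by exact_mod_cast h0
      have e1 : G (z + a * e) - G z - a * k z = a * (_root_.dq a e G z - k z) := by
        rw [_root_.dq]; field_simp
      rw [e1, norm_mul, Complex.norm_real, Real.norm_eq_abs]
      gcongr
  have hderiv : ∀ z ∈ ball (0 : ℂ) r, HasFDerivAt G
      (Complex.reCLM.smulRight (k₁ z) + Complex.imCLM.smulRight (k₂ z)) z := by
    intro z hz
    rw [hasFDerivAt_iff_tendsto]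
    obtain ⟨ρ, hρ, hρs⟩ := Metric.isOpen_iff.1 isOpen_ball z hz
    set K := 3 * C₁ + 2 * C₂ with hK
    have hl : Tendsto (fun x : ℂ => K * √‖x - z‖) (𝓝 z) (𝓝 0) := by
      have : Continuous fun x : ℂ => K * √‖x - z‖ := by fun_prop
      simpa using this.tendsto z
    refine squeeze_zero' (Eventually.of_forall fun x => by positivity) ?_ hl
    filter_upwards [ball_mem_nhds z (lt_min hρ hδ)] with x hx
    set h := x - z with hh
    have hxn : ‖h‖ < min ρ δ := by rwa [mem_ball_iff_norm] at hx
    set a := h.re with ha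
    set b := h.im with hb
    have han : |a| ≤ ‖h‖ := Complex.abs_re_le_norm h
    have hbn : |b| ≤ ‖h‖ := Complex.abs_im_le_norm h
    -- The corner of the path from z to x made of a vertical and a horizontal segment. It lies in
    -- the disc because it is no farther from z than x is.
    set y := z + b * Complex.I with hy
    have hyz : ‖y - z‖ = |b| := by rw [hy, add_sub_cancel_left, norm_step Complex.norm_I]
    have hyr : y ∈ ball (0 : ℂ) r := hρs (by
      rw [mem_ball_iff_norm, hyz]
      exact hbn.trans_lt (hxn.trans_le (min_le_left _ _)))
    have hxe : x = y + a * 1 := by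
      rw [hy, mul_one, add_assoc, add_comm (_ * _), ha, hb, Complex.re_add_im, hh]; ring
    have n1 := step 1 C₁ k₁ hC₁0 a3 a (han.trans_lt (hxn.trans_le (min_le_right _ _))) y hyr
    have n2 := step Complex.I C₂ k₂ hC₂0 b3 b (hbn.trans_lt (hxn.trans_le (min_le_right _ _))) z hz
    have n3 := a2 y hyr z hz
    rw [hyz] at n3
    rw [← hxe] at n1
    rw [← hy] at n2
    have e : G x - G z - (Complex.reCLM.smulRight (k₁ z) + Complex.imCLM.smulRight (k₂ z)) h =
        (G x - G y - a * k₁ y) + a * (k₁ y - k₁ z) + (G y - G z - b * k₂ z) := by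
      simp only [_root_.add_apply, ContinuousLinearMap.smulRight_apply, Complex.reCLM_apply,
        Complex.imCLM_apply, Complex.real_smul, ← ha, ← hb]
      ring
    have hsa : √|a| ≤ √‖h‖ := Real.sqrt_le_sqrt han
    have hsb : √|b| ≤ √‖h‖ := Real.sqrt_le_sqrt hbn
    have bound : ‖G x - G z - (Complex.reCLM.smulRight (k₁ z) +
        Complex.imCLM.smulRight (k₂ z)) h‖ ≤ ‖h‖ * (K * √‖h‖) := by
      rw [e]
      have n4 : ‖(a : ℂ) * (k₁ y - k₁ z)‖ ≤ ‖h‖ * (C₁ * √‖h‖) := by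
        rw [norm_mul, Complex.norm_real, Real.norm_eq_abs]
        exact mul_le_mul han (n3.trans (by gcongr)) (norm_nonneg _) (norm_nonneg _)
      have n1' : |a| * (2 * C₁ * √|a|) ≤ ‖h‖ * (2 * C₁ * √‖h‖) := by gcongr
      have n2' : |b| * (2 * C₂ * √|b|) ≤ ‖h‖ * (2 * C₂ * √‖h‖) := by gcongr
      refine norm_add₃_le.trans ?_
      rw [hK]
      nlinarith
    rcases eq_or_ne h 0 with h0 | h0
    · simp [h0]
    · have hpos : 0 < ‖h‖ := norm_pos_iff.2 h0
      rw [inv_mul_le_iff₀ hpos]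
      exact bound
  refine ⟨hG.1.mono (by linarith), fun _ z hz => (hderiv z hz).differentiableAt, ?_, ?_⟩
  · refine HolderBdd.congr (F := fun _ => k₁) ⟨⟨B₁, fun _ => a1⟩, C₁, fun _ => a2⟩ fun _ z hz => ?_
    rw [(hderiv z hz).fderiv]; simp
  · refine HolderBdd.congr (F := fun _ => k₂) ⟨⟨B₂, fun _ => b1⟩, C₂, fun _ => b2⟩ fun _ z hz => ?_
    rw [(hderiv z hz).fderiv]; simp

lemma HolderBdd.fderiv_apply {ι : Type*} {r : ℝ} {k : ℕ} {F : ι → ℂ → ℂ}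
    (h : HolderBdd r (k + 1) F) (e : ℂ) : HolderBdd r k fun i z => fderiv ℝ (F i) z e := by
  refine (((HolderBdd.const (e.re : ℂ)).mul h.2.2.1).add
    ((HolderBdd.const (e.im : ℂ)).mul h.2.2.2)).congr fun i z _ => ?_
  simp only [← Complex.real_smul]
  rw [← map_smul, ← map_smul, ← map_add]
  congr 1
  simp [Complex.re_add_im]

/-- The difference quotients of W already have Hölder data, so their gradients are Hölder uniformly
in the step. These gradients are the difference quotients of the gradient of W, to which
`HolderBdd.of_dq` applies. -/
lemma SolFam.holderBdd_two {r R : ℝ} {μ h W : ℂ → ℂ}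
    (H : SolFam R (fun _ : Unit => μ) (fun _ => h) fun _ => W)
    (hμ : HolderBdd R 1 fun _ : Unit => μ) (hh : HolderBdd R 1 fun _ : Unit => h)
    (hW : HolderBdd R 1 fun _ : Unit => W)
    (hr : 0 < r) (hrR : r < R) (hR : R ≤ 1) : HolderBdd r 2 fun _ : Unit => W := by
  set δ := (R - r) / 4 with hδ
  have hδ0 : 0 < δ := by rw [hδ]; linarith
  have hRe : R = r + δ + δ + δ + δ := by rw [hδ]; ring
  have hW' := hW
  have hμ' := hμ
  have hh' := hh
  have H' := H
  rw [hRe] at hW' hμ' hh' H'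
  have key : ∀ e : ℂ, ‖e‖ = 1 → HolderBdd (r + δ) 1 fun s : Steps δ => _root_.dq s e W := by
    intro e he
    refine (H'.dq he hδ0).holder_deriv (by positivity) (by linarith) (by linarith)
      (hW'.dq he hδ0) ?_ fun s => ?_
    · have h2 := ((hW'.wirt (-Complex.I)).shift he).reindex fun s : Steps δ => (s, ())
      have h3 := (hμ'.dq he hδ0).mul h2
      exact (hh'.dq he hδ0).add (h3.add h3.conj)
    · have h2 := (hW'.shift he).reindex fun _ : Unit => (s, ())
      refine ((HolderBdd.const (((s : ℝ) : ℂ)⁻¹)).mul (h2.add ((HolderBdd.const (-1)).mul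
        (hW'.mono (show r + δ + δ + δ ≤ _ by linarith))))).congr fun _ z hz => ?_
      simp only [_root_.dq]
      rw [div_eq_mul_inv]
      ring
  have hd : ∀ z ∈ ball (0 : ℂ) (r + δ + δ), DifferentiableAt ℝ W z := fun z hz =>
    H.differentiableAt () (ball_subset_ball (by linarith) hz)
  have hG : ∀ e', HolderBdd r 1 fun (_ : Unit) z => fderiv ℝ W z e' := fun e' => by
    refine HolderBdd.of_dq hδ0 ((hW.fderiv_apply e').mono (by linarith)) fun e he => ?_
    exact ((key e he).fderiv_apply e').congr fun s z hz => (fderiv_dq he hd s hz hδ0).2 e'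
  exact ⟨hW.bdd.mono hrR.le, fun _ z hz => H.differentiableAt () (ball_subset_ball hrR.le hz),
    hG 1, hG Complex.I⟩

lemma fderiv_fderiv_apply_comm {f : ℂ → ℂ} {z : ℂ} (hf : ContDiffAt ℝ 2 f z) (a b : ℂ) :
    fderiv ℝ (fun z => fderiv ℝ f z a) z b = fderiv ℝ (fun z => fderiv ℝ f z b) z a := by
  have hd : DifferentiableAt ℝ (fderiv ℝ f) z :=
    (hf.fderiv_right (m := 1) (by norm_num)).differentiableAt one_ne_zero
  have h : ∀ c d, fderiv ℝ (fun z => fderiv ℝ f z c) z d = fderiv ℝ (fderiv ℝ f) z d c := by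
    intro c d
    rw [fderiv_clm_apply hd (differentiableAt_const c)]
    simp
  rw [h, h]
  exact (hf.isSymmSndFDerivAt (by simp)).eq b a

lemma differentiableAt_fderiv_apply {f : ℂ → ℂ} {z : ℂ} (hf : ContDiffAt ℝ 2 f z) (a : ℂ) :
    DifferentiableAt ℝ (fun z => fderiv ℝ f z a) z :=
  ((hf.fderiv_right (m := 1) (by norm_num)).differentiableAt one_ne_zero).clm_apply
    (differentiableAt_const a)

lemma fderiv_wirt {f : ℂ → ℂ} {z : ℂ} (hf : ContDiffAt ℝ 2 f z) (c e : ℂ) :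
    DifferentiableAt ℝ (wirt c f) z ∧
    fderiv ℝ (wirt c f) z e = wirt c (fun z => fderiv ℝ f z e) z := by
  have h1 := differentiableAt_fderiv_apply hf 1
  have h2 := differentiableAt_fderiv_apply hf Complex.I
  have e1 : wirt c f = fun z => (1 / 2 : ℂ) * (fderiv ℝ f z 1 + c * fderiv ℝ f z Complex.I) := by
    funext z; simp only [wirt]; ring
  refine ⟨by rw [e1]; exact (h1.add (h2.const_mul c)).const_mul _, ?_⟩
  rw [e1, fderiv_const_mul (h1.fun_add (h2.const_mul c)), fderiv_fun_add h1 (h2.const_mul c),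
    fderiv_const_mul h2, wirt, fderiv_fderiv_apply_comm hf e, fderiv_fderiv_apply_comm hf e]
  simp only [_root_.smul_apply, _root_.add_apply, smul_eq_mul]
  ring

/-- Directional derivatives of solutions solve the Beltrami system with the same coefficient. -/
lemma SolFam.fderiv {ι : Type*} {R : ℝ} {μ h W : ι → ℂ → ℂ} (H : SolFam R μ h W)
    (hW : ∀ i, ContDiffOn ℝ 2 (W i) (ball 0 R)) (e : ℂ) :
    SolFam R μ (fun i z => fderiv ℝ (h i) z e + (fderiv ℝ (μ i) z e * dz (W i) z +
      conj (fderiv ℝ (μ i) z e * dz (W i) z))) fun i z => fderiv ℝ (W i) z e := by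
  refine ⟨H.coeff, H.small, H.small', fun i => ?_, fun i z hz => ?_⟩
  · exact ((hW i).fderiv_of_isOpen isOpen_ball (m := 1) (by norm_num)).clm_apply contDiffOn_const
  · have hc := (hW i).contDiffAt (isOpen_ball.mem_nhds hz)
    obtain ⟨d1, f1⟩ := fderiv_wirt hc Complex.I e
    obtain ⟨d2, f2⟩ := fderiv_wirt hc (-Complex.I) e
    have dμ := (H.coeff i).differentiable one_ne_zero z
    have d3 := dμ.fun_mul d2
    have d4 : DifferentiableAt ℝ (fun z => conj (μ i z * dz (W i) z)) z :=
      Complex.conjCLE.differentiableAt.comp z d3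
    have e1 : _root_.fderiv ℝ (h i) z = _root_.fderiv ℝ (fun z =>
        dzbar (W i) z - (μ i z * dz (W i) z + conj (μ i z * dz (W i) z))) z :=
      fderiv_congr_ball (fun z hz => (H.eq i z hz).symm) hz
    rw [e1, fderiv_fun_sub d1 (d3.fun_add d4), fderiv_fun_add d3 d4]
    simp only [_root_.sub_apply, _root_.add_apply]
    rw [fderiv_conj_apply d3, fderiv_fun_mul dμ d2]
    simp only [_root_.add_apply, _root_.smul_apply, smul_eq_mul, f1, f2, beltrami, map_add, map_mul]
    ring

/-- Induction by differentiating the system: a derivative of W solves it with the same coefficient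
and with a right-hand side controlled by the previous level. The discs shrink at each
differentiation. -/
lemma SolFam.holderBdd {ι : Type*} {k : ℕ} {r R : ℝ} {μ h W : ι → ℂ → ℂ} (H : SolFam R μ h W)
    (hμ : HolderBdd R k μ) (hh : HolderBdd R k h) (hW' : ∀ i, HolderBdd R 1 fun _ : Unit => W i)
    (hW : BddFam R W) (hr : 0 < r) (hrR : r < R) (hR : R ≤ 1) : HolderBdd r (k + 1) W := by
  induction k generalizing h W r R with
  | zero =>
    set r₁ := (r + R) / 2 with hr₁
    have h1 : r < r₁ := by rw [hr₁]; linarith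
    have h2 : r₁ < R := by rw [hr₁]; linarith
    exact (H.mono h2.le).holder_deriv hr h1 (by linarith)
      (H.holder (by linarith) h2 hR hW hh.1) (hh.mono h2.le) fun i => (hW' i).mono h2.le
  | succ k ih =>
    set r₁ := (r + R) / 2 with hr₁
    have h1 : r < r₁ := by rw [hr₁]; linarith
    have h2 : r₁ < R := by rw [hr₁]; linarith
    have hr₁0 : 0 < r₁ := by linarith
    have hone : 1 ≤ k + 1 := by omega
    -- Regularity of each member separately. It permits differentiating the system and provides the
    -- nonuniform hypothesis for the derivatives.
    have htwo : ∀ i, HolderBdd r₁ 2 fun _ : Unit => W i := fun i =>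
      SolFam.holderBdd_two (R := R) (μ := μ i) (h := h i)
        ⟨fun _ => H.coeff i, fun _ => H.small i, fun _ => H.small' i, fun _ => H.reg i,
          fun _ => H.eq i⟩
        ((hμ.reindex fun _ : Unit => i).of_le hone) ((hh.reindex fun _ : Unit => i).of_le hone)
        (hW' i) hr₁0 h2 hR
    have hWk : HolderBdd r₁ (k + 1) W := ih H hμ.pred hh.pred hW' hW hr₁0 h2 hR
    have hH := (H.mono h2.le).fderiv fun i => (htwo i).contDiffOn ()
    have hV : ∀ e, HolderBdd r (k + 1) fun i z => _root_.fderiv ℝ (W i) z e := fun e => by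
      have ha := ((hμ.mono h2.le).fderiv_apply e).mul (hWk.wirt (-Complex.I))
      exact ih (hH e) (hμ.pred.mono h2.le) (((hh.mono h2.le).fderiv_apply e).add (ha.add ha.conj))
        (fun i => (htwo i).fderiv_apply e) (hWk.fderiv_apply e).bdd hr h1 (by linarith)
    exact ⟨hW.mono hrR.le, fun i z hz => H.differentiableAt i (ball_subset_ball hrR.le hz),
      hV 1, hV Complex.I⟩

/-- Interior regularity and estimates for the Beltrami system. -/
theorem SolFam.regularity {ι : Type*} {k : ℕ} {r R : ℝ} {μ h W : ι → ℂ → ℂ} (H : SolFam R μ h W)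
    (hμ : HolderBdd R k μ) (hh : HolderBdd R k h) (hh' : ∀ i, ContDiffOn ℝ 1 (h i) (ball 0 R))
    (hW : BddFam R W) (hr : 0 < r) (hrR : r < R) (hR : R ≤ 1) : HolderBdd r (k + 1) W := by
  set r₁ := (r + R) / 2 with hr₁
  have h1 : r < r₁ := by rw [hr₁]; linarith
  have h2 : r₁ < R := by rw [hr₁]; linarith
  have hone : ∀ i, HolderBdd r₁ 1 fun _ : Unit => W i := fun i =>
    SolFam.holderBdd_one (R := R) (μ := μ i) (h := h i)
      ⟨fun _ => H.coeff i, fun _ => H.small i, fun _ => H.small' i, fun _ => H.reg i,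
        fun _ => H.eq i⟩ (hh' i) (by linarith) h2 hR
  exact (H.mono h2.le).holderBdd (hμ.mono h2.le) (hh.mono h2.le) hone (hW.mono h2.le) hr h1
    (by linarith)

/-! ### Symbol classes at infinity -/

/-- The weight `x ^ p (ln x) ^ q`. -/
noncomputable def wt (p q x : ℝ) : ℝ := x ^ p * Real.log x ^ q

/-- Functions on `ℂ` with `m` derivatives near infinity, the `j`-th of which is
`O(|z| ^ (p - j) (ln |z|) ^ q)`. -/
def FarO : ℕ → ℝ → ℝ → (ℂ → ℂ) → Prop
  | 0, p, q, F => (∀ᶠ z in cobounded ℂ, ContinuousAt F z) ∧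
      F =O[cobounded ℂ] fun z => wt p q ‖z‖
  | m + 1, p, q, F => (∀ᶠ z in cobounded ℂ, DifferentiableAt ℝ F z) ∧
      (F =O[cobounded ℂ] fun z => wt p q ‖z‖) ∧
      FarO m (p - 1) q (fun z => fderiv ℝ F z 1) ∧
      FarO m (p - 1) q (fun z => fderiv ℝ F z Complex.I)

lemma eventually_cobounded_iff {E : Type*} [SeminormedAddCommGroup E] {P : E → Prop} :
    (∀ᶠ z in cobounded E, P z) ↔ ∃ R : ℝ, ∀ z, R < ‖z‖ → P z := by
  rw [← comap_norm_atTop, eventually_comap]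
  constructor
  · intro h
    obtain ⟨R, hR⟩ := eventually_atTop.1 h
    exact ⟨R, fun z hz => hR _ hz.le z rfl⟩
  · rintro ⟨R, hR⟩
    filter_upwards [eventually_gt_atTop R] with b hb z hz
    exact hR z (hz ▸ hb)

lemma eventually_norm_gt (E : Type*) [SeminormedAddCommGroup E] (R : ℝ) :
    ∀ᶠ z in cobounded E, R < ‖z‖ :=
  eventually_cobounded_iff.2 ⟨R, fun _ => id⟩

lemma eventually_cobounded_nhds {E : Type*} [SeminormedAddCommGroup E] {P : E → Prop}
    (h : ∀ᶠ z in cobounded E, P z) : ∀ᶠ z in cobounded E, ∀ᶠ y in 𝓝 z, P y := by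
  obtain ⟨R, hR⟩ := eventually_cobounded_iff.1 h
  refine eventually_cobounded_iff.2 ⟨R, fun z hz => ?_⟩
  filter_upwards [(isOpen_lt continuous_const continuous_norm).mem_nhds hz] with y hy using hR y hy

lemma wt_pos {p q x : ℝ} (hx : 1 < x) : 0 < wt p q x :=
  mul_pos (Real.rpow_pos_of_pos (by linarith) _) (Real.rpow_pos_of_pos (Real.log_pos hx) _)

lemma wt_mul {p q p' q' x : ℝ} (hx : 1 < x) : wt p q x * wt p' q' x = wt (p + p') (q + q') x := by
  rw [wt, wt, wt, Real.rpow_add (by linarith), Real.rpow_add (Real.log_pos hx)]; ring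

lemma wt_zero {p x : ℝ} : wt p 0 x = x ^ p := by simp [wt]

/-- Weights at comparable points are comparable. -/
lemma wt_le {p q x y K : ℝ} (hK : 2 ≤ K) (hx : K ^ 2 ≤ x) (h1 : x / K ≤ y) (h2 : y ≤ K * x) :
    wt p q y ≤ K ^ |p| * 2 ^ |q| * wt p q x := by
  have key : ∀ {L s t r : ℝ}, 0 < L → 0 < s → s / L ≤ t → t ≤ L * s → t ^ r ≤ L ^ |r| * s ^ r := by
    intro L s t r hL hs h1 h2
    have ht : 0 < t := (div_pos hs hL).trans_le h1
    rcases le_total 0 r with hr | hr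
    · rw [abs_of_nonneg hr, ← Real.mul_rpow hL.le hs.le]
      exact Real.rpow_le_rpow ht.le h2 hr
    · have e : L ^ |r| = L⁻¹ ^ r := by
        rw [abs_of_nonpos hr, Real.inv_rpow hL.le, Real.rpow_neg hL.le]
      rw [e, ← Real.mul_rpow (by positivity) hs.le]
      exact Real.rpow_le_rpow_of_nonpos (by positivity) (by rwa [inv_mul_eq_div]) hr
  have hK0 : 0 < K := by linarith
  have hx0 : 0 < x := by nlinarith
  have hlx : Real.log K * 2 ≤ Real.log x := by
    have : Real.log (K ^ 2) ≤ Real.log x := Real.log_le_log (by positivity) hx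
    rw [Real.log_pow] at this; push_cast at this; linarith
  have hl2 : 0 < Real.log K := Real.log_pos (by linarith)
  have hy : 0 < y := (div_pos hx0 hK0).trans_le h1
  have hy1 : Real.log x - Real.log K ≤ Real.log y := by
    rw [← Real.log_div hx0.ne' hK0.ne']
    exact Real.log_le_log (by positivity) h1
  have hy2 : Real.log y ≤ Real.log K + Real.log x := by
    rw [← Real.log_mul hK0.ne' hx0.ne']
    exact Real.log_le_log hy h2
  have a := key (r := p) hK0 hx0 h1 h2
  have b := key (L := 2) (r := q) two_pos (by linarith : 0 < Real.log x) (t := Real.log y)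
    (by linarith) (by linarith)
  have hy0 : 0 ≤ Real.log y := by linarith
  calc wt p q y ≤ (K ^ |p| * x ^ p) * (2 ^ |q| * Real.log x ^ q) := by
        unfold wt
        gcongr
    _ = _ := by unfold wt; ring

/-- A strict gain in the power dominates any power of the logarithm, so the logarithmic exponents
are compared only when the power need not improve. -/
lemma wt_isBigO_atTop {p p' q q' : ℝ} (h : p < p' ∨ p ≤ p' ∧ q ≤ q') :
    wt p q =O[atTop] wt p' q' := by
  rcases h with h | ⟨h, h'⟩
  · have h1 : (fun x : ℝ => Real.log x ^ (q - q')) =O[atTop] fun x => x ^ (p' - p) :=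
      (isLittleO_log_rpow_rpow_atTop (q - q') (by linarith)).isBigO
    obtain ⟨C, hC⟩ := h1.bound
    refine IsBigO.of_bound C ?_
    filter_upwards [hC, eventually_gt_atTop 1] with x hx h1x
    have hx0 : (0 : ℝ) < x := by linarith
    have e1 : wt p q x = wt p q' x * Real.log x ^ (q - q') := by
      rw [wt, wt, mul_assoc, ← Real.rpow_add (Real.log_pos h1x)]; ring_nf
    have e2 : wt p' q' x = wt p q' x * x ^ (p' - p) := by
      have : x ^ p' = x ^ p * x ^ (p' - p) := by rw [← Real.rpow_add hx0]; ring_nf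
      rw [wt, wt, this]; ring
    rw [e1, e2, norm_mul, norm_mul]
    nlinarith [norm_nonneg (wt p q' x)]
  · refine IsBigO.of_bound 1 ?_
    filter_upwards [eventually_ge_atTop (Real.exp 1), eventually_gt_atTop 1] with x hx h1x
    have hx0 : (0 : ℝ) < x := by linarith
    rw [Real.norm_of_nonneg (wt_pos h1x).le, Real.norm_of_nonneg (wt_pos h1x).le, one_mul, wt, wt]
    have hl : 1 ≤ Real.log x := by rwa [Real.le_log_iff_exp_le hx0]
    have := Real.rpow_le_rpow_of_exponent_le hl h'
    have := Real.rpow_le_rpow_of_exponent_le h1x.le h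
    gcongr

lemma wt_isBigO {p p' q q' : ℝ} (h : p < p' ∨ p ≤ p' ∧ q ≤ q') (E : Type*)
    [SeminormedAddCommGroup E] :
    (fun z : E => wt p q ‖z‖) =O[cobounded E] fun z => wt p' q' ‖z‖ :=
  (wt_isBigO_atTop h).comp_tendsto tendsto_norm_cobounded_atTop

section FarO
variable {m : ℕ} {p q p' q' : ℝ} {F G : ℂ → ℂ}

lemma FarO.isBigO (h : FarO m p q F) : F =O[cobounded ℂ] fun z => wt p q ‖z‖ := by
  cases m
  exacts [h.2, h.2.1]

lemma FarO.continuousAt (h : FarO m p q F) : ∀ᶠ z in cobounded ℂ, ContinuousAt F z := by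
  cases m
  exacts [h.1, h.1.mono fun z hz => hz.continuousAt]

lemma FarO.pred (h : FarO (m + 1) p q F) : FarO m p q F := by
  induction m generalizing F p with
  | zero => exact ⟨h.continuousAt, h.isBigO⟩
  | succ m ih => exact ⟨h.1, h.2.1, ih h.2.2.1, ih h.2.2.2⟩

lemma FarO.of_le {n : ℕ} (h : FarO m p q F) (hn : n ≤ m) : FarO n p q F := by
  induction m with
  | zero => rwa [Nat.le_zero.1 hn]
  | succ k ih =>
    rcases Nat.le_succ_iff.1 hn with h' | h'
    · exact ih h.pred h'
    · rwa [h']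

lemma FarO.congr (h : FarO m p q F) (hFG : F =ᶠ[cobounded ℂ] G) : FarO m p q G := by
  induction m generalizing F G p with
  | zero =>
    refine ⟨?_, h.2.congr' hFG EventuallyEq.rfl⟩
    filter_upwards [h.1, eventually_cobounded_nhds hFG] with z hz hn using hz.congr hn
  | succ m ih =>
    have hn := eventually_cobounded_nhds hFG
    refine ⟨?_, h.2.1.congr' hFG EventuallyEq.rfl, ih h.2.2.1 ?_, ih h.2.2.2 ?_⟩
    · filter_upwards [h.1, hn] with z hz hn using
        hz.congr_of_eventuallyEq (hn.mono fun _ => Eq.symm)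
    all_goals
      filter_upwards [hn] with z hn
      rw [EventuallyEq.fderiv_eq (f := F) (f₁ := G) (hn.mono fun _ => Eq.symm)]

lemma FarO.weaken (hF : FarO m p q F) (h : p < p' ∨ p ≤ p' ∧ q ≤ q') : FarO m p' q' F := by
  induction m generalizing F p p' with
  | zero => exact ⟨hF.1, hF.2.trans (wt_isBigO h ℂ)⟩
  | succ m ih =>
    have h' : p - 1 < p' - 1 ∨ p - 1 ≤ p' - 1 ∧ q ≤ q' := by
      rcases h with h | h
      exacts [.inl (by linarith), .inr ⟨by linarith, h.2⟩]
    exact ⟨hF.1, hF.2.1.trans (wt_isBigO h ℂ), ih hF.2.2.1 h', ih hF.2.2.2 h'⟩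

lemma FarO.add (hF : FarO m p q F) (hG : FarO m p q G) : FarO m p q fun z => F z + G z := by
  induction m generalizing F G p with
  | zero => exact ⟨by filter_upwards [hF.1, hG.1] with z h h' using h.add h', hF.2.add hG.2⟩
  | succ m ih =>
    refine ⟨by filter_upwards [hF.1, hG.1] with z h h' using h.fun_add h', hF.2.1.add hG.2.1,
      (ih hF.2.2.1 hG.2.2.1).congr ?_, (ih hF.2.2.2 hG.2.2.2).congr ?_⟩
    all_goals
      filter_upwards [hF.1, hG.1] with z h h'
      rw [fderiv_fun_add h h']; rfl

lemma isBigO_wt_mul (hF : F =O[cobounded ℂ] fun z => wt p q ‖z‖)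
    (hG : G =O[cobounded ℂ] fun z => wt p' q' ‖z‖) :
    (fun z => F z * G z) =O[cobounded ℂ] fun z => wt (p + p') (q + q') ‖z‖ := by
  refine (hF.mul hG).congr' EventuallyEq.rfl ?_
  filter_upwards [eventually_norm_gt ℂ 1] with z hz using wt_mul hz

lemma FarO.mul (hF : FarO m p q F) (hG : FarO m p' q' G) :
    FarO m (p + p') (q + q') fun z => F z * G z := by
  induction m generalizing F G p p' with
  | zero => exact ⟨by filter_upwards [hF.1, hG.1] with z h h' using h.mul h',
      isBigO_wt_mul hF.2 hG.2⟩
  | succ m ih =>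
    have e1 : p - 1 + p' = p + p' - 1 := by ring
    have e2 : p + (p' - 1) = p + p' - 1 := by ring
    have h1 := ih hF.2.2.1 hG.pred
    have h2 := ih hF.pred hG.2.2.1
    have h3 := ih hF.2.2.2 hG.pred
    have h4 := ih hF.pred hG.2.2.2
    rw [e1] at h1 h3
    rw [e2] at h2 h4
    refine ⟨by filter_upwards [hF.1, hG.1] with z h h' using h.fun_mul h',
      isBigO_wt_mul hF.2.1 hG.2.1, (h1.add h2).congr ?_, (h3.add h4).congr ?_⟩
    all_goals
      filter_upwards [hF.1, hG.1] with z h h'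
      rw [fderiv_fun_mul h h']
      simp only [_root_.add_apply, _root_.smul_apply, smul_eq_mul]
      ring

lemma FarO.zero : FarO m p q fun _ => 0 := by
  induction m generalizing p with
  | zero => exact ⟨Eventually.of_forall fun _ => continuousAt_const, isBigO_zero _ _⟩
  | succ m ih =>
    refine ⟨Eventually.of_forall fun _ => differentiableAt_const _, isBigO_zero _ _, ?_, ?_⟩
    all_goals simpa using ih

lemma FarO.const (c : ℂ) : FarO m 0 0 fun _ => c := by
  have h : (fun _ : ℂ => c) =O[cobounded ℂ] fun z => wt 0 0 ‖z‖ := by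
    simpa [wt] using isBigO_const_const c (one_ne_zero (α := ℝ)) (cobounded ℂ)
  cases m with
  | zero => exact ⟨Eventually.of_forall fun _ => continuousAt_const, h⟩
  | succ m =>
    refine ⟨Eventually.of_forall fun _ => differentiableAt_const _, h, ?_, ?_⟩
    all_goals simpa using FarO.zero

lemma FarO.const_mul (c : ℂ) (hF : FarO m p q F) : FarO m p q fun z => c * F z := by
  simpa using (FarO.const c).mul hF

lemma FarO.neg (hF : FarO m p q F) : FarO m p q fun z => -F z := by
  simpa using hF.const_mul (-1)

lemma FarO.sub (hF : FarO m p q F) (hG : FarO m p q G) : FarO m p q fun z => F z - G z := by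
  simpa [sub_eq_add_neg] using hF.add hG.neg

lemma FarO.conj (hF : FarO m p q F) : FarO m p q fun z => conj (F z) := by
  have hO : ∀ {p : ℝ} {F : ℂ → ℂ}, (F =O[cobounded ℂ] fun z => wt p q ‖z‖) →
      (fun z => (starRingEnd ℂ) (F z)) =O[cobounded ℂ] fun z => wt p q ‖z‖ := fun h =>
    IsBigO.of_norm_left (by simpa [RCLike.norm_conj] using h.norm_left)
  induction m generalizing F p with
  | zero => exact ⟨hF.1.mono fun z h => Complex.continuous_conj.continuousAt.comp h, hO hF.2⟩
  | succ m ih =>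
    refine ⟨hF.1.mono fun z h => Complex.conjCLE.differentiableAt.comp z h, hO hF.2.1,
      (ih hF.2.2.1).congr ?_, (ih hF.2.2.2).congr ?_⟩
    all_goals
      filter_upwards [hF.1] with z h
      rw [fderiv_conj_apply h]

lemma FarO.wirt (hF : FarO (m + 1) p q F) (c : ℂ) : FarO m (p - 1) q (wirt c F) := by
  refine ((hF.2.2.1.add (hF.2.2.2.const_mul c)).const_mul (1 / 2)).congr
    (Eventually.of_forall fun z => ?_)
  simp only [_root_.wirt]; ring

lemma FarO.of_wirt (hd : ∀ᶠ z in cobounded ℂ, DifferentiableAt ℝ F z)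
    (hF : F =O[cobounded ℂ] fun z => wt p q ‖z‖) (h1 : FarO m (p - 1) q (dz F))
    (h2 : FarO m (p - 1) q (dzbar F)) : FarO (m + 1) p q F := by
  refine ⟨hd, hF, (h1.add h2).congr (Eventually.of_forall fun z => ?_),
    ((h1.sub h2).const_mul Complex.I).congr (Eventually.of_forall fun z => ?_)⟩
  · simp only [_root_.wirt]; ring
  · simp only [_root_.wirt]; ring_nf; simp only [Complex.I_sq]; ring

lemma FarO.inv {c : ℝ} (hF : FarO m p 0 F) (hc : 0 < c)
    (h : ∀ᶠ z in cobounded ℂ, c * ‖z‖ ^ p ≤ ‖F z‖) : FarO m (-p) 0 fun z => (F z)⁻¹ := by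
  have hne : ∀ᶠ z in cobounded ℂ, F z ≠ 0 := by
    filter_upwards [h, eventually_norm_gt ℂ 0] with z hz h0
    exact norm_pos_iff.1 ((mul_pos hc (Real.rpow_pos_of_pos h0 _)).trans_le hz)
  have hb : (fun z => (F z)⁻¹) =O[cobounded ℂ] fun z => wt (-p) 0 ‖z‖ := by
    refine IsBigO.of_bound c⁻¹ ?_
    filter_upwards [h, eventually_norm_gt ℂ 0] with z hz h0
    have := Real.rpow_pos_of_pos h0 p
    rw [wt_zero, norm_inv, Real.norm_of_nonneg (by positivity), Real.rpow_neg h0.le, ← mul_inv]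
    exact inv_anti₀ (by positivity) hz
  induction m with
  | zero => exact ⟨by filter_upwards [hF.1, hne] with z h h' using h.inv₀ h', hb⟩
  | succ m ih =>
    have hinv := ih hF.pred
    have key : ∀ e, FarO m (p - 1) 0 (fun z => fderiv ℝ F z e) →
        FarO m (-p - 1) 0 fun z => fderiv ℝ (fun z => (F z)⁻¹) z e := by
      intro e he
      have h1 := (he.mul (hinv.mul hinv)).neg
      rw [show p - 1 + (-p + -p) = -p - 1 by ring, show (0 : ℝ) + (0 + 0) = 0 by ring] at h1
      refine h1.congr ?_
      filter_upwards [hF.1, hne] with z h h'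
      have := fderiv_div_apply (f := fun _ => 1) (differentiableAt_const _) h h' e
      simp only [one_div] at this
      rw [this]
      simp
      field_simp
    exact ⟨by filter_upwards [hF.1, hne] with z h h' using h.inv h', hb, key _ hF.2.2.1,
      key _ hF.2.2.2⟩

lemma clm_eq_smulRight (T : ℂ →L[ℝ] ℂ) :
    T = Complex.reCLM.smulRight (T 1) + Complex.imCLM.smulRight (T Complex.I) := by
  ext1 y
  simp only [_root_.add_apply, ContinuousLinearMap.smulRight_apply, Complex.reCLM_apply,
    Complex.imCLM_apply]
  rw [← map_smul, ← map_smul, ← map_add]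
  congr 1
  simp [Complex.re_add_im]

lemma FarO.contDiffAt (hF : FarO m p q F) : ∀ᶠ z in cobounded ℂ, ContDiffAt ℝ m F z := by
  induction m generalizing F p with
  | zero =>
    filter_upwards [eventually_cobounded_nhds hF.1] with z hz
    exact contDiffAt_zero.2 ⟨_, hz, fun y hy => (ContinuousAt.continuousWithinAt hy)⟩
  | succ m ih =>
    filter_upwards [ih hF.2.2.1, ih hF.2.2.2, eventually_cobounded_nhds hF.1] with z h1 h2 h3
    rw [Nat.cast_succ, contDiffAt_succ_iff_hasFDerivAt]
    refine ⟨fderiv ℝ F, ⟨_, h3, fun y hy => hy.hasFDerivAt⟩, ?_⟩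
    rw [show fderiv ℝ F = fun z => Complex.reCLM.smulRight (fderiv ℝ F z 1) +
      Complex.imCLM.smulRight (fderiv ℝ F z Complex.I) from funext fun z => clm_eq_smulRight _]
    exact (contDiffAt_const.smulRight h1).add (contDiffAt_const.smulRight h2)

lemma FarO.fderiv_isBigO (hF : FarO (m + 1) p q F) :
    (fun z => fderiv ℝ F z) =O[cobounded ℂ] fun z => wt (p - 1) q ‖z‖ := by
  have h := hF.2.2.1.isBigO.norm_left.add hF.2.2.2.isBigO.norm_left
  refine IsBigO.trans (IsBigO.of_norm_le fun z => ?_) h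
  exact norm_clm_le _

end FarO

/-! ### The Schauder estimate at infinity -/

/-- The points of modulus larger than `R`. -/
abbrev Far (R : ℝ) : Type := {z : ℂ // R < ‖z‖}

/-- The function `F` near `z₀`, rescaled by the weight and to unit size. -/
noncomputable def rescale (p q : ℝ) (F : ℂ → ℂ) (z₀ z : ℂ) : ℂ :=
  ((wt p q ‖z₀‖)⁻¹ : ℝ) * F (z₀ + (‖z₀‖ / 4 : ℝ) * z)

section Rescale
variable {m : ℕ} {p q : ℝ} {F : ℂ → ℂ}

lemma norm_center_add {z₀ z : ℂ} (hz : ‖z‖ ≤ 2) : ‖z₀‖ / 2 ≤ ‖z₀ + (‖z₀‖ / 4 : ℝ) * z‖ ∧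
    ‖z₀ + (‖z₀‖ / 4 : ℝ) * z‖ ≤ 2 * ‖z₀‖ := by
  have h : ‖((‖z₀‖ / 4 : ℝ) : ℂ) * z‖ ≤ ‖z₀‖ / 2 := by
    rw [norm_mul, Complex.norm_real, Real.norm_of_nonneg (by positivity)]
    nlinarith [norm_nonneg z₀]
  constructor
  · have := norm_sub_le_norm_add z₀ (((‖z₀‖ / 4 : ℝ) : ℂ) * z)
    linarith
  · have := norm_add_le z₀ (((‖z₀‖ / 4 : ℝ) : ℂ) * z)
    linarith [norm_nonneg z₀]

/-- The rescaled disc of radius 2 about a far point stays at distance at least half its modulus from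
the origin. -/
lemma eventually_far {P : ℂ → Prop} (h : ∀ᶠ z in cobounded ℂ, P z) :
    ∀ᶠ R in atTop, ∀ z₀ z : ℂ, R < ‖z₀‖ → ‖z‖ ≤ 2 → P (z₀ + (‖z₀‖ / 4 : ℝ) * z) := by
  obtain ⟨R₀, h⟩ := eventually_cobounded_iff.1 h
  filter_upwards [eventually_ge_atTop (2 * R₀)] with R hR z₀ z h0 hz
  exact h _ (by linarith [(norm_center_add (z₀ := z₀) hz).1])

lemma fderiv_comp_affine {f : ℂ → ℂ} {a z e : ℂ} {s : ℝ}
    (h : DifferentiableAt ℝ f (a + s * z)) :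
    fderiv ℝ (fun z => f (a + s * z)) z e = s * fderiv ℝ f (a + s * z) e := by
  have h1 : HasFDerivAt (fun z : ℂ => a + s * z) (s • ContinuousLinearMap.id ℝ ℂ) z := by
    simpa using ((hasFDerivAt_id (𝕜 := ℝ) z).const_mul (s : ℂ)).const_add a
  have := (h.hasFDerivAt.comp z h1).fderiv
  rw [Function.comp_def] at this
  rw [this]
  simp only [ContinuousLinearMap.comp_apply, _root_.smul_apply, ContinuousLinearMap.id_apply]
  rw [map_smul, Complex.real_smul]

lemma differentiableAt_rescale {z₀ z : ℂ}
    (h : DifferentiableAt ℝ F (z₀ + (‖z₀‖ / 4 : ℝ) * z)) :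
    DifferentiableAt ℝ (rescale p q F z₀) z := by
  have h1 : DifferentiableAt ℝ (fun z : ℂ => z₀ + (‖z₀‖ / 4 : ℝ) * z) z := by fun_prop
  exact (h.comp z h1).const_mul _

/-- The chain-rule factor |z₀|/4 is matched by lowering the power of the weight by one; only 1/4
remains. This makes decay at infinity equivalent to uniform bounds at unit scale. -/
lemma fderiv_rescale {z₀ z : ℂ} (h0 : 1 < ‖z₀‖)
    (h : DifferentiableAt ℝ F (z₀ + (‖z₀‖ / 4 : ℝ) * z)) (e : ℂ) :
    fderiv ℝ (rescale p q F z₀) z e =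
      1 / 4 * rescale (p - 1) q (fun z => fderiv ℝ F z e) z₀ z := by
  have h1 : DifferentiableAt ℝ (fun z : ℂ => z₀ + (‖z₀‖ / 4 : ℝ) * z) z := by fun_prop
  have h2 : wt p q ‖z₀‖ = ‖z₀‖ * wt (p - 1) q ‖z₀‖ := by
    have := wt_mul (p := 1) (q := 0) (p' := p - 1) (q' := q) h0
    rw [wt_zero, Real.rpow_one] at this
    rw [this]; ring_nf
  unfold rescale
  have h5 : DifferentiableAt ℝ (fun z : ℂ => F (z₀ + (‖z₀‖ / 4 : ℝ) * z)) z := h.comp z h1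
  rw [fderiv_const_mul h5, _root_.smul_apply, smul_eq_mul, fderiv_comp_affine h, h2]
  have h3 : (‖z₀‖ : ℂ) ≠ 0 := by exact_mod_cast (by linarith : ‖z₀‖ ≠ 0)
  have h4 : ((wt (p - 1) q ‖z₀‖ : ℝ) : ℂ) ≠ 0 := by exact_mod_cast (wt_pos h0).ne'
  push_cast
  field_simp

lemma eventually_norm_rescale_le {E : Type*} [SeminormedAddCommGroup E] {F : ℂ → E}
    (h : F =O[cobounded ℂ] fun z => wt p q ‖z‖) : ∃ C, ∀ᶠ R in atTop, ∀ z₀ z : ℂ, R < ‖z₀‖ →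
      ‖z‖ ≤ 2 → ‖F (z₀ + (‖z₀‖ / 4 : ℝ) * z)‖ ≤ C * wt p q ‖z₀‖ := by
  obtain ⟨C, hC0, hC⟩ := h.exists_nonneg
  refine ⟨C * (2 ^ |p| * 2 ^ |q|), ?_⟩
  filter_upwards [eventually_far hC.bound, eventually_ge_atTop 4] with R hR h4 z₀ z h0 hz
  obtain ⟨a, b⟩ := norm_center_add (z₀ := z₀) hz
  refine (hR z₀ z h0 hz).trans ?_
  rw [Real.norm_of_nonneg (wt_pos (by linarith)).le, mul_assoc]
  gcongr
  exact wt_le le_rfl (by linarith) a b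

lemma eventually_bddFam (h : F =O[cobounded ℂ] fun z => wt p q ‖z‖) :
    ∀ᶠ R in atTop, BddFam 2 fun i : Far R => rescale p q F i := by
  obtain ⟨C, hC⟩ := eventually_norm_rescale_le h
  filter_upwards [hC, eventually_ge_atTop 1] with R hR h4
  refine ⟨C, fun i z hz => ?_⟩
  have hw : 0 < wt p q ‖i.1‖ := wt_pos (by linarith [i.2])
  simp only [rescale]
  rw [norm_mul, Complex.norm_real, norm_inv, Real.norm_of_nonneg hw.le,
    inv_mul_le_iff₀ hw, mul_comm _ C]
  exact hR i z i.2 (by simpa using (mem_ball_zero_iff.1 hz).le)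

/-- The last derivative is spent on obtaining Hölder continuity of the one before it. The elliptic
estimate later returns this derivative. -/
lemma FarO.holderBdd (h : FarO (m + 1) p q F) :
    ∀ᶠ R in atTop, HolderBdd 2 m fun i : Far R => rescale p q F i := by
  induction m generalizing F p with
  | zero =>
    filter_upwards [eventually_bddFam h.isBigO, eventually_bddFam h.2.2.1.isBigO,
      eventually_bddFam h.2.2.2.isBigO, eventually_far h.1, eventually_ge_atTop 1]
      with R h0 h1 h2 hd hR
    refine ⟨h0, ?_⟩
    obtain ⟨C, hC⟩ := h0
    obtain ⟨C₁, hC₁⟩ := h1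
    obtain ⟨C₂, hC₂⟩ := h2
    have hd' : ∀ i : Far R, ∀ z ∈ ball (0 : ℂ) 2,
        DifferentiableAt ℝ F (i + (‖i.1‖ / 4 : ℝ) * z) := fun i z hz =>
      hd i z i.2 (mem_ball_zero_iff.1 hz).le
    refine HolderFam.of_fderiv_bdd (fun i z hz => differentiableAt_rescale (hd' i z hz)) hC
      (L := 1 / 4 * C₁ + 1 / 4 * C₂) fun i z hz => (norm_clm_le _).trans ?_
    have h1 : 1 < ‖i.1‖ := by linarith [i.2]
    rw [fderiv_rescale h1 (hd' i z hz), fderiv_rescale h1 (hd' i z hz), norm_mul, norm_mul]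
    have h4 : ‖(1 / 4 : ℂ)‖ = 1 / 4 := by simp
    rw [h4]
    gcongr
    exacts [hC₁ i z hz, hC₂ i z hz]
  | succ m ih =>
    filter_upwards [eventually_bddFam h.isBigO, ih h.2.2.1,
      ih h.2.2.2, eventually_far h.1, eventually_ge_atTop 1]
      with R h0 h1 h2 hd hR
    have hd' : ∀ i : Far R, ∀ z ∈ ball (0 : ℂ) 2,
        DifferentiableAt ℝ F (i + (‖i.1‖ / 4 : ℝ) * z) := fun i z hz =>
      hd i z i.2 (mem_ball_zero_iff.1 hz).le
    refine ⟨h0, fun i z hz => differentiableAt_rescale (hd' i z hz),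
      ((HolderBdd.const (1 / 4)).mul h1).congr fun i z hz => ?_,
      ((HolderBdd.const (1 / 4)).mul h2).congr fun i z hz => ?_⟩
    all_goals exact (fderiv_rescale (by linarith [i.2]) (hd' i z hz) _).symm

lemma isBigO_of_bddFam {R r : ℝ} (hr : 0 < r) (h : BddFam r fun i : Far R => rescale p q F i) :
    F =O[cobounded ℂ] fun z => wt p q ‖z‖ := by
  obtain ⟨C, hC⟩ := h
  refine IsBigO.of_bound C ?_
  filter_upwards [eventually_norm_gt ℂ R, eventually_norm_gt ℂ 1] with z hz h1
  have := hC ⟨z, hz⟩ 0 (by simpa using hr)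
  have hw : 0 < wt p q ‖z‖ := wt_pos h1
  simp only [rescale, mul_zero, add_zero, norm_mul, Complex.norm_real, norm_inv,
    Real.norm_of_nonneg hw.le] at this
  rwa [inv_mul_le_iff₀ hw, mul_comm, ← Real.norm_of_nonneg hw.le] at this

lemma eq_rescale {z₀ : ℂ} (h0 : 1 < ‖z₀‖) :
    F = fun w => (wt p q ‖z₀‖ : ℝ) * rescale p q F z₀ ((4 / ‖z₀‖) * (w - z₀)) := by
  have h3 : (‖z₀‖ : ℂ) ≠ 0 := by exact_mod_cast (by linarith : ‖z₀‖ ≠ 0)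
  have h4 : ((wt p q ‖z₀‖ : ℝ) : ℂ) ≠ 0 := by exact_mod_cast (wt_pos h0).ne'
  funext w
  unfold rescale
  push_cast
  rw [show z₀ + ‖z₀‖ / 4 * (4 / ‖z₀‖ * (w - z₀)) = w by field_simp; ring]
  field_simp

lemma rescale_point {z₀ z : ℂ} (h0 : 1 < ‖z₀‖) :
    (4 / ‖z₀‖ : ℂ) * (z₀ + (‖z₀‖ / 4 : ℝ) * z - z₀) = z := by
  have h3 : (‖z₀‖ : ℂ) ≠ 0 := by exact_mod_cast (by linarith : ‖z₀‖ ≠ 0)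
  push_cast
  field_simp
  ring

lemma differentiableAt_of_rescale {z₀ z : ℂ} (h0 : 1 < ‖z₀‖)
    (h : DifferentiableAt ℝ (rescale p q F z₀) z) :
    DifferentiableAt ℝ F (z₀ + (‖z₀‖ / 4 : ℝ) * z) := by
  rw [eq_rescale (p := p) (q := q) (F := F) h0]
  refine (DifferentiableAt.fun_comp' (g := rescale p q F z₀) _ ?_ (by fun_prop)).const_mul _
  rwa [rescale_point h0]

lemma continuousAt_of_rescale {z₀ : ℂ} (h0 : 1 < ‖z₀‖)
    (h : ContinuousAt (rescale p q F z₀) 0) : ContinuousAt F z₀ := by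
  rw [eq_rescale (p := p) (q := q) (F := F) h0]
  refine continuousAt_const.mul (ContinuousAt.comp' (g := rescale p q F z₀) ?_ (by fun_prop))
  simpa only [sub_self, mul_zero] using h

lemma HolderBdd.farO {R r : ℝ} (hr : 0 < r) (hR : 1 ≤ R)
    (h : HolderBdd r m fun i : Far R => rescale p q F i) : FarO m p q F := by
  have hO := isBigO_of_bddFam hr h.bdd
  induction m generalizing F p with
  | zero =>
    refine ⟨?_, hO⟩
    filter_upwards [eventually_norm_gt ℂ R] with z hz
    exact continuousAt_of_rescale (by linarith) ((h.contDiffOn ⟨z, hz⟩).continuousOn.continuousAt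
      (isOpen_ball.mem_nhds (mem_ball_self hr)))
  | succ m ih =>
    have hd : ∀ (i : Far R), ∀ z ∈ ball (0 : ℂ) r,
        DifferentiableAt ℝ F (i + (‖i.1‖ / 4 : ℝ) * z) := fun i z hz =>
      differentiableAt_of_rescale (by linarith [i.2]) (h.2.1 i z hz)
    have key : ∀ e : ℂ, HolderBdd r m (fun (i : Far R) z => fderiv ℝ (rescale p q F i) z e) →
        HolderBdd r m fun i : Far R => rescale (p - 1) q (fun z => fderiv ℝ F z e) i := by
      intro e he
      refine ((HolderBdd.const 4).mul he).congr fun i z hz => ?_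
      rw [fderiv_rescale (by linarith [i.2]) (hd i z hz)]
      ring
    have h1 := key _ h.2.2.1
    have h2 := key _ h.2.2.2
    refine ⟨?_, hO, ih h1 (isBigO_of_bddFam hr h1.bdd), ih h2 (isBigO_of_bddFam hr h2.bdd)⟩
    filter_upwards [eventually_norm_gt ℂ R] with z hz
    simpa using hd ⟨z, hz⟩ 0 (mem_ball_self hr)

end Rescale

lemma exists_smooth_cutoff : ∃ χ : ℂ → ℂ, ContDiff ℝ 1 χ ∧ (∀ z ∈ ball (0 : ℂ) 1, χ z = 1) ∧
    (∀ z ∈ ball (0 : ℂ) 1, fderiv ℝ χ z = 0) ∧ ∀ z, 2 ≤ ‖z‖ → χ =ᶠ[𝓝 z] 0 := by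
  obtain ⟨η, r', hr', hη, -, h1, h0⟩ := exists_cutoff one_pos one_lt_two
  refine ⟨η, hη.of_le (by norm_num), fun z hz => (h1 z hz).eq_of_nhds, fun z hz => ?_,
    fun z hz => h0 z (by linarith)⟩
  rw [(h1 z hz).fderiv_eq]; simp

/-- Coefficients that decay at infinity are small in `C¹` after rescaling and cutting off. -/
lemma eventually_small_coeff {m : ℕ} {μ χ : ℂ → ℂ} (hμ : FarO (m + 1) (-2) 0 μ)
    (hχ : ContDiff ℝ 1 χ) (h0 : ∀ z, 2 ≤ ‖z‖ → χ =ᶠ[𝓝 z] 0) {ε : ℝ} (hε : 0 < ε) :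
    ∀ᶠ R in atTop, ∀ z₀ : ℂ, R < ‖z₀‖ →
      ContDiff ℝ 1 (fun z => χ z * μ (z₀ + (‖z₀‖ / 4 : ℝ) * z)) ∧
      (∀ z, ‖χ z * μ (z₀ + (‖z₀‖ / 4 : ℝ) * z)‖ ≤ ε) ∧
      ∀ z, ‖fderiv ℝ (fun z => χ z * μ (z₀ + (‖z₀‖ / 4 : ℝ) * z)) z‖ ≤ ε := by
  have hc : HasCompactSupport χ := HasCompactSupport.intro (isCompact_closedBall 0 2)
    fun z hz => (h0 z (le_of_lt (by simpa using hz))).eq_of_nhds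
  obtain ⟨A, hA⟩ := hc.exists_bound_of_continuous hχ.continuous
  obtain ⟨A', hA'⟩ := (hc.fderiv (𝕜 := ℝ)).exists_bound_of_continuous
    (hχ.continuous_fderiv (by simp))
  have hA0 : 0 ≤ A := (norm_nonneg _).trans (hA 0)
  have hA0' : 0 ≤ A' := (norm_nonneg _).trans (hA' 0)
  obtain ⟨C, hC⟩ := eventually_norm_rescale_le hμ.isBigO
  obtain ⟨C', hC'⟩ := eventually_norm_rescale_le hμ.fderiv_isBigO
  have hreg : ∀ᶠ z in cobounded ℂ, ContDiffAt ℝ 1 μ z :=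
    hμ.contDiffAt.mono fun z hz => hz.of_le (by simp)
  have hl : Tendsto (fun R : ℝ => (A + A') * (|C| + |C'|) * R ^ (-2 : ℝ)) atTop (𝓝 0) := by
    simpa using (tendsto_rpow_neg_atTop two_pos).const_mul ((A + A') * (|C| + |C'|))
  filter_upwards [hC, hC', eventually_far hreg, hl.eventually_lt_const hε, eventually_gt_atTop 1]
    with R hC hC' hreg hle hR z₀ hz₀
  have hz1 : 1 < ‖z₀‖ := hR.trans hz₀
  have hw : ‖z₀‖ ^ (-2 : ℝ) ≤ R ^ (-2 : ℝ) :=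
    Real.rpow_le_rpow_of_nonpos (by linarith) hz₀.le (by norm_num)
  set w := ‖z₀‖ ^ (-2 : ℝ) with hwd
  have hw0 : 0 ≤ w := by positivity
  have hwle : (A + A') * (|C| + |C'|) * w ≤ ε := by
    refine le_trans ?_ hle.le
    gcongr
  have hW1 : wt (-2) 0 ‖z₀‖ = w := wt_zero
  -- The gradient of μ decays one order faster than μ, which compensates for the dilation factor;
  -- value and gradient of the rescaled coefficient are thus equally small.
  have hW2 : ‖z₀‖ * wt (-2 - 1) 0 ‖z₀‖ = w := by
    have := wt_mul (p := 1) (q := 0) (p' := -2 - 1) (q' := 0) hz1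
    rw [wt_zero, Real.rpow_one] at this
    rw [this, hwd, ← wt_zero]; norm_num
  have haff : ContDiff ℝ 1 fun z : ℂ => z₀ + (‖z₀‖ / 4 : ℝ) * z := by fun_prop
  have hbound : ∀ z, ‖z‖ < 2 → ‖μ (z₀ + (‖z₀‖ / 4 : ℝ) * z)‖ ≤ |C| * w := fun z hz => by
    refine (hC z₀ z hz₀ hz.le).trans ?_
    rw [hW1]
    gcongr
    exact le_abs_self C
  refine ⟨contDiff_iff_contDiffAt.2 fun z => ?_, fun z => ?_, fun z => ?_⟩
  · rcases le_or_gt 2 ‖z‖ with hz | hz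
    · refine (contDiffAt_const (c := (0 : ℂ))).congr_of_eventuallyEq ?_
      filter_upwards [h0 z hz] with y hy
      simp [hy]
    · exact hχ.contDiffAt.mul ((hreg z₀ z hz₀ hz.le).comp z haff.contDiffAt)
  · rcases le_or_gt 2 ‖z‖ with hz | hz
    · simp [(h0 z hz).eq_of_nhds, hε.le]
    · rw [norm_mul]
      calc _ ≤ A * (|C| * w) := by
            gcongr
            exacts [hA z, hbound z hz]
        _ ≤ (A + A') * (|C| + |C'|) * w := by
            have : A * |C| ≤ (A + A') * (|C| + |C'|) := by
              gcongr <;> linarith [abs_nonneg C, abs_nonneg C']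
            nlinarith
        _ ≤ ε := hwle
  · rcases le_or_gt 2 ‖z‖ with hz | hz
    · have : (fun z => χ z * μ (z₀ + (‖z₀‖ / 4 : ℝ) * z)) =ᶠ[𝓝 z] fun _ => 0 := by
        filter_upwards [h0 z hz] with y hy
        simp [hy]
      rw [this.fderiv_eq]
      simp [hε.le]
    · have hd := ((hreg z₀ z hz₀ hz.le).differentiableAt one_ne_zero)
      have hd1 : DifferentiableAt ℝ (fun z => μ (z₀ + (‖z₀‖ / 4 : ℝ) * z)) z :=
        hd.comp z (haff.differentiable one_ne_zero z)
      have hdb : ‖fderiv ℝ (fun z => μ (z₀ + (‖z₀‖ / 4 : ℝ) * z)) z‖ ≤ |C'| * w := by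
        refine ContinuousLinearMap.opNorm_le_bound _ (by positivity) fun e => ?_
        rw [fderiv_comp_affine hd, norm_mul, Complex.norm_real,
          Real.norm_of_nonneg (by positivity)]
        have h1 := (fderiv ℝ μ (z₀ + (‖z₀‖ / 4 : ℝ) * z)).le_opNorm e
        have h2 := hC' z₀ z hz₀ hz.le
        have h3 : 0 ≤ wt (-2 - 1) 0 ‖z₀‖ := (wt_pos hz1).le
        calc _ ≤ ‖z₀‖ / 4 * (C' * wt (-2 - 1) 0 ‖z₀‖ * ‖e‖) := by
              gcongr
              exact h1.trans (by gcongr)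
          _ = C' / 4 * w * ‖e‖ := by rw [← hW2]; ring
          _ ≤ |C'| * w * ‖e‖ := by
              gcongr
              linarith [le_abs_self C', abs_nonneg C']
      rw [fderiv_fun_mul (hχ.differentiable one_ne_zero z) hd1]
      refine (norm_add_le _ _).trans ?_
      rw [norm_smul, norm_smul]
      calc _ ≤ A * (|C'| * w) + (|C| * w) * A' := by
            gcongr
            exacts [hA z, hbound z hz, hA' z]
        _ ≤ (A + A') * (|C| + |C'|) * w := by
            have : A * |C'| + |C| * A' ≤ (A + A') * (|C| + |C'|) := by
              nlinarith [mul_nonneg hA0 (abs_nonneg C), mul_nonneg hA0' (abs_nonneg C')]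
            nlinarith
        _ ≤ ε := hwle

/-- Solutions of Beltrami systems inherit their decay at infinity from the right-hand side. -/
theorem FarO.of_beltrami {m : ℕ} {p q : ℝ} {μ h W : ℂ → ℂ} (hμ : FarO (m + 1) (-2) 0 μ)
    (hh : FarO (m + 1) (p - 1) q h) (hW : W =O[cobounded ℂ] fun z => wt p q ‖z‖)
    (hr : ∀ᶠ z in cobounded ℂ, ContDiffAt ℝ 1 W z)
    (heq : ∀ᶠ z in cobounded ℂ, beltrami μ W z = h z) : FarO (m + 1) p q W := by
  obtain ⟨χ, hχ, h1, -, h0⟩ := exists_smooth_cutoff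
  have hμ0 : FarO (m + 1) 0 0 μ := hμ.weaken (.inl (by norm_num))
  have hhr : ∀ᶠ z in cobounded ℂ, ContDiffAt ℝ 1 h z :=
    hh.contDiffAt.mono fun z hz => hz.of_le (by simp)
  obtain ⟨R, hR1, hsm, hμb, hhb, hWb, hhR, hWR, heR⟩ := ((eventually_ge_atTop 1).and
    ((eventually_small_coeff hμ hχ h0 smallness_pos).and (hμ0.holderBdd.and (hh.holderBdd.and
    ((eventually_bddFam hW).and ((eventually_far hhr).and ((eventually_far hr).and
    (eventually_far heq)))))))).exists
  have haff : ∀ z₀ : ℂ, ContDiff ℝ 1 fun z : ℂ => z₀ + (‖z₀‖ / 4 : ℝ) * z := fun z₀ => by fun_prop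
  have hle : ∀ z ∈ ball (0 : ℂ) 1, ‖z‖ ≤ 2 := fun z hz => by
    have := mem_ball_zero_iff.1 hz; linarith
  -- The interior theory needs coefficients that are small on the whole plane, hence the cutoff χ,
  -- which equals 1 on the unit disc. Rescaling leaves the form of the system unchanged and
  -- multiplies the right-hand side by 1/4.
  have S : SolFam (ι := Far R) 1 (fun i z => χ z * μ (i + (‖i.1‖ / 4 : ℝ) * z))
      (fun i z => 1 / 4 * rescale (p - 1) q h i z) (fun i => rescale p q W i) := by
    refine ⟨fun i => (hsm i i.2).1, fun i => (hsm i i.2).2.1, fun i => (hsm i i.2).2.2,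
      fun i z hz => ?_, fun i z hz => ?_⟩
    · exact (contDiffAt_const.mul ((hWR i z i.2 (hle z hz)).comp z
        (haff i).contDiffAt)).contDiffWithinAt
    · have hd := (hWR i z i.2 (hle z hz)).differentiableAt one_ne_zero
      have h2 := heR i z i.2 (hle z hz)
      have hi : 1 < ‖i.1‖ := by linarith [i.2]
      have hw : ∀ c, _root_.wirt c (rescale p q W i) z =
          1 / 4 * rescale (p - 1) q (_root_.wirt c W) i z := by
        intro c
        simp only [_root_.wirt, fderiv_rescale hi hd]
        simp only [rescale, _root_.wirt]
        ring
      simp only [beltrami, dz, dzbar] at h2 ⊢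
      rw [hw, hw, h1 z hz]
      simp only [rescale]
      rw [← h2]
      simp only [map_mul, map_div₀, map_one, Complex.conj_ofReal, map_ofNat]
      ring
  refine HolderBdd.farO (r := 1 / 2) (by norm_num) hR1
    (S.regularity (k := m) (((hμb.mono one_le_two)).congr fun i z hz => ?_)
      ((HolderBdd.const (1 / 4)).mul (hhb.mono one_le_two)) (fun i z hz => ?_)
      (hWb.mono one_le_two) (by norm_num) (by norm_num) le_rfl)
  · simp [rescale, h1 z hz, wt]
  · exact (contDiffAt_const.mul (contDiffAt_const.mul ((hhR i z i.2 (hle z hz)).comp z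
      (haff i).contDiffAt))).contDiffWithinAt

/-! ### The Cauchy–Pompeiu formula for decaying functions -/

lemma integrable_inv_norm_sub_ball (z : ℂ) (R : ℝ) :
    Integrable ((ball z R).indicator fun ζ => ‖z - ζ‖⁻¹) := by
  have h : Integrable ((ball (0 : ℂ) R).indicator fun ζ => ‖ζ‖⁻¹) := by
    have := (integrable_indicator_iff measurableSet_ball).2
      (integrableOn_norm_rpow_ball (s := -1) (by norm_num) R)
    simpa only [Real.rpow_neg_one] using this
  refine (h.comp_sub_left z).congr (Eventually.of_forall fun ζ => ?_)
  simp only [indicator, mem_ball, dist_eq_norm, norm_sub_rev ζ z, sub_zero]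

/-- The dominating function for Cauchy transforms: the pole is integrable in the plane, and the
total decay at infinity has order 3 > 2. -/
lemma integrable_one_add_norm_sq_div (z : ℂ) :
    Integrable fun ζ : ℂ => (1 + ‖ζ‖) ^ (-2 : ℝ) * ‖z - ζ‖⁻¹ := by
  have h2 := integrable_one_add_norm (μ := (volume : Measure ℂ)) (r := 3)
    (by rw [Complex.finrank_real_complex]; norm_num)
  refine ((integrable_inv_norm_sub_ball z 1).add (h2.const_mul (2 + ‖z‖))).mono' ?_
    (Eventually.of_forall fun ζ => ?_)
  · exact Measurable.aestronglyMeasurable (by fun_prop)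
  · have h1 : (1 : ℝ) ≤ 1 + ‖ζ‖ := by linarith [norm_nonneg ζ]
    rw [Real.norm_of_nonneg (by positivity), Pi.add_apply]
    by_cases hζ : ζ ∈ ball z 1
    · rw [indicator_of_mem hζ]
      have : (1 + ‖ζ‖) ^ (-2 : ℝ) ≤ 1 := Real.rpow_le_one_of_one_le_of_nonpos h1 (by norm_num)
      have h3 : 0 ≤ (2 + ‖z‖) * (1 + ‖ζ‖) ^ (-3 : ℝ) := by positivity
      nlinarith [inv_nonneg.2 (norm_nonneg (z - ζ))]
    · rw [indicator_of_notMem hζ, zero_add]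
      rw [mem_ball, not_lt, dist_eq_norm, norm_sub_rev] at hζ
      have h3 : ‖z - ζ‖⁻¹ ≤ (2 + ‖z‖) * (1 + ‖ζ‖)⁻¹ := by
        rw [← div_eq_mul_inv, inv_le_comm₀ (by positivity) (by positivity), inv_div,
          div_le_iff₀ (by positivity)]
        have := norm_sub_norm_le ζ z
        rw [norm_sub_rev] at this
        nlinarith [norm_nonneg z]
      have h4 : (1 + ‖ζ‖) ^ (-3 : ℝ) = (1 + ‖ζ‖) ^ (-2 : ℝ) * (1 + ‖ζ‖)⁻¹ := by
        rw [← Real.rpow_neg_one, ← Real.rpow_add (by positivity)]; norm_num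
      rw [h4]
      calc _ ≤ (1 + ‖ζ‖) ^ (-2 : ℝ) * ((2 + ‖z‖) * (1 + ‖ζ‖)⁻¹) := by gcongr
        _ = _ := by ring

lemma tendsto_cauchyKer (z : ℂ) : Tendsto (fun t => cauchyKer t z) (𝓝[>] 0) (𝓝 z⁻¹) := by
  rcases eq_or_ne z 0 with rfl | hz
  · simp [cauchyKer]
  · have hc : conj z ≠ 0 := by simpa using hz
    have h : ContinuousAt (fun t : ℝ => cauchyKer t z) 0 := by
      unfold cauchyKer
      refine ContinuousAt.div (by fun_prop) (by fun_prop) ?_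
      simp [hz]
    have := h.tendsto.mono_left (nhdsWithin_le_nhds (s := Ioi 0))
    convert this using 2
    simp only [cauchyKer]
    push_cast
    field_simp
    simp

lemma tendsto_conv_cauchyKer {F : ℂ → ℂ} (hF : Continuous F) {C : ℝ}
    (h : ∀ ζ, ‖F ζ‖ ≤ C * (1 + ‖ζ‖) ^ (-2 : ℝ)) (z : ℂ) :
    Tendsto (fun t => conv (cauchyKer t) F z) (𝓝[>] 0) (𝓝 (∫ ζ, (z - ζ)⁻¹ * F ζ)) := by
  unfold conv
  refine tendsto_integral_filter_of_dominated_convergence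
    (fun ζ => C * ((1 + ‖ζ‖) ^ (-2 : ℝ) * ‖z - ζ‖⁻¹)) ?_ ?_
    ((integrable_one_add_norm_sq_div z).const_mul C) ?_
  · filter_upwards [self_mem_nhdsWithin] with t ht
    have := continuous_cauchyKer ht
    exact Continuous.aestronglyMeasurable (by fun_prop)
  · filter_upwards [self_mem_nhdsWithin] with t ht
    refine Eventually.of_forall fun ζ => ?_
    rw [norm_mul]
    calc _ ≤ ‖z - ζ‖⁻¹ * (C * (1 + ‖ζ‖) ^ (-2 : ℝ)) := by
          gcongr
          exacts [norm_cauchyKer_le_inv ht _, h ζ]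
      _ = _ := by ring
  · exact Eventually.of_forall fun ζ => (tendsto_cauchyKer _).mul_const _

/-- Integration by parts at scale t turns the regularized Cauchy transform of ∂̄U into a
mollification of U; both sides converge as t → 0. -/
lemma cauchy_pompeiu_of_hasCompactSupport {U : ℂ → ℂ} (hU : ContDiff ℝ 1 U)
    (hc : HasCompactSupport U) (z : ℂ) : ∫ ζ, (z - ζ)⁻¹ * dzbar U ζ = mollMass * U z := by
  obtain ⟨B, hB⟩ := hc.exists_bound_of_continuous hU.continuous
  have hd : Continuous (dzbar U) := continuous_wirt hU _
  have hs : HasCompactSupport (dzbar U) := hc.wirt _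
  have hb : ∃ C, ∀ ζ, ‖dzbar U ζ‖ ≤ C * (1 + ‖ζ‖) ^ (-2 : ℝ) := by
    have hw : Continuous fun ζ : ℂ => (((1 + ‖ζ‖) ^ (2 : ℝ) : ℝ) : ℂ) * dzbar U ζ := by
      have : Continuous fun ζ : ℂ => (1 + ‖ζ‖) ^ (2 : ℝ) :=
        Continuous.rpow_const (by fun_prop) fun _ => .inr (by norm_num)
      fun_prop
    obtain ⟨C, hC⟩ := hs.mul_left.exists_bound_of_continuous hw
    refine ⟨C, fun ζ => ?_⟩
    have h1 := hC ζ
    have h0 : (0 : ℝ) < 1 + ‖ζ‖ := by positivity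
    rw [Pi.mul_apply, norm_mul, Complex.norm_real, Real.norm_of_nonneg (by positivity)] at h1
    rw [Real.rpow_neg h0.le, ← div_eq_mul_inv, le_div_iff₀ (by positivity), mul_comm]
    exact h1
  obtain ⟨C, hC⟩ := hb
  refine tendsto_nhds_unique (tendsto_conv_cauchyKer hd hC z)
    ((tendsto_conv_moll hU.continuous hB z).congr' ?_)
  filter_upwards [self_mem_nhdsWithin] with t ht
  rw [← dzbar_cauchyKer ht, ← conv_wirt _ _ (contDiff_cauchyKer ht) hU hc]

/-- The Cauchy–Pompeiu formula on the whole plane. -/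
theorem cauchy_pompeiu {U : ℂ → ℂ} (hU : ContDiff ℝ 1 U) {C : ℝ}
    (h0 : ∀ z, ‖U z‖ ≤ C * (1 + ‖z‖) ^ (-1 : ℝ))
    (h1 : ∀ z, ‖fderiv ℝ U z‖ ≤ C * (1 + ‖z‖) ^ (-2 : ℝ)) (z : ℂ) :
    ∫ ζ, (z - ζ)⁻¹ * dzbar U ζ = mollMass * U z := by
  obtain ⟨η, r', hr', hη, -, he1, he0⟩ := exists_cutoff one_pos one_lt_two
  have hηc : HasCompactSupport η := HasCompactSupport.intro (isCompact_closedBall 0 r')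
    fun z hz => (he0 z (le_of_lt (by simpa using hz))).eq_of_nhds
  obtain ⟨A, hA⟩ := hηc.exists_bound_of_continuous hη.continuous
  obtain ⟨A', hA'⟩ := (hηc.fderiv (𝕜 := ℝ)).exists_bound_of_continuous
    (hη.continuous_fderiv (by simp))
  have hA0 : 0 ≤ A := (norm_nonneg _).trans (hA 0)
  have hA0' : 0 ≤ A' := (norm_nonneg _).trans (hA' 0)
  have hC0 : 0 ≤ C := by simpa using (norm_nonneg _).trans (h0 0)
  let s : ℕ → ℝ := fun n => (n + 1 : ℝ)⁻¹
  have hs : ∀ n, 0 < s n := fun n => by positivity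
  -- Dilated cutoffs. The summand 0 only matches the affine form used in `fderiv_comp_affine`.
  let χ : ℕ → ℂ → ℂ := fun n ζ => η (0 + s n * ζ)
  have hχ : ∀ n, ContDiff ℝ 1 (χ n) := fun n => (hη.of_le (by norm_num)).comp (by fun_prop)
  have hn : ∀ n (ζ : ℂ), ‖0 + (s n : ℂ) * ζ‖ = s n * ‖ζ‖ := fun n ζ => by
    rw [zero_add, norm_mul, Complex.norm_real, Real.norm_of_nonneg (hs n).le]
  have hs1 : ∀ (n : ℕ) (a : ℝ), 0 ≤ a → a < n → s n * a < 1 := fun n a ha h => by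
    rw [inv_mul_lt_iff₀ (by positivity)]; linarith
  have hχ1 : ∀ (n : ℕ) (ζ : ℂ), ‖ζ‖ < n → χ n ζ = 1 := fun n ζ h =>
    (he1 _ (by rw [mem_ball_zero_iff, hn]; exact hs1 n _ (norm_nonneg _) h)).eq_of_nhds
  have hdχ : ∀ n ζ, wirt Complex.I (χ n) ζ = s n * wirt Complex.I η (0 + s n * ζ) := by
    intro n ζ
    have hd := hη.differentiable two_ne_zero (0 + s n * ζ)
    simp only [wirt, χ, fderiv_comp_affine hd]; ring
  have hdχ1 : ∀ (n : ℕ) (ζ : ℂ), ‖ζ‖ < n → wirt Complex.I (χ n) ζ = 0 := by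
    intro n ζ h
    rw [hdχ, wirt,
      (he1 _ (by rw [mem_ball_zero_iff, hn]; exact hs1 n _ (norm_nonneg _) h)).fderiv_eq]
    simp
  -- A majorant independent of n: on the support of the derivative |ζ| < 2/s and s ≤ 1, so s(1 +
  -- |ζ|) ≤ 3. Against the O(1/|ζ|) decay of U it gives order 2, as required for dominated
  -- convergence.
  have hdχb : ∀ n ζ, ‖wirt Complex.I (χ n) ζ‖ ≤ 3 * A' * (1 + ‖ζ‖) ^ (-1 : ℝ) := by
    intro n ζ
    rw [hdχ, norm_mul, Complex.norm_real, Real.norm_of_nonneg (hs n).le]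
    rcases le_or_gt 2 (s n * ‖ζ‖) with h | h
    · rw [wirt, (he0 _ (by rw [hn]; linarith)).fderiv_eq]
      simp; positivity
    · have h3 : s n ≤ 3 * (1 + ‖ζ‖)⁻¹ := by
        rw [← div_eq_mul_inv, le_div_iff₀ (by positivity)]
        have : s n ≤ 1 := inv_le_one_of_one_le₀ (by linarith [(n.cast_nonneg : (0 : ℝ) ≤ n)])
        nlinarith
      rw [Real.rpow_neg_one]
      calc _ ≤ 3 * (1 + ‖ζ‖)⁻¹ * A' := by
            gcongr
            exact (norm_wirt_le Complex.norm_I _ _).trans (hA' _)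
        _ = _ := by ring
  have hmul : ∀ n ζ, dzbar (fun ζ => χ n ζ * U ζ) ζ =
      wirt Complex.I (χ n) ζ * U ζ + χ n ζ * dzbar U ζ := fun n ζ =>
    wirt_mul _ ((hχ n).differentiable one_ne_zero ζ) (hU.differentiable one_ne_zero ζ)
  have hcp : ∀ n, ∫ ζ, (z - ζ)⁻¹ * dzbar (fun ζ => χ n ζ * U ζ) ζ = mollMass * (χ n z * U z) := by
    intro n
    refine cauchy_pompeiu_of_hasCompactSupport ((hχ n).mul hU) (HasCompactSupport.mul_right ?_) z
    refine HasCompactSupport.intro (isCompact_closedBall 0 (2 * (s n)⁻¹)) fun ζ hζ => ?_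
    rw [mem_closedBall_zero_iff, not_le, ← div_eq_mul_inv, div_lt_iff₀ (hs n)] at hζ
    exact (he0 _ (by rw [hn]; linarith)).eq_of_nhds
  have hlarge : ∀ ζ : ℂ, ∀ᶠ n : ℕ in atTop, ‖ζ‖ < n := fun ζ =>
    tendsto_natCast_atTop_atTop.eventually_gt_atTop _
  have lim1 : Tendsto (fun n => ∫ ζ, (z - ζ)⁻¹ * dzbar (fun ζ => χ n ζ * U ζ) ζ) atTop
      (𝓝 (∫ ζ, (z - ζ)⁻¹ * dzbar U ζ)) := by
    refine tendsto_integral_of_dominated_convergence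
      (fun ζ => (3 * A' * C + A * C) * ((1 + ‖ζ‖) ^ (-2 : ℝ) * ‖z - ζ‖⁻¹)) (fun n => ?_)
      ((integrable_one_add_norm_sq_div z).const_mul _) (fun n => Eventually.of_forall fun ζ => ?_)
      (Eventually.of_forall fun ζ => ?_)
    · have : Continuous (dzbar fun ζ => χ n ζ * U ζ) := continuous_wirt ((hχ n).mul hU) _
      exact Measurable.aestronglyMeasurable (by fun_prop)
    · rw [hmul, norm_mul, norm_inv, mul_comm, ← mul_assoc]
      have e : (1 + ‖ζ‖) ^ (-2 : ℝ) = (1 + ‖ζ‖) ^ (-1 : ℝ) * (1 + ‖ζ‖) ^ (-1 : ℝ) := by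
        rw [← Real.rpow_add (by positivity)]; norm_num
      gcongr
      calc _ ≤ ‖wirt Complex.I (χ n) ζ‖ * ‖U ζ‖ + ‖χ n ζ‖ * ‖dzbar U ζ‖ := by
            refine (norm_add_le _ _).trans_eq ?_
            rw [norm_mul, norm_mul]
        _ ≤ (3 * A' * (1 + ‖ζ‖) ^ (-1 : ℝ)) * (C * (1 + ‖ζ‖) ^ (-1 : ℝ)) +
            A * (C * (1 + ‖ζ‖) ^ (-2 : ℝ)) := by
            gcongr
            exacts [hdχb n ζ, h0 ζ, hA _, (norm_wirt_le Complex.norm_I _ _).trans (h1 ζ)]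
        _ = _ := by rw [e]; ring
    · refine tendsto_const_nhds.congr' ?_
      filter_upwards [hlarge ζ] with n h
      rw [hmul, hχ1 n ζ h, hdχ1 n ζ h, zero_mul, zero_add, one_mul]
  refine tendsto_nhds_unique lim1 (tendsto_const_nhds.congr' ?_)
  filter_upwards [hlarge z] with n h
  rw [hcp, hχ1 n z h, one_mul]

/-! ### A weighted potential estimate -/

lemma integral_norm_polar (f : ℝ → ℝ) :
    ∫ z : ℂ, f ‖z‖ = 2 * volume.real (ball (0 : ℂ) 1) * ∫ y in Ioi (0 : ℝ), y * f y := by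
  rw [integral_fun_norm_addHaar, Complex.finrank_real_complex]
  simp [mul_assoc]

lemma integral_ball_one_add_norm_sq {ρ : ℝ} (hρ : 0 < ρ) :
    Integrable ((ball (0 : ℂ) ρ).indicator fun ζ => (1 + ‖ζ‖) ^ (-2 : ℝ)) ∧
    ∫ ζ, (ball (0 : ℂ) ρ).indicator (fun ζ => (1 + ‖ζ‖) ^ (-2 : ℝ)) ζ ≤
      2 * volume.real (ball (0 : ℂ) 1) * Real.log (1 + ρ) := by
  have hc : Continuous fun ζ : ℂ => (1 + ‖ζ‖) ^ (-2 : ℝ) :=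
    Continuous.rpow_const (by fun_prop) fun ζ => .inl (by positivity)
  refine ⟨(integrable_indicator_iff measurableSet_ball).2 ((hc.continuousOn.integrableOn_compact
    (isCompact_closedBall 0 ρ)).mono_set ball_subset_closedBall), ?_⟩
  have e : ∀ ζ : ℂ, (ball (0 : ℂ) ρ).indicator (fun ζ => (1 + ‖ζ‖) ^ (-2 : ℝ)) ζ =
      (Iio ρ).indicator (fun y => (1 + y) ^ (-2 : ℝ)) ‖ζ‖ := fun ζ => by
    simp [indicator]
  simp only [e]
  rw [integral_norm_polar]
  refine mul_le_mul_of_nonneg_left ?_ (by positivity)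
  have e2 : ∀ y : ℝ, y * (Iio ρ).indicator (fun y => (1 + y) ^ (-2 : ℝ)) y =
      (Iio ρ).indicator (fun y => y * (1 + y) ^ (-2 : ℝ)) y := fun y => by
    simp [indicator]
  simp only [e2]
  rw [setIntegral_indicator measurableSet_Iio, Ioi_inter_Iio, ← integral_Ioc_eq_integral_Ioo,
    ← intervalIntegral.integral_of_le hρ.le]
  have e3 : Real.log (1 + ρ) = ∫ y in (0 : ℝ)..ρ, 1 / (1 + y) := by
    rw [intervalIntegral.integral_comp_add_left (fun y => 1 / y) 1,
      integral_one_div_of_pos (by norm_num) (by linarith)]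
    simp
  rw [e3]
  have hcc : ContinuousOn (fun y : ℝ => y * (1 + y) ^ (-2 : ℝ)) (uIcc 0 ρ) := by
    refine continuousOn_id.mul (ContinuousOn.rpow_const (by fun_prop) fun y hy => .inl ?_)
    rw [uIcc_of_le hρ.le] at hy
    linarith [hy.1]
  have hcd : ContinuousOn (fun y : ℝ => 1 / (1 + y)) (uIcc 0 ρ) := by
    refine ContinuousOn.div (by fun_prop) (by fun_prop) fun y hy => ?_
    rw [uIcc_of_le hρ.le] at hy
    linarith [hy.1]
  refine intervalIntegral.integral_mono_on hρ.le hcc.intervalIntegrable hcd.intervalIntegrable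
    fun y hy => ?_
  have h0 : 0 < 1 + y := by linarith [hy.1]
  have : (1 + y) ^ (-2 : ℝ) = ((1 + y) ^ 2)⁻¹ := by
    rw [Real.rpow_neg h0.le]; norm_cast
  rw [this, ← div_eq_mul_inv, div_le_div_iff₀ (by positivity) h0]
  nlinarith [hy.1]

lemma integral_ball_inv_norm_sub (z : ℂ) {ρ : ℝ} (hρ : 0 < ρ) :
    ∫ ζ, (ball z ρ).indicator (fun ζ => ‖z - ζ‖⁻¹) ζ =
      2 * volume.real (ball (0 : ℂ) 1) * ρ := by
  have e : ∀ ζ : ℂ, (ball z ρ).indicator (fun ζ => ‖z - ζ‖⁻¹) ζ =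
      (Iio ρ).indicator (fun y => y⁻¹) ‖z - ζ‖ := fun ζ => by
    simp [indicator, dist_eq_norm, norm_sub_rev ζ z]
  simp only [e]
  rw [integral_sub_left_eq_self (fun ζ : ℂ => (Iio ρ).indicator (fun y => y⁻¹) ‖ζ‖) volume z,
    integral_norm_polar]
  congr 1
  have e2 : ∀ y ∈ Ioi (0 : ℝ), y * (Iio ρ).indicator (fun y => y⁻¹) y =
      (Iio ρ).indicator (fun y => 1) y := fun y hy => by
    by_cases h : y ∈ Iio ρ
    · rw [indicator_of_mem h, indicator_of_mem h, mul_inv_cancel₀ (ne_of_gt hy)]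
    · rw [indicator_of_notMem h, indicator_of_notMem h, mul_zero]
  rw [setIntegral_congr_fun measurableSet_Ioi e2, setIntegral_indicator measurableSet_Iio,
    Ioi_inter_Iio]
  simp [hρ.le]

lemma integral_compl_ball_rpow {ρ s : ℝ} (hρ : 0 < ρ) (hs : 0 < s) :
    Integrable ({ζ : ℂ | ρ < ‖ζ‖}.indicator fun ζ => ‖ζ‖ ^ (-2 - s)) ∧
    ∫ ζ, {ζ : ℂ | ρ < ‖ζ‖}.indicator (fun ζ => ‖ζ‖ ^ (-2 - s)) ζ =
      2 * volume.real (ball (0 : ℂ) 1) * (ρ ^ (-s) / s) := by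
  have e : ({ζ : ℂ | ρ < ‖ζ‖}.indicator fun ζ => ‖ζ‖ ^ (-2 - s)) = fun ζ =>
      (Ioi ρ).indicator (fun y => y ^ (-2 - s)) ‖ζ‖ := funext fun ζ => by
    simp [indicator]
  have e2 : ∀ y ∈ Ioi (0 : ℝ), y * (Ioi ρ).indicator (fun y => y ^ (-2 - s)) y =
      (Ioi ρ).indicator (fun y => y ^ (-1 - s)) y := fun y hy => by
    by_cases h : y ∈ Ioi ρ
    · rw [indicator_of_mem h, indicator_of_mem h]
      nth_rewrite 1 [← Real.rpow_one y]
      rw [← Real.rpow_add hy]; ring_nf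
    · rw [indicator_of_notMem h, indicator_of_notMem h, mul_zero]
  have hsub : Ioi (0 : ℝ) ∩ Ioi ρ = Ioi ρ := inter_eq_right.2 (Ioi_subset_Ioi hρ.le)
  have hi : IntegrableOn (fun y : ℝ => y ^ (-1 - s)) (Ioi ρ) :=
    integrableOn_Ioi_rpow_of_lt (by linarith) hρ
  rw [e]
  constructor
  · rw [integrable_fun_norm_addHaar volume (f := (Ioi ρ).indicator (fun y => y ^ (-2 - s))),
      Complex.finrank_real_complex]
    refine IntegrableOn.congr_fun (f := (Ioi ρ).indicator fun y => y ^ (-1 - s)) ?_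
      (fun y hy => ?_) measurableSet_Ioi
    · rw [IntegrableOn, integrable_indicator_iff measurableSet_Ioi, IntegrableOn,
        Measure.restrict_restrict measurableSet_Ioi, inter_comm, hsub]
      exact hi
    · rw [← e2 y hy]; simp
  · rw [integral_norm_polar, setIntegral_congr_fun measurableSet_Ioi e2,
      setIntegral_indicator measurableSet_Ioi, hsub, integral_Ioi_rpow_of_lt (by linarith) hρ]
    rw [show -1 - s + 1 = -s by ring, neg_div_neg_eq]

/-- `1 + ln (1 + x)`. -/
noncomputable def slog (x : ℝ) : ℝ := 1 + Real.log (1 + x)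

lemma one_le_slog {x : ℝ} (hx : 0 ≤ x) : 1 ≤ slog x := by
  have := Real.log_nonneg (by linarith : 1 ≤ 1 + x)
  unfold slog; linarith

lemma slog_mono {x y : ℝ} (hx : 0 ≤ x) (h : x ≤ y) : slog x ≤ slog y := by
  have := Real.log_le_log (by linarith : 0 < 1 + x) (by linarith : 1 + x ≤ 1 + y)
  unfold slog; linarith

lemma slog_le_mul {x y : ℝ} (hx : 0 < x) (h : x ≤ y) :
    slog y ≤ slog x * (1 + Real.log (y / x)) := by
  have h1 : 1 + y ≤ (1 + x) * (y / x) := by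
    have : 1 ≤ y / x := by rwa [le_div_iff₀ hx, one_mul]
    rw [add_mul, mul_div_cancel₀ y hx.ne']; linarith
  have hyx : 1 ≤ y / x := by rwa [le_div_iff₀ hx, one_mul]
  have h2 := Real.log_le_log (by linarith) h1
  rw [Real.log_mul (by linarith) (by positivity)] at h2
  have h3 := one_le_slog hx.le
  have h4 := Real.log_nonneg hyx
  have : slog y ≤ slog x + Real.log (y / x) := by unfold slog; linarith
  nlinarith

/-- Growth of the logarithm from x to y is traded for a small power of y/x. Splitting δ into q + 1
parts instead of q keeps the argument valid at q = 0. -/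
lemma slog_rpow_le {q δ x y : ℝ} (hq : 0 ≤ q) (hδ : 0 < δ) (hx : 0 < x) (h : x ≤ y) :
    slog y ^ q ≤ (1 + (q + 1) / δ) ^ (q + 1) * slog x ^ q * (y / x) ^ δ := by
  have hyx : 1 ≤ y / x := by rwa [le_div_iff₀ hx, one_mul]
  have hl := Real.log_nonneg hyx
  have hs := one_le_slog hx.le
  set ε := δ / (q + 1) with hε
  have hε0 : 0 < ε := by positivity
  have h1 : 1 + Real.log (y / x) ≤ (1 + (q + 1) / δ) * (y / x) ^ ε := by
    have a := Real.log_le_rpow_div (by positivity : 0 ≤ y / x) hε0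
    have b : 1 ≤ (y / x) ^ ε := Real.one_le_rpow hyx hε0.le
    have c : (y / x) ^ ε / ε = (q + 1) / δ * (y / x) ^ ε := by rw [hε]; field_simp
    rw [c] at a
    linarith
  calc slog y ^ q ≤ (slog x * (1 + Real.log (y / x))) ^ q :=
        Real.rpow_le_rpow (by linarith [one_le_slog (hx.le.trans h)]) (slog_le_mul hx h) hq
    _ = slog x ^ q * (1 + Real.log (y / x)) ^ q := Real.mul_rpow (by linarith) (by linarith)
    _ ≤ slog x ^ q * (1 + Real.log (y / x)) ^ (q + 1) := by
        gcongr
        · linarith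
        · linarith
    _ ≤ slog x ^ q * ((1 + (q + 1) / δ) * (y / x) ^ ε) ^ (q + 1) := by gcongr
    _ = slog x ^ q * ((1 + (q + 1) / δ) ^ (q + 1) * (y / x) ^ δ) := by
        rw [Real.mul_rpow (by positivity) (by positivity), ← Real.rpow_mul (by positivity), hε,
          div_mul_cancel₀ _ (by positivity)]
    _ = _ := by ring

/-- The potential of a weight of order `-β`, `1 < β ≤ 2`. -/
lemma exists_potential_le {β q : ℝ} (hβ : 1 < β) (hβ2 : β ≤ 2) (hq : 0 ≤ q) :
    ∃ C, ∀ z : ℂ, 1 ≤ ‖z‖ →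
      ∃ G : ℂ → ℝ, Integrable G ∧
        (∀ ζ, (1 + ‖ζ‖) ^ (-β) * slog ‖ζ‖ ^ q * ‖z - ζ‖⁻¹ ≤ G ζ) ∧
        ∫ ζ, G ζ ≤ C * (‖z‖ ^ (1 - β) * slog ‖z‖ ^ (q + 1)) := by
  -- Half of the excess β - 1 pays for the logarithm in the outer region; the other half keeps the
  -- integrand of order -2 - δ, hence integrable.
  set δ := (β - 1) / 2 with hδ
  have hδ0 : 0 < δ := by rw [hδ]; linarith
  set κ := 2 * volume.real (ball (0 : ℂ) 1) with hκ
  have hκ0 : 0 ≤ κ := by positivity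
  set D := (1 + (q + 1) / δ) ^ (q + 1) with hD
  have hD0 : 0 ≤ D := by positivity
  refine ⟨4 * κ + D * 2 ^ δ * 2 ^ β * (3 * κ) + 2 * D * (κ / δ), fun z hz => ?_⟩
  set x := ‖z‖ with hx
  set S := slog x with hS
  have hx0 : 0 < x := by linarith
  have hS1 : 1 ≤ S := one_le_slog hx0.le
  set a := S ^ q * (2 * x ^ (2 - β)) * (2 * x⁻¹) with ha
  set b := D * 2 ^ δ * S ^ q * (2 ^ β * x ^ (-β)) with hb
  set c := 2 * D * S ^ q * x ^ (-δ) with hc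
  have ha0 : 0 ≤ a := by positivity
  have hb0 : 0 ≤ b := by positivity
  have hc0 : 0 ≤ c := by positivity
  set fA : ℂ → ℝ := (ball (0 : ℂ) (x / 2)).indicator fun ζ => (1 + ‖ζ‖) ^ (-2 : ℝ) with hfA
  set fB : ℂ → ℝ := (ball z (3 * x)).indicator fun ζ => ‖z - ζ‖⁻¹ with hfB
  set fC : ℂ → ℝ := {ζ : ℂ | x < ‖ζ‖}.indicator fun ζ => ‖ζ‖ ^ (-2 - δ) with hfC
  have nA : ∀ ζ, 0 ≤ fA ζ := fun ζ => indicator_nonneg (fun _ _ => by positivity) ζ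
  have nB : ∀ ζ, 0 ≤ fB ζ := fun ζ => indicator_nonneg (fun _ _ => by positivity) ζ
  have nC : ∀ ζ, 0 ≤ fC ζ := fun ζ => indicator_nonneg (fun _ _ => by positivity) ζ
  obtain ⟨iA, vA⟩ := integral_ball_one_add_norm_sq (ρ := x / 2) (by linarith)
  have iB := integrable_inv_norm_sub_ball z (3 * x)
  have vB := integral_ball_inv_norm_sub z (ρ := 3 * x) (by linarith)
  obtain ⟨iC, vC⟩ := integral_compl_ball_rpow (ρ := x) hx0 hδ0
  refine ⟨fun ζ => a * fA ζ + b * fB ζ + c * fC ζ,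
    ((iA.const_mul a).add (iB.const_mul b)).add (iC.const_mul c), fun ζ => ?_, ?_⟩
  · have hs0 := one_le_slog (norm_nonneg ζ)
    have hzζ : x - ‖ζ‖ ≤ ‖z - ζ‖ := norm_sub_norm_le z ζ
    have hζz : ‖ζ‖ - x ≤ ‖z - ζ‖ := by rw [norm_sub_rev]; exact norm_sub_norm_le ζ z
    -- Three regions: inside |z|/2, between |z|/2 and 2|z|, and beyond. The pole lies in the middle
    -- one and is integrable. The inner one is compared with weight order -2 at the cost of
    -- |z|^(2-β), which produces the extra logarithm for every admissible β.
    rcases lt_or_ge ‖ζ‖ (x / 2) with h | h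
    · have h1 : fA ζ = (1 + ‖ζ‖) ^ (-2 : ℝ) := indicator_of_mem (by simpa using h) _
      have h2 : (1 + ‖ζ‖) ^ (-β) ≤ 2 * x ^ (2 - β) * (1 + ‖ζ‖) ^ (-2 : ℝ) := by
        have e : (1 + ‖ζ‖) ^ (-β) = (1 + ‖ζ‖) ^ (2 - β) * (1 + ‖ζ‖) ^ (-2 : ℝ) := by
          rw [← Real.rpow_add (by positivity)]; ring_nf
        rw [e]
        gcongr
        calc (1 + ‖ζ‖) ^ (2 - β) ≤ (2 * x) ^ (2 - β) :=
              Real.rpow_le_rpow (by positivity) (by linarith) (by linarith)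
          _ = 2 ^ (2 - β) * x ^ (2 - β) := Real.mul_rpow (by norm_num) hx0.le
          _ ≤ 2 * x ^ (2 - β) := by
              gcongr
              calc (2 : ℝ) ^ (2 - β) ≤ 2 ^ (1 : ℝ) :=
                    Real.rpow_le_rpow_of_exponent_le one_le_two (by linarith)
                _ = 2 := Real.rpow_one 2
      have h3 : slog ‖ζ‖ ^ q ≤ S ^ q :=
        Real.rpow_le_rpow (by linarith) (slog_mono (norm_nonneg _) (by linarith)) hq
      have h4 : ‖z - ζ‖⁻¹ ≤ 2 * x⁻¹ := by
        rw [← div_eq_mul_inv, ← inv_div]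
        exact inv_anti₀ (by linarith) (by linarith)
      calc _ ≤ 2 * x ^ (2 - β) * (1 + ‖ζ‖) ^ (-2 : ℝ) * S ^ q * (2 * x⁻¹) := by gcongr
        _ = a * fA ζ := by rw [h1, ha]; ring
        _ ≤ _ := by
          have := mul_nonneg hb0 (nB ζ)
          have := mul_nonneg hc0 (nC ζ)
          linarith
    · have hζ0 : 0 < ‖ζ‖ := by linarith
      have h1 : (1 + ‖ζ‖) ^ (-β) ≤ ‖ζ‖ ^ (-β) :=
        Real.rpow_le_rpow_of_nonpos hζ0 (by linarith) (by linarith)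
      rcases lt_or_ge ‖ζ‖ (2 * x) with h' | h'
      · have h2 : fB ζ = ‖z - ζ‖⁻¹ := indicator_of_mem (by
          rw [mem_ball, dist_eq_norm, norm_sub_rev]
          exact (norm_sub_le z ζ).trans_lt (by linarith)) _
        have h3 : slog ‖ζ‖ ^ q ≤ D * 2 ^ δ * S ^ q := by
          calc slog ‖ζ‖ ^ q ≤ slog (2 * x) ^ q :=
                Real.rpow_le_rpow (by linarith) (slog_mono (norm_nonneg _) h'.le) hq
            _ ≤ D * S ^ q * (2 * x / x) ^ δ := slog_rpow_le hq hδ0 hx0 (by linarith)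
            _ = _ := by rw [mul_div_cancel_right₀ _ hx0.ne']; ring
        have h4 : ‖ζ‖ ^ (-β) ≤ 2 ^ β * x ^ (-β) := by
          calc ‖ζ‖ ^ (-β) ≤ (x / 2) ^ (-β) :=
                Real.rpow_le_rpow_of_nonpos (by linarith) h (by linarith)
            _ = _ := by
              rw [Real.div_rpow hx0.le (by norm_num), Real.rpow_neg (by norm_num : (0:ℝ) ≤ 2),
                div_inv_eq_mul, mul_comm]
        calc _ ≤ (2 ^ β * x ^ (-β)) * (D * 2 ^ δ * S ^ q) * ‖z - ζ‖⁻¹ := by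
              gcongr
              exact h1.trans h4
          _ = b * fB ζ := by rw [h2, hb]; ring
          _ ≤ _ := by
            have := mul_nonneg ha0 (nA ζ)
            have := mul_nonneg hc0 (nC ζ)
            linarith
      · have h2 : fC ζ = ‖ζ‖ ^ (-2 - δ) := indicator_of_mem (by
          show x < ‖ζ‖
          linarith) _
        have h3 : slog ‖ζ‖ ^ q ≤ D * S ^ q * (‖ζ‖ / x) ^ δ :=
          slog_rpow_le hq hδ0 hx0 (by linarith)
        have h4 : ‖z - ζ‖⁻¹ ≤ 2 * ‖ζ‖⁻¹ := by
          rw [← div_eq_mul_inv, ← inv_div]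
          exact inv_anti₀ (by linarith) (by linarith)
        have e : ‖ζ‖ ^ (-2 - δ) = ‖ζ‖ ^ (-β) * ‖ζ‖ ^ δ * ‖ζ‖⁻¹ := by
          rw [← Real.rpow_neg_one, ← Real.rpow_add hζ0, ← Real.rpow_add hζ0]
          congr 1; rw [hδ]; ring
        calc _ ≤ ‖ζ‖ ^ (-β) * (D * S ^ q * (‖ζ‖ / x) ^ δ) * (2 * ‖ζ‖⁻¹) := by gcongr
          _ = c * fC ζ := by
            rw [h2, hc, e, Real.div_rpow hζ0.le hx0.le, Real.rpow_neg hx0.le]; ring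
          _ ≤ _ := by
            have := mul_nonneg ha0 (nA ζ)
            have := mul_nonneg hb0 (nB ζ)
            linarith
  · have jA : Integrable fun ζ => a * fA ζ := iA.const_mul a
    have jB : Integrable fun ζ => b * fB ζ := iB.const_mul b
    have jC : Integrable fun ζ => c * fC ζ := iC.const_mul c
    have jAB : Integrable fun ζ => a * fA ζ + b * fB ζ := jA.add jB
    have hint : ∫ ζ, a * fA ζ + b * fB ζ + c * fC ζ =
        a * (∫ ζ, fA ζ) + b * (κ * (3 * x)) + c * (κ * (x ^ (-δ) / δ)) := by
      rw [integral_add jAB jC, integral_add jA jB, integral_const_mul, integral_const_mul,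
        integral_const_mul, vB, vC]
    show ∫ ζ, a * fA ζ + b * fB ζ + c * fC ζ ≤ _
    rw [hint]
    have hSq : S ^ q ≤ S ^ (q + 1) := Real.rpow_le_rpow_of_exponent_le hS1 (by linarith)
    have hlog : Real.log (1 + x / 2) ≤ S := by
      have := Real.log_le_log (by linarith : 0 < 1 + x / 2) (by linarith : 1 + x / 2 ≤ 1 + x)
      rw [hS, slog]; linarith
    have hSS : S ^ q * S = S ^ (q + 1) := by rw [Real.rpow_add_one (by linarith)]
    have eA : x ^ (2 - β) * x⁻¹ = x ^ (1 - β) := by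
      rw [← Real.rpow_neg_one, ← Real.rpow_add hx0]; ring_nf
    have eB : x ^ (-β) * x = x ^ (1 - β) := by
      nth_rewrite 2 [← Real.rpow_one x]
      rw [← Real.rpow_add hx0]; ring_nf
    have eC : x ^ (-δ) * x ^ (-δ) = x ^ (1 - β) := by
      rw [← Real.rpow_add hx0]; congr 1; rw [hδ]; ring
    have tA : a * (∫ ζ, fA ζ) ≤ 4 * κ * (x ^ (1 - β) * S ^ (q + 1)) := by
      calc _ ≤ a * (κ * S) := by
            gcongr
            exact vA.trans (by gcongr)
        _ = 4 * κ * ((x ^ (2 - β) * x⁻¹) * (S ^ q * S)) := by rw [ha]; ring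
        _ = _ := by rw [eA, hSS]
    have tB : b * (κ * (3 * x)) ≤ D * 2 ^ δ * 2 ^ β * (3 * κ) * (x ^ (1 - β) * S ^ (q + 1)) := by
      calc _ = D * 2 ^ δ * 2 ^ β * (3 * κ) * ((x ^ (-β) * x) * S ^ q) := by rw [hb]; ring
        _ ≤ _ := by rw [eB]; gcongr
    have tC : c * (κ * (x ^ (-δ) / δ)) ≤ 2 * D * (κ / δ) * (x ^ (1 - β) * S ^ (q + 1)) := by
      calc _ = 2 * D * (κ / δ) * ((x ^ (-δ) * x ^ (-δ)) * S ^ q) := by rw [hc]; ring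
        _ ≤ _ := by rw [eC]; gcongr
    linarith

/-! ### Expansion at infinity of functions with small `∂̄` -/

lemma exists_global_bound {E : Type*} [NormedAddCommGroup E] {f : ℂ → E} {g : ℂ → ℝ}
    (hf : Continuous f) (hg : Continuous g) (hg0 : ∀ z, 0 < g z) (h : f =O[cobounded ℂ] g) :
    ∃ C, 0 ≤ C ∧ ∀ z, ‖f z‖ ≤ C * g z := by
  obtain ⟨C, hC0, hC⟩ := h.exists_nonneg
  obtain ⟨R, hR⟩ := eventually_cobounded_iff.1 hC.bound
  obtain ⟨D, hD⟩ := (isCompact_closedBall (0 : ℂ) R).exists_bound_of_continuousOn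
    (f := fun z => (g z)⁻¹ * ‖f z‖)
    ((hg.inv₀ fun z => (hg0 z).ne').mul hf.norm).continuousOn
  refine ⟨max C D, le_max_of_le_left hC0, fun z => ?_⟩
  rcases le_or_gt ‖z‖ R with hz | hz
  · have := (le_abs_self _).trans (hD z (mem_closedBall_zero_iff.2 hz))
    rw [inv_mul_le_iff₀ (hg0 z), mul_comm] at this
    exact this.trans (mul_le_mul_of_nonneg_right (le_max_right _ _) (hg0 z).le)
  · have := hR z hz
    rw [Real.norm_of_nonneg (hg0 z).le] at this
    exact this.trans (mul_le_mul_of_nonneg_right (le_max_left _ _) (hg0 z).le)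

/-- A version of `wt` that is positive and continuous on `[0, ∞)`. -/
noncomputable def swt (p q x : ℝ) : ℝ := (1 + x) ^ p * slog x ^ q

lemma swt_pos {p q x : ℝ} (hx : 0 ≤ x) : 0 < swt p q x :=
  mul_pos (Real.rpow_pos_of_pos (by linarith) _)
    (Real.rpow_pos_of_pos (by linarith [one_le_slog hx]) _)

lemma continuous_swt (p q : ℝ) : Continuous fun z : ℂ => swt p q ‖z‖ := by
  have h1 : ∀ z : ℂ, 1 + ‖z‖ ≠ 0 := fun z => by positivity
  have h2 : Continuous fun z : ℂ => slog ‖z‖ := by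
    unfold slog
    exact continuous_const.add (Continuous.log (by fun_prop) h1)
  exact (Continuous.rpow_const (by fun_prop) fun z => .inl (h1 z)).mul
    (h2.rpow_const fun z => .inl (by linarith [one_le_slog (norm_nonneg z)]))

lemma wt_isBigO_swt {p q : ℝ} (hp : p ≤ 0) (hq : 0 ≤ q) :
    (fun z : ℂ => wt p q ‖z‖) =O[cobounded ℂ] fun z => swt p q ‖z‖ := by
  refine IsBigO.of_bound (2 ^ (-p)) ?_
  filter_upwards [eventually_norm_gt ℂ 1] with z hz
  rw [Real.norm_of_nonneg (wt_pos hz).le, Real.norm_of_nonneg (swt_pos (norm_nonneg z)).le,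
    wt, swt, ← mul_assoc]
  have hz0 : 0 < ‖z‖ := by linarith
  have h1 : ‖z‖ ^ p ≤ 2 ^ (-p) * (1 + ‖z‖) ^ p := by
    calc ‖z‖ ^ p ≤ ((1 + ‖z‖) / 2) ^ p :=
          Real.rpow_le_rpow_of_nonpos (by positivity) (by linarith) hp
      _ = _ := by
          rw [Real.div_rpow (by positivity) (by norm_num), Real.rpow_neg (by norm_num)]; ring
  have h2 : Real.log ‖z‖ ≤ slog ‖z‖ := by
    have := Real.log_le_log hz0 (by linarith : ‖z‖ ≤ 1 + ‖z‖)
    unfold slog; linarith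
  have h3 := Real.log_pos hz
  gcongr

lemma slog_isBigO {q : ℝ} (hq : 0 ≤ q) : (fun z : ℂ => slog ‖z‖ ^ q) =O[cobounded ℂ]
    fun z => Real.log ‖z‖ ^ q := by
  refine IsBigO.of_bound (3 ^ q) ?_
  filter_upwards [eventually_norm_gt ℂ (Real.exp 1)] with z hz
  have hz0 : 0 < ‖z‖ := (Real.exp_pos 1).trans hz
  have h1 : 1 ≤ Real.log ‖z‖ := (Real.le_log_iff_exp_le hz0).2 hz.le
  have h0 := one_le_slog (norm_nonneg z)
  have h2 : slog ‖z‖ ≤ 3 * Real.log ‖z‖ := by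
    have h3 : 1 ≤ ‖z‖ := (Real.one_le_exp zero_le_one).trans hz.le
    have h4 := Real.log_le_log (by positivity) (by linarith : 1 + ‖z‖ ≤ 2 * ‖z‖)
    rw [Real.log_mul (by norm_num) hz0.ne'] at h4
    have h5 : Real.log 2 ≤ 1 := by linarith [Real.log_two_lt_d9]
    unfold slog; linarith
  rw [Real.norm_of_nonneg (by positivity), Real.norm_of_nonneg (by positivity),
    ← Real.mul_rpow (by norm_num) (by linarith)]
  exact Real.rpow_le_rpow (by linarith) h2 hq

lemma exists_swt_le {p q δ : ℝ} (hq : 0 ≤ q) (hδ : 0 < δ) :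
    ∃ C, ∀ x, 0 ≤ x → swt p q x ≤ C * (1 + x) ^ (p + δ) := by
  refine ⟨(1 + (q + 1) / δ) ^ (q + 1) * slog 1 ^ q, fun x hx => ?_⟩
  have h1 : slog x ^ q ≤ slog (1 + x) ^ q :=
    Real.rpow_le_rpow (by linarith [one_le_slog hx]) (slog_mono hx (by linarith)) hq
  have h2 := slog_rpow_le hq hδ one_pos (by linarith : 1 ≤ 1 + x)
  rw [div_one] at h2
  rw [swt, Real.rpow_add (by linarith : 0 < 1 + x) p δ]
  calc _ ≤ (1 + x) ^ p * ((1 + (q + 1) / δ) ^ (q + 1) * slog 1 ^ q * (1 + x) ^ δ) := by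
        gcongr
        exact h1.trans h2
    _ = _ := by ring

/-- Functions that decay like `1/z` agree near infinity with a global function that does. -/
lemma exists_global_extension {V : ℂ → ℂ} {k q : ℝ} (hk : 0 ≤ k) (hq : 0 ≤ q)
    (hV : ∀ᶠ z in cobounded ℂ, ContDiffAt ℝ 1 V z)
    (h0 : V =O[cobounded ℂ] fun z => wt (-1) 0 ‖z‖)
    (h1 : (fderiv ℝ V) =O[cobounded ℂ] fun z => wt (-2) 0 ‖z‖)
    (h2 : dzbar V =O[cobounded ℂ] fun z => wt (-k) q ‖z‖) :
    ∃ U : ℂ → ℂ, ContDiff ℝ 1 U ∧ U =ᶠ[cobounded ℂ] V ∧ ∃ C, 0 ≤ C ∧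
      (∀ z, ‖U z‖ ≤ C * (1 + ‖z‖) ^ (-1 : ℝ)) ∧ (∀ z, ‖fderiv ℝ U z‖ ≤ C * (1 + ‖z‖) ^ (-2 : ℝ)) ∧
      ∀ z, ‖dzbar U z‖ ≤ C * swt (-k) q ‖z‖ := by
  obtain ⟨R, hR⟩ := eventually_cobounded_iff.1 hV
  obtain ⟨η, r', hr', hη, -, he1, he0⟩ := exists_cutoff (r := |R| + 1) (R := |R| + 2)
    (by positivity) (by linarith)
  set U : ℂ → ℂ := fun z => (1 - η z) * V z with hUd
  have hU : ContDiff ℝ 1 U := by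
    refine contDiff_iff_contDiffAt.2 fun z => ?_
    rcases le_or_gt ‖z‖ |R| with hz | hz
    · refine (contDiffAt_const (c := (0 : ℂ))).congr_of_eventuallyEq ?_
      filter_upwards [he1 z (by simpa using by linarith)] with y hy
      simp [hUd, hy]
    · exact (contDiffAt_const.sub (hη.contDiffAt.of_le (by norm_num))).mul
        (hR z ((le_abs_self R).trans_lt hz))
  have hUV : U =ᶠ[cobounded ℂ] V := by
    filter_upwards [eventually_norm_gt ℂ r'] with z hz
    simp [hUd, (he0 z hz.le).eq_of_nhds]
  have hfd : fderiv ℝ U =ᶠ[cobounded ℂ] fderiv ℝ V := by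
    filter_upwards [eventually_cobounded_nhds hUV] with z hz using EventuallyEq.fderiv_eq hz
  have hdb : dzbar U =ᶠ[cobounded ℂ] dzbar V := by
    filter_upwards [hfd] with z hz
    simp only [wirt, hz]
  have key : ∀ {E : Type} [NormedAddCommGroup E] {f g : ℂ → E} {p q : ℝ}, Continuous f →
      f =ᶠ[cobounded ℂ] g → (g =O[cobounded ℂ] fun z => wt p q ‖z‖) → p ≤ 0 → 0 ≤ q →
      ∃ C, 0 ≤ C ∧ ∀ z, ‖f z‖ ≤ C * swt p q ‖z‖ := fun hf hfg hg hp hq =>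
    exists_global_bound hf (continuous_swt _ _) (fun z => swt_pos (norm_nonneg z))
      ((hg.congr' hfg.symm EventuallyEq.rfl).trans (wt_isBigO_swt hp hq))
  obtain ⟨C₀, h00, hC₀⟩ := key hU.continuous hUV h0 (by norm_num) le_rfl
  obtain ⟨C₁, h10, hC₁⟩ := key (hU.continuous_fderiv one_ne_zero) hfd h1 (by norm_num) le_rfl
  obtain ⟨C₂, h20, hC₂⟩ := key (continuous_wirt hU _) hdb h2 (by linarith) hq
  have hs0 : ∀ (p : ℝ) (z : ℂ), swt p 0 ‖z‖ = (1 + ‖z‖) ^ p := fun p z => by simp [swt]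
  refine ⟨U, hU, hUV, C₀ + C₁ + C₂, by positivity, fun z => ?_, fun z => ?_, fun z => ?_⟩
  · rw [← hs0]
    exact (hC₀ z).trans (mul_le_mul_of_nonneg_right (by linarith) (swt_pos (norm_nonneg z)).le)
  · rw [← hs0]
    exact (hC₁ z).trans (mul_le_mul_of_nonneg_right (by linarith) (swt_pos (norm_nonneg z)).le)
  · exact (hC₂ z).trans (mul_le_mul_of_nonneg_right (by linarith) (swt_pos (norm_nonneg z)).le)

/-- Expansion of the Cauchy transform at infinity. -/
lemma cauchy_transform_expansion {F : ℂ → ℂ} {k q C : ℝ} (hk : 3 < k) (hk4 : k ≤ 4) (hq : 0 ≤ q)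
    (hF : Continuous F) (hC : 0 ≤ C) (h : ∀ z, ‖F z‖ ≤ C * swt (-k) q ‖z‖) :
    (fun z => (∫ ζ, (z - ζ)⁻¹ * F ζ) - ((∫ ζ, F ζ) * z⁻¹ + (∫ ζ, ζ * F ζ) * (z⁻¹ * z⁻¹)))
      =O[cobounded ℂ] fun z => wt (1 - k) (q + 1) ‖z‖ := by
  -- The logarithms consume half of the margin k - 3, leaving decay of order (k + 3)/2 > 3; this
  -- makes the first moment absolutely convergent.
  obtain ⟨D, hD⟩ := exists_swt_le (p := -k) (δ := (k - 3) / 2) hq (by linarith)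
  have hbF : ∀ z, ‖F z‖ ≤ C * D * (1 + ‖z‖) ^ (-((k + 3) / 2)) := fun z => by
    refine (h z).trans ?_
    rw [mul_assoc]
    refine mul_le_mul_of_nonneg_left ((hD _ (norm_nonneg z)).trans_eq ?_) hC
    ring_nf
  have hbζ : ∀ z, ‖z * F z‖ ≤ C * D * (1 + ‖z‖) ^ (-((k + 1) / 2)) := fun z => by
    have e : (1 + ‖z‖) ^ (-((k + 1) / 2)) = (1 + ‖z‖) * (1 + ‖z‖) ^ (-((k + 3) / 2)) := by
      nth_rewrite 2 [← Real.rpow_one (1 + ‖z‖)]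
      rw [← Real.rpow_add (by positivity)]; ring_nf
    rw [norm_mul, e]
    calc _ ≤ (1 + ‖z‖) * (C * D * (1 + ‖z‖) ^ (-((k + 3) / 2))) :=
          mul_le_mul (by linarith) (hbF z) (norm_nonneg _) (by positivity)
      _ = _ := by ring
  have i0 : Integrable F :=
    integrable_of_le_one_add_norm hF.aestronglyMeasurable (by linarith) hbF
  have i1 : Integrable fun ζ => ζ * F ζ :=
    integrable_of_le_one_add_norm (by fun_prop) (by linarith) hbζ
  -- The remainder kernel ζ²/(z²(z - ζ)) carries two powers of ζ, reducing the decay order of the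
  -- density from k to k - 2, which lies between 1 and 2.
  obtain ⟨K, hK⟩ := exists_potential_le (β := k - 2) (by linarith) (by linarith) hq
  have hmain : (fun z => (∫ ζ, (z - ζ)⁻¹ * F ζ) -
      ((∫ ζ, F ζ) * z⁻¹ + (∫ ζ, ζ * F ζ) * (z⁻¹ * z⁻¹))) =O[cobounded ℂ]
      fun z : ℂ => ‖z‖ ^ (1 - k) * slog ‖z‖ ^ (q + 1) := by
    refine IsBigO.of_bound (C * K) ?_
    filter_upwards [eventually_norm_gt ℂ 1] with z hz
    obtain ⟨G, iG, hG, vG⟩ := hK z hz.le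
    have hz0 : 0 < ‖z‖ := by linarith
    have hz' : z ≠ 0 := norm_pos_iff.1 hz0
    have hw : ∀ ζ : ℂ, swt (-k) q ‖ζ‖ = (1 + ‖ζ‖) ^ (-2 : ℝ) *
        ((1 + ‖ζ‖) ^ (-(k - 2)) * slog ‖ζ‖ ^ q) := fun ζ => by
      rw [swt, ← mul_assoc, ← Real.rpow_add (by positivity)]; ring_nf
    have hsq : ∀ ζ : ℂ, ‖ζ‖ ^ 2 * (1 + ‖ζ‖) ^ (-2 : ℝ) ≤ 1 := fun ζ => by
      rw [Real.rpow_neg (by positivity), ← div_eq_mul_inv, div_le_one (by positivity)]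
      norm_cast
      gcongr
      linarith
    have hsq' : ∀ ζ : ℂ, (1 + ‖ζ‖) ^ (-2 : ℝ) ≤ 1 := fun ζ =>
      Real.rpow_le_one_of_one_le_of_nonpos (by linarith [norm_nonneg ζ]) (by norm_num)
    have hpos : ∀ ζ : ℂ, 0 ≤ (1 + ‖ζ‖) ^ (-(k - 2)) * slog ‖ζ‖ ^ q := fun ζ => by
      have := one_le_slog (norm_nonneg ζ)
      positivity
    have i2 : Integrable fun ζ => (z - ζ)⁻¹ * F ζ := by
      refine (iG.const_mul C).mono' (Measurable.aestronglyMeasurable (by fun_prop))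
        (Eventually.of_forall fun ζ => ?_)
      rw [norm_mul, norm_inv]
      calc _ ≤ ‖z - ζ‖⁻¹ * (C * (1 * ((1 + ‖ζ‖) ^ (-(k - 2)) * slog ‖ζ‖ ^ q))) := by
            gcongr
            refine (h ζ).trans ?_
            rw [hw]
            gcongr
            exacts [hpos ζ, hsq' ζ]
        _ = C * ((1 + ‖ζ‖) ^ (-(k - 2)) * slog ‖ζ‖ ^ q * ‖z - ζ‖⁻¹) := by ring
        _ ≤ C * G ζ := by gcongr; exact hG ζ
    have hne : ∀ᵐ ζ : ℂ, ζ ≠ z := by simp [ae_iff]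
    have e : (∫ ζ, (z - ζ)⁻¹ * F ζ) - ((∫ ζ, F ζ) * z⁻¹ + (∫ ζ, ζ * F ζ) * (z⁻¹ * z⁻¹)) =
        ∫ ζ, (z⁻¹ * z⁻¹) * (ζ ^ 2 * (z - ζ)⁻¹ * F ζ) := by
      have j0 : Integrable fun ζ => F ζ * z⁻¹ := i0.mul_const _
      have j1 : Integrable fun ζ => ζ * F ζ * (z⁻¹ * z⁻¹) := i1.mul_const _
      have j2 : Integrable fun ζ => F ζ * z⁻¹ + ζ * F ζ * (z⁻¹ * z⁻¹) := j0.add j1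
      rw [← integral_mul_const, ← integral_mul_const, ← integral_add j0 j1, ← integral_sub i2 j2]
      refine integral_congr_ae ?_
      filter_upwards [hne] with ζ hζ
      have : z - ζ ≠ 0 := sub_ne_zero.2 hζ.symm
      field_simp
      ring
    rw [e]
    have hbound : ∀ᵐ ζ : ℂ, ‖(z⁻¹ * z⁻¹) * (ζ ^ 2 * (z - ζ)⁻¹ * F ζ)‖ ≤
        ‖z‖ ^ (-2 : ℝ) * C * G ζ := Eventually.of_forall fun ζ => by
      have e2 : ‖z⁻¹ * z⁻¹‖ = ‖z‖ ^ (-2 : ℝ) := by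
        rw [norm_mul, norm_inv, ← Real.rpow_neg_one, ← Real.rpow_add hz0]; norm_num
      rw [norm_mul, e2, norm_mul, norm_mul, norm_inv, norm_pow, mul_assoc (‖z‖ ^ (-2 : ℝ)) C]
      refine mul_le_mul_of_nonneg_left ?_ (by positivity)
      calc _ ≤ ‖ζ‖ ^ 2 * ‖z - ζ‖⁻¹ * (C * swt (-k) q ‖ζ‖) := by gcongr; exact h ζ
        _ = C * (‖ζ‖ ^ 2 * (1 + ‖ζ‖) ^ (-2 : ℝ)) *
            ((1 + ‖ζ‖) ^ (-(k - 2)) * slog ‖ζ‖ ^ q * ‖z - ζ‖⁻¹) := by rw [hw]; ring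
        _ ≤ C * 1 * G ζ := by
            have := hpos ζ
            gcongr
            exacts [hsq ζ, hG ζ]
        _ = _ := by ring
    refine (norm_integral_le_of_norm_le (iG.const_mul _) hbound).trans ?_
    rw [integral_const_mul]
    have hs := one_le_slog hz0.le
    rw [Real.norm_of_nonneg (by positivity)]
    have e3 : ‖z‖ ^ (1 - k) = ‖z‖ ^ (-2 : ℝ) * ‖z‖ ^ (1 - (k - 2)) := by
      rw [← Real.rpow_add hz0]; ring_nf
    calc _ ≤ ‖z‖ ^ (-2 : ℝ) * C * (K * (‖z‖ ^ (1 - (k - 2)) * slog ‖z‖ ^ (q + 1))) := by gcongr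
      _ = _ := by rw [e3]; ring
  exact hmain.trans ((isBigO_refl _ _).mul (slog_isBigO (by linarith)))

/-- The coefficients are the normalized moments of ∂̄ of a global extension. They depend on the
behaviour of V on bounded sets, although only their existence is asserted. -/
theorem exists_expansion_of_dzbar {V : ℂ → ℂ} {k q : ℝ} (hk : 3 < k) (hk4 : k ≤ 4) (hq : 0 ≤ q)
    (hV : ∀ᶠ z in cobounded ℂ, ContDiffAt ℝ 1 V z)
    (h0 : V =O[cobounded ℂ] fun z => wt (-1) 0 ‖z‖)
    (h1 : (fderiv ℝ V) =O[cobounded ℂ] fun z => wt (-2) 0 ‖z‖)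
    (h2 : dzbar V =O[cobounded ℂ] fun z => wt (-k) q ‖z‖) :
    ∃ b₀ b₁ : ℂ, (fun z => V z - (b₀ * z⁻¹ + b₁ * (z⁻¹ * z⁻¹))) =O[cobounded ℂ]
      fun z => wt (1 - k) (q + 1) ‖z‖ := by
  obtain ⟨U, hU, hUV, C, hC, hC0, hC1, hC2⟩ :=
    exists_global_extension (by linarith) hq hV h0 h1 h2
  have h := cauchy_transform_expansion hk hk4 hq (continuous_wirt hU _) hC hC2
  refine ⟨mollMass⁻¹ * ∫ ζ, dzbar U ζ, mollMass⁻¹ * ∫ ζ, ζ * dzbar U ζ, ?_⟩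
  refine (h.const_mul_left mollMass⁻¹).congr' ?_ EventuallyEq.rfl
  filter_upwards [hUV] with z hz
  rw [cauchy_pompeiu hU hC0 hC1 z, hz]
  have := mollMass_ne_zero
  field_simp

/-! ### Integration from infinity -/

/-- Integration of the gradient along the ray from z to infinity. The weight itself is, far out and
up to a constant, a primitive of the bound on the gradient. -/
lemma isBigO_of_fderiv {u : ℂ → ℂ} {p q : ℝ} (hp : p < 0)
    (hd : ∀ᶠ z in cobounded ℂ, DifferentiableAt ℝ u z)
    (h : (fderiv ℝ u) =O[cobounded ℂ] fun z => wt (p - 1) q ‖z‖)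
    (h0 : Tendsto u (cobounded ℂ) (𝓝 0)) : u =O[cobounded ℂ] fun z => wt p q ‖z‖ := by
  obtain ⟨C, hC0, hC⟩ := h.exists_nonneg
  obtain ⟨R, hR⟩ := eventually_cobounded_iff.1 (hd.and hC.bound)
  -- Beyond this radius the derivative of the logarithmic factor costs at most half of the decay of
  -- the power, which leaves the factor -p/2.
  set R₁ := max (max R 1) (Real.exp (2 * q / (-p))) with hR₁
  have hwt : ∀ s, R₁ < s → ∃ D, HasDerivAt (wt p q) D s ∧ -p / 2 * wt (p - 1) q s ≤ -D := by
    intro s hs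
    have h1 : 1 < s := ((le_max_right R 1).trans (le_max_left _ _)).trans_lt hs
    have hs0 : 0 < s := by linarith
    have hl := Real.log_pos h1
    refine ⟨_, (Real.hasDerivAt_rpow_const (.inl hs0.ne')).mul
      ((Real.hasDerivAt_log hs0.ne').rpow_const (.inl hl.ne')), ?_⟩
    have h2 : 2 * q / (-p) ≤ Real.log s :=
      (Real.le_log_iff_exp_le hs0).2 ((le_max_right _ _).trans hs.le)
    rw [div_le_iff₀ (by linarith)] at h2
    have e1 : s ^ p * s⁻¹ = s ^ (p - 1) := by
      rw [Real.rpow_sub_one hs0.ne', div_eq_mul_inv]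
    have e2 : Real.log s ^ q = Real.log s ^ (q - 1) * Real.log s := by
      rw [← Real.rpow_add_one hl.ne']; ring_nf
    have e3 : -(p * s ^ (p - 1) * Real.log s ^ q + s ^ p * (s⁻¹ * q * Real.log s ^ (q - 1))) =
        s ^ (p - 1) * Real.log s ^ (q - 1) * (-p * Real.log s - q) := by
      rw [e2, ← e1]; ring
    rw [e3, wt, e2]
    have : 0 ≤ s ^ (p - 1) * Real.log s ^ (q - 1) := by positivity
    nlinarith
  refine IsBigO.of_bound (2 * C / (-p)) ?_
  filter_upwards [eventually_norm_gt ℂ R₁] with z hz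
  have hz1 : 1 < ‖z‖ := ((le_max_right R 1).trans (le_max_left _ _)).trans_lt hz
  have hz0 : 0 < ‖z‖ := by linarith
  set K := 2 * C / (-p) with hK
  have hK0 : 0 ≤ K := div_nonneg (by positivity) (by linarith)
  rw [Real.norm_of_nonneg (wt_pos hz1).le]
  have hts : ∀ t : ℝ, 1 ≤ t → R₁ < t * ‖z‖ := fun t ht => hz.trans_le (by nlinarith)
  have hnt : ∀ t : ℝ, 1 ≤ t → ‖(t : ℂ) * z‖ = t * ‖z‖ := fun t ht => by
    rw [norm_mul, Complex.norm_real, Real.norm_of_nonneg (by linarith)]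
  have hRt : ∀ t : ℝ, 1 ≤ t → R < ‖(t : ℂ) * z‖ := fun t ht => by
    rw [hnt t ht]
    exact ((le_max_left R 1).trans (le_max_left _ _)).trans_lt (hts t ht)
  have hfd : ∀ t : ℝ, 1 ≤ t → HasDerivAt (fun t : ℝ => u ((t : ℂ) * z) - u z)
      (fderiv ℝ u ((t : ℂ) * z) z) t := fun t ht => by
    have h1 : HasDerivAt (fun t : ℝ => (t : ℂ) * z) z t := by
      simpa using (Complex.ofRealCLM.hasDerivAt (x := t)).mul_const z
    exact ((hR _ (hRt t ht)).1.hasFDerivAt.comp_hasDerivAt t h1).sub_const _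
  have hBd : ∀ t : ℝ, 1 ≤ t → ∃ D, HasDerivAt (fun t : ℝ => K * (wt p q ‖z‖ - wt p q (t * ‖z‖))) D t
      ∧ C * wt (p - 1) q (t * ‖z‖) * ‖z‖ ≤ D := fun t ht => by
    obtain ⟨D, hD, hD'⟩ := hwt _ (hts t ht)
    have h1 : HasDerivAt (fun t : ℝ => t * ‖z‖) ‖z‖ t := by
      simpa using (hasDerivAt_id t).mul_const ‖z‖
    have h2 : HasDerivAt (fun t : ℝ => wt p q (t * ‖z‖)) (D * ‖z‖) t :=
      HasDerivAt.comp (h₂ := wt p q) (h := fun t => t * ‖z‖) t hD h1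
    refine ⟨_, (h2.const_sub (wt p q ‖z‖)).const_mul K, ?_⟩
    have : C * wt (p - 1) q (t * ‖z‖) = K * (-p / 2 * wt (p - 1) q (t * ‖z‖)) := by
      rw [hK]
      have : p ≠ 0 := hp.ne
      field_simp
    rw [this]
    calc _ ≤ K * (-D) * ‖z‖ := by gcongr
      _ = _ := by ring
  choose! D hD hD' using hBd
  have hle : ∀ T : ℝ, 1 ≤ T → ‖u ((T : ℂ) * z) - u z‖ ≤ K * (wt p q ‖z‖ - wt p q (T * ‖z‖)) := by
    intro T hT
    refine image_norm_le_of_norm_deriv_right_le_deriv_boundary' (a := 1) (b := T)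
      (f := fun t : ℝ => u ((t : ℂ) * z) - u z) (B := fun t : ℝ => K * (wt p q ‖z‖ - wt p q (t * ‖z‖)))
      (fun t ht => (hfd t ht.1).continuousAt.continuousWithinAt)
      (fun t ht => (hfd t ht.1).hasDerivWithinAt) (by simp)
      (fun t ht => (hD t ht.1).continuousAt.continuousWithinAt)
      (fun t ht => (hD t ht.1).hasDerivWithinAt) (fun t ht => ?_) (right_mem_Icc.2 hT)
    refine ((ContinuousLinearMap.le_opNorm _ _).trans ?_).trans (hD' t ht.1)
    gcongr
    have := (hR _ (hRt t ht.1)).2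
    rw [hnt t ht.1] at this
    rwa [Real.norm_of_nonneg (wt_pos (by nlinarith [ht.1])).le] at this
  have hlim : Tendsto (fun T : ℝ => ‖u ((T : ℂ) * z) - u z‖) atTop (𝓝 ‖u z‖) := by
    have h1 : Tendsto (fun T : ℝ => (T : ℂ) * z) atTop (cobounded ℂ) := by
      rw [← tendsto_norm_atTop_iff_cobounded]
      refine (tendsto_id.atTop_mul_const hz0).congr' ?_
      filter_upwards [eventually_ge_atTop 1] with T hT using (hnt T hT).symm
    have := ((h0.comp h1).sub_const (u z)).norm
    simpa using this
  refine le_of_tendsto hlim ?_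
  filter_upwards [eventually_ge_atTop 1] with T hT
  refine (hle T hT).trans ?_
  have : 0 ≤ wt p q (T * ‖z‖) := (wt_pos (by nlinarith)).le
  nlinarith

/-! ### The expansion for equations that are close to the Laplace equation -/

lemma fderiv_inv_apply {z : ℂ} (hz : z ≠ 0) (e : ℂ) :
    fderiv ℝ (fun z : ℂ => z⁻¹) z e = -e * (z⁻¹ * z⁻¹) := by
  have := fderiv_div_apply (f := fun _ => 1) (g := fun z => z) (differentiableAt_const _)
    differentiableAt_fun_id hz e
  simp only [one_div] at this
  rw [this]
  simp
  field_simp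

lemma wirt_inv (c : ℂ) {z : ℂ} (hz : z ≠ 0) :
    wirt c (fun z : ℂ => z⁻¹) z = -((1 + c * Complex.I) / 2) * (z⁻¹ * z⁻¹) := by
  simp only [wirt, fderiv_inv_apply hz]; ring

lemma FarO.id {m : ℕ} : FarO m 1 0 fun z => z := by
  have hO : (fun z : ℂ => z) =O[cobounded ℂ] fun z => wt 1 0 ‖z‖ := by
    simp only [wt_zero, Real.rpow_one]
    exact (isBigO_refl _ _).norm_right
  cases m with
  | zero => exact ⟨Eventually.of_forall fun z => continuousAt_id, hO⟩
  | succ m =>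
    refine ⟨Eventually.of_forall fun z => differentiableAt_fun_id, hO, ?_, ?_⟩
    all_goals
      simp only [fderiv_fun_id, ContinuousLinearMap.id_apply, sub_self]
      exact FarO.const _

lemma FarO.inv_id {m : ℕ} : FarO m (-1) 0 fun z => z⁻¹ :=
  FarO.inv FarO.id one_pos (Eventually.of_forall fun z => by simp)

lemma eventually_ne_zero : ∀ᶠ z in cobounded ℂ, z ≠ 0 :=
  (eventually_norm_gt ℂ 0).mono fun _ => norm_pos_iff.1

lemma beltrami_sub {μ V W : ℂ → ℂ} {z : ℂ} (hV : DifferentiableAt ℝ V z)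
    (hW : DifferentiableAt ℝ W z) :
    beltrami μ (fun z => V z - W z) z = beltrami μ V z - beltrami μ W z := by
  have h : ∀ c, wirt c (fun z => V z - W z) z = wirt c V z - wirt c W z := fun c => by
    simp only [wirt, fderiv_fun_sub hV hW, _root_.sub_apply]; ring
  simp only [beltrami, dz, dzbar, h, mul_sub, map_sub]
  ring

/-- The derivative of a real function is controlled by its Wirtinger derivative. -/
lemma fderiv_apply_of_real {u : ℂ → ℂ} {z : ℂ} (hu : DifferentiableAt ℝ u z)
    (hr : ∀ z, conj (u z) = u z) (e : ℂ) :
    fderiv ℝ u z e = e * dz u z + conj (e * dz u z) := by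
  have hc : ∀ e, conj (fderiv ℝ u z e) = fderiv ℝ u z e := fun e => by
    rw [← fderiv_conj_apply hu]
    simp only [hr]
  have h2 : fderiv ℝ u z e = e.re * fderiv ℝ u z 1 + e.im * fderiv ℝ u z Complex.I := by
    rw [← Complex.real_smul, ← Complex.real_smul, ← map_smul, ← map_smul, ← map_add]
    congr 1
    simp [Complex.re_add_im]
  rw [h2]
  simp only [wirt, map_mul, map_div₀, map_add, map_neg, hc, map_ofNat, Complex.conj_I]
  have e1 : e = e.re + e.im * Complex.I := (Complex.re_add_im e).symm
  have e2 : conj e = e.re - e.im * Complex.I := by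
    apply Complex.ext <;> simp
  rw [e2]
  nth_rewrite 3 [e1]
  ring_nf
  simp only [Complex.I_sq]
  ring

lemma dzbar_of_real {u : ℂ → ℂ} {z : ℂ} (hu : DifferentiableAt ℝ u z)
    (hr : ∀ z, conj (u z) = u z) : dzbar u z = conj (dz u z) := by
  have := wirt_conj (-Complex.I) hu
  simp only [hr] at this
  rw [dz, this]
  simp

/-! ### Logarithms of positive definite quadratic forms -/

/-- The quadratic form with coefficients `A`, `2 B`, `C`. -/
noncomputable def qf (A B C : ℝ) (z : ℂ) : ℝ := A * z.re ^ 2 + 2 * B * z.re * z.im + C * z.im ^ 2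

/-- The Wirtinger derivative of the logarithm of `qf`. -/
noncomputable def qfDz (A B C : ℝ) (z : ℂ) : ℂ :=
  ((A * z.re + B * z.im : ℝ) - Complex.I * (B * z.re + C * z.im : ℝ)) / qf A B C z

section Quadratic
variable {A B C : ℝ}

/-- The Cayley–Hamilton identity M² = (tr M)M - (det M)I, evaluated on z. It bounds below both the
form and its ratio to its gradient. -/
lemma qf_lower (z : ℂ) : (A + C) * qf A B C z = (A * z.re + B * z.im) ^ 2 +
    (B * z.re + C * z.im) ^ 2 + (A * C - B ^ 2) * ‖z‖ ^ 2 := by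
  rw [Complex.sq_norm, Complex.normSq_apply, qf]; ring

lemma qf_pos (hA : 0 < A) (hC : 0 < C) (hD : 0 < A * C - B ^ 2) {z : ℂ} (hz : z ≠ 0) :
    0 < qf A B C z := by
  have h := qf_lower (A := A) (B := B) (C := C) z
  have hz' : 0 < ‖z‖ := norm_pos_iff.2 hz
  have : 0 < (A + C) * qf A B C z := by rw [h]; positivity
  exact pos_of_mul_pos_right this (by linarith)

lemma hasFDerivAt_qf (z : ℂ) : HasFDerivAt (qf A B C)
    ((2 * (A * z.re + B * z.im)) • Complex.reCLM + (2 * (B * z.re + C * z.im)) • Complex.imCLM) z := by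
  have h1 : HasFDerivAt Complex.re Complex.reCLM z := Complex.reCLM.hasFDerivAt
  have h2 : HasFDerivAt Complex.im Complex.imCLM z := Complex.imCLM.hasFDerivAt
  have := (((h1.pow 2).const_mul A).add (((h1.const_mul (2 * B)).mul h2))).add
    ((h2.pow 2).const_mul C)
  refine (this.congr_fderiv ?_)
  ext
  simp
  ring

lemma hasFDerivAt_log_qf {z : ℂ} (h : 0 < qf A B C z) :
    HasFDerivAt (fun z => (Real.log (qf A B C z) : ℂ)) (Complex.ofRealCLM.comp ((qf A B C z)⁻¹ •
      ((2 * (A * z.re + B * z.im)) • Complex.reCLM +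
        (2 * (B * z.re + C * z.im)) • Complex.imCLM))) z :=
  Complex.ofRealCLM.hasFDerivAt.comp z ((hasFDerivAt_qf z).log h.ne')

lemma dz_log_qf {z : ℂ} (h : 0 < qf A B C z) :
    dz (fun z => (Real.log (qf A B C z) : ℂ)) z = qfDz A B C z := by
  have hne : (qf A B C z : ℂ) ≠ 0 := by exact_mod_cast h.ne'
  simp only [wirt, (hasFDerivAt_log_qf h).fderiv, qfDz]
  simp
  field_simp
  ring

lemma qfDz_isBigO (hA : 0 < A) (hC : 0 < C) (hD : 0 < A * C - B ^ 2) :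
    qfDz A B C =O[cobounded ℂ] fun z => wt (-1) 0 ‖z‖ := by
  set D := A * C - B ^ 2 with hDd
  refine IsBigO.of_bound ((1 + 1 / (2 * D)) * (A + C)) ?_
  filter_upwards [eventually_ne_zero, eventually_norm_gt ℂ 1] with z hz hz1
  have hq := qf_pos hA hC hD hz
  have hn : 0 < ‖z‖ := norm_pos_iff.2 hz
  rw [Real.norm_of_nonneg (wt_pos hz1).le, wt_zero, Real.rpow_neg_one, qfDz, norm_div,
    Complex.norm_real, Real.norm_of_nonneg hq.le, div_le_iff₀ hq]
  set N := ‖((A * z.re + B * z.im : ℝ) : ℂ) - Complex.I * (B * z.re + C * z.im : ℝ)‖ with hN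
  have hN2 : N ^ 2 = (A * z.re + B * z.im) ^ 2 + (B * z.re + C * z.im) ^ 2 := by
    rw [hN, Complex.sq_norm, Complex.normSq_apply]
    simp
    ring
  have hl := qf_lower (A := A) (B := B) (C := C) z
  rw [← hN2, ← hDd] at hl
  have h1 : N ^ 2 ≤ (A + C) * qf A B C z := by rw [hl]; nlinarith [sq_nonneg ‖z‖]
  have h2 : ‖z‖ ^ 2 ≤ 1 / D * ((A + C) * qf A B C z) := by
    rw [one_div, le_inv_mul_iff₀ hD, hl]; nlinarith [sq_nonneg N]
  have h3 : N * ‖z‖ ≤ (1 + 1 / (2 * D)) * (A + C) * qf A B C z := by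
    have : 1 / (2 * D) = 1 / D / 2 := by field_simp
    rw [this]
    nlinarith [sq_nonneg (N - ‖z‖), mul_pos (by linarith : 0 < A + C) hq]
  calc N = N * ‖z‖ * ‖z‖⁻¹ := by field_simp
    _ ≤ (1 + 1 / (2 * D)) * (A + C) * qf A B C z * ‖z‖⁻¹ := by gcongr
    _ = _ := by ring

lemma qfDz_smul {t : ℝ} (ht : 0 < t) (z : ℂ) : qfDz A B C (t * z) = (t : ℂ)⁻¹ * qfDz A B C z := by
  have ht' : (t : ℂ) ≠ 0 := by exact_mod_cast ht.ne'
  have e : qf A B C (t * z) = t ^ 2 * qf A B C z := by simp [qf]; ring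
  simp only [qfDz, e]
  push_cast
  simp only [Complex.re_ofReal_mul, Complex.im_ofReal_mul]
  push_cast
  field_simp

/-- Along a ray H has size exactly |H(z)|/t, which is incompatible with O(t^-2) unless it vanishes.
-/
lemma eq_zero_of_homogeneous {H : ℂ → ℂ} (hH : ∀ t : ℝ, 0 < t → ∀ z, H (t * z) = (t : ℂ)⁻¹ * H z)
    (hO : H =O[cobounded ℂ] fun z => wt (-2) 0 ‖z‖) {z : ℂ} (hz : z ≠ 0) : H z = 0 := by
  have hn : 0 < ‖z‖ := norm_pos_iff.2 hz
  obtain ⟨K, hK0, hK⟩ := hO.exists_nonneg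
  obtain ⟨R, hR⟩ := eventually_cobounded_iff.1 hK.bound
  have hlim : Tendsto (fun t : ℝ => K * ‖z‖ ^ (-2 : ℝ) * t ^ (-1 : ℝ)) atTop (𝓝 0) := by
    simpa using (tendsto_rpow_neg_atTop one_pos).const_mul (K * ‖z‖ ^ (-2 : ℝ))
  refine norm_le_zero_iff.1 (ge_of_tendsto hlim ?_)
  filter_upwards [eventually_gt_atTop 0, (tendsto_id.atTop_mul_const hn).eventually_gt_atTop R]
    with t ht htR
  have e : ‖(t : ℂ) * z‖ = t * ‖z‖ := by
    rw [norm_mul, Complex.norm_real, Real.norm_of_nonneg ht.le]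
  have h := hR (t * z) (by rw [e]; exact htR)
  rw [hH t ht, wt_zero, e, norm_mul, norm_inv, Complex.norm_real, Real.norm_of_nonneg ht.le,
    Real.norm_of_nonneg (by positivity), Real.mul_rpow ht.le hn.le, inv_mul_le_iff₀ ht] at h
  refine h.trans_eq ?_
  have : t * t ^ (-2 : ℝ) = t ^ (-1 : ℝ) := by
    nth_rewrite 1 [← Real.rpow_one t]
    rw [← Real.rpow_add ht]; norm_num
  rw [← this]; ring

/-- If the logarithm of a quadratic form is harmonic to leading order, the form is round. -/
lemma round_of_qfDz (hA : 0 < A) (hC : 0 < C) {d : ℝ} {b : ℂ}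
    (h : ∀ z, z ≠ 0 → d * qfDz A B C z - b * z⁻¹ = 0) : b = d ∧ (d ≠ 0 → A = C ∧ B = 0) := by
  have hA' : (A : ℂ) ≠ 0 := by exact_mod_cast hA.ne'
  have hC' : (C : ℂ) ≠ 0 := by exact_mod_cast hC.ne'
  -- Three test points suffice: 1 and i determine b and force B = 0, and 1 + i then forces A = C.
  have h1 := h 1 one_ne_zero
  have h2 := h Complex.I Complex.I_ne_zero
  simp [qfDz, qf] at h1 h2
  have e1 : b * A = d * (A - Complex.I * B) := by
    field_simp at h1
    linear_combination -h1
  have e2 : b * C = d * (C + Complex.I * B) := by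
    field_simp at h2
    linear_combination -Complex.I * h2 + (b * C - d * C) * Complex.I_sq
  have r1 := congrArg Complex.re e1
  have i1 := congrArg Complex.im e1
  have i2 := congrArg Complex.im e2
  simp at r1 i1 i2
  have hbr : b.re = d := by
    rcases r1 with h | h
    exacts [h, absurd h hA.ne']
  have hbi : b.im = 0 := by
    have : b.im * (A + C) = 0 := by linarith
    exact (mul_eq_zero.1 this).resolve_right (by linarith)
  have hb : b = d := Complex.ext (by simpa using hbr) (by simpa using hbi)
  refine ⟨hb, fun hd => ?_⟩
  have hB : B = 0 := by
    rw [hbi, zero_mul] at i2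
    exact (mul_eq_zero.1 i2.symm).resolve_left hd
  refine ⟨?_, hB⟩
  have hI : (1 + Complex.I) ≠ 0 := fun h => by simpa using congrArg Complex.im h
  have h3 := h (1 + Complex.I) hI
  have hAC : (A : ℂ) + C ≠ 0 := by exact_mod_cast (by linarith : A + C ≠ 0)
  have hd' : (d : ℂ) ≠ 0 := by exact_mod_cast hd
  subst hB
  simp [qfDz, qf, hb] at h3
  field_simp at h3
  have i3 := congrArg Complex.im h3
  simp [hd] at i3
  linarith

end Quadratic

/-- A real function whose gradient solves a Beltrami equation with decaying data, and which is
asymptotic to a multiple of the logarithm of a quadratic form, has an expansion up to the first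
harmonic at infinity; the quadratic form is round unless the multiple vanishes. -/
theorem planar_expansion {m : ℕ} {k q : ℝ} (hk : 3 < k) (hk4 : k ≤ 4) (hq : 0 ≤ q)
    {μ h v : ℂ → ℂ} (hμ : FarO (m + 1) (-2) 0 μ) (hh : FarO (m + 1) (-k) q h)
    (hr : ∀ z, conj (v z) = v z) (hv : ∀ᶠ z in cobounded ℂ, ContDiffAt ℝ 2 v z)
    (heq : ∀ᶠ z in cobounded ℂ, beltrami μ (dz v) z = h z)
    {A B C d : ℝ} (hA : 0 < A) (hC : 0 < C) (hD : 0 < A * C - B ^ 2)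
    (hvq : FarO 1 (-1) 0 fun z => v z - d * Real.log (qf A B C z)) :
    (d ≠ 0 → A = C ∧ B = 0) ∧ ∃ b : ℂ, FarO (m + 2) (2 - k) (q + 1)
      fun z => v z - (d * Real.log (qf A B C z) + (b * z⁻¹).re) := by
  have hne := eventually_ne_zero
  have hvd : ∀ᶠ z in cobounded ℂ, DifferentiableAt ℝ v z :=
    hv.mono fun z hz => hz.differentiableAt two_ne_zero
  have hVc : ∀ᶠ z in cobounded ℂ, ContDiffAt ℝ 1 (dz v) z := by
    filter_upwards [hv] with z hz
    have : ContDiffAt ℝ 1 (fderiv ℝ v) z := hz.fderiv_right (by norm_num)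
    have h1 : ∀ e, ContDiffAt ℝ 1 (fun z => fderiv ℝ v z e) z := fun e =>
      this.clm_apply contDiffAt_const
    show ContDiffAt ℝ 1 (fun z => (fderiv ℝ v z 1 + -Complex.I * fderiv ℝ v z Complex.I) / 2) z
    exact ((h1 1).add (contDiffAt_const.mul (h1 Complex.I))).div_const 2
  have hVd := hVc.mono fun z hz => hz.differentiableAt one_ne_zero
  have hqfd : ∀ z ≠ 0, DifferentiableAt ℝ (fun z => (Real.log (qf A B C z) : ℂ)) z := fun z hz =>
    (hasFDerivAt_log_qf (qf_pos hA hC hD hz)).differentiableAt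
  -- the leading term of the gradient
  have hVq : (fun z => dz v z - d * qfDz A B C z) =O[cobounded ℂ] fun z => wt (-2) 0 ‖z‖ := by
    have h1 := (hvq.wirt (-Complex.I)).isBigO
    rw [show (-1 : ℝ) - 1 = -2 by norm_num] at h1
    refine h1.congr' ?_ EventuallyEq.rfl
    filter_upwards [hvd, hne] with z h1 h2
    have h3 := hqfd z h2
    have h4 := dz_log_qf (qf_pos hA hC hD h2)
    simp only [dz, wirt] at h4 ⊢
    rw [fderiv_fun_sub h1 (h3.const_mul _), fderiv_const_mul h3, ← h4]
    simp only [_root_.sub_apply, _root_.smul_apply, smul_eq_mul]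
    ring
  have hV0 : dz v =O[cobounded ℂ] fun z => wt (-1) 0 ‖z‖ := by
    have := (hVq.trans (wt_isBigO (.inl (by norm_num : (-2 : ℝ) < -1)) ℂ)).add
      ((qfDz_isBigO hA hC hD).const_mul_left (d : ℂ))
    simpa using this
  -- First use of the Schauder estimate: the size of w at infinity is extended to its derivatives,
  -- which makes μ∂w of order -4.
  have hV : FarO (m + 1) (-1) 0 (dz v) :=
    FarO.of_beltrami hμ (hh.weaken (.inl (by linarith))) hV0 hVc heq
  have hV' : FarO m (-2) 0 (dz (dz v)) := by
    have := hV.wirt (-Complex.I)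
    rwa [show (-1 : ℝ) - 1 = -2 by norm_num] at this
  have hdb : dzbar (dz v) =O[cobounded ℂ] fun z => wt (-k) q ‖z‖ := by
    -- The product has order -2 - 2 = -4, so this is where k ≤ 4 enters.
    have h1 := ((hμ.pred.mul hV').weaken (p' := -k) (q' := q)
      (.inr ⟨by linarith, by linarith⟩))
    refine (hh.pred.add (h1.add h1.conj)).isBigO.congr' ?_ EventuallyEq.rfl
    filter_upwards [heq] with z hz
    rw [← hz, beltrami]; ring
  have hfd : fderiv ℝ (dz v) =O[cobounded ℂ] fun z => wt (-2) 0 ‖z‖ := by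
    have := hV.fderiv_isBigO
    rwa [show (-1 : ℝ) - 1 = -2 by norm_num] at this
  obtain ⟨b₀, b₁, hE⟩ := exists_expansion_of_dzbar hk hk4 hq hVc hV0 hfd hdb
  -- identification of the leading term
  have hI2 : FarO (m + 2) (-2) 0 fun z : ℂ => z⁻¹ * z⁻¹ := by
    have := (FarO.inv_id (m := m + 2)).mul FarO.inv_id
    rwa [show (-1 : ℝ) + -1 = -2 by norm_num, zero_add] at this
  have hH : (fun z => d * qfDz A B C z - b₀ * z⁻¹) =O[cobounded ℂ] fun z => wt (-2) 0 ‖z‖ := by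
    have h1 := (hE.trans (wt_isBigO (.inl (by linarith : 1 - k < -2)) ℂ)).sub hVq
    have h2 := h1.add (hI2.isBigO.const_mul_left b₁)
    refine h2.congr_left fun z => ?_
    ring
  have hHz : ∀ z, z ≠ 0 → d * qfDz A B C z - b₀ * z⁻¹ = 0 := fun z hz =>
    eq_zero_of_homogeneous (H := fun z => d * qfDz A B C z - b₀ * z⁻¹)
      (fun t ht z => by rw [qfDz_smul ht, mul_inv]; ring) hH hz
  -- For holomorphic f the Wirtinger derivative of Re f is f'/2; hence Re(-2b₁/z) has derivative
  -- b₁/z².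
  refine ⟨(round_of_qfDz hA hC hHz).2, -2 * b₁, ?_⟩
  -- the remainder
  set L : ℂ → ℂ := fun z => b₀ * z⁻¹ + b₁ * (z⁻¹ * z⁻¹) with hL
  set r : ℂ → ℂ := fun z => v z - (d * Real.log (qf A B C z) + ((-2 * b₁ * z⁻¹).re : ℝ)) with hrd
  have hinv : ∀ z : ℂ, z ≠ 0 → DifferentiableAt ℝ (fun z : ℂ => z⁻¹) z := fun z hz =>
    (differentiableAt_inv (𝕜 := ℂ) hz).restrictScalars ℝ
  have hre : ∀ z : ℂ, (((-2 * b₁ * z⁻¹).re : ℝ) : ℂ) =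
      -(b₁ * z⁻¹) - (starRingEnd ℂ) (b₁ * z⁻¹) := fun z => by
    apply Complex.ext
    · simp; ring
    · simp; ring
  have hrr : ∀ z, (starRingEnd ℂ) (r z) = r z := fun z => by
    simp only [hrd, map_sub, map_add, map_mul, hr, Complex.conj_ofReal]
  have hred : ∀ z : ℂ, z ≠ 0 → DifferentiableAt ℝ (fun z : ℂ => (((-2 * b₁ * z⁻¹).re : ℝ) : ℂ)) z :=
    fun z hz => Complex.ofRealCLM.differentiableAt.comp z
      (Complex.reCLM.differentiableAt.comp z ((hinv z hz).const_mul _))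
  have hrdiff : ∀ᶠ z in cobounded ℂ, DifferentiableAt ℝ r z := by
    filter_upwards [hvd, hne] with z h1 h2
    exact h1.sub (((hqfd z h2).const_mul _).add (hred z h2))
  have hdzre : ∀ z : ℂ, z ≠ 0 → dz (fun z : ℂ => (((-2 * b₁ * z⁻¹).re : ℝ) : ℂ)) z =
      b₁ * (z⁻¹ * z⁻¹) := by
    intro z hz
    have h1 := (hinv z hz).const_mul b₁
    have h2 : DifferentiableAt ℝ (fun z : ℂ => (starRingEnd ℂ) (b₁ * z⁻¹)) z :=
      Complex.conjCLE.differentiableAt.comp z h1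
    simp only [hre, dz, wirt]
    rw [fderiv_fun_sub h1.fun_neg h2, fderiv_fun_neg]
    simp only [_root_.sub_apply, _root_.neg_apply]
    rw [fderiv_conj_apply h1, fderiv_conj_apply h1, fderiv_const_mul (hinv z hz)]
    simp only [_root_.smul_apply, fderiv_inv_apply hz, smul_eq_mul, map_mul, map_neg, Complex.conj_I,
      map_one]
    linear_combination (-b₁ * (z⁻¹ * z⁻¹) / 2 + starRingEnd ℂ b₁ * (starRingEnd ℂ z⁻¹ * starRingEnd ℂ z⁻¹) / 2) * Complex.I_sq
  have hdr : dz r =ᶠ[cobounded ℂ] fun z => dz v z - L z := by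
    filter_upwards [hvd, hne] with z h1 h2
    have h3 := hqfd z h2
    have h4 := dz_log_qf (qf_pos hA hC hD h2)
    have h5 := hdzre z h2
    have h6 := hHz z h2
    have h7 : dz r z = dz v z - (d * dz (fun z => (Real.log (qf A B C z) : ℂ)) z +
        dz (fun z : ℂ => (((-2 * b₁ * z⁻¹).re : ℝ) : ℂ)) z) := by
      simp only [dz, wirt, hrd]
      rw [fderiv_fun_sub h1 ((h3.const_mul (d : ℂ)).fun_add (hred z h2)),
        fderiv_fun_add (h3.const_mul _) (hred z h2), fderiv_const_mul h3]
      simp only [_root_.sub_apply, _root_.add_apply, _root_.smul_apply, smul_eq_mul]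
      ring
    rw [h7, h4, h5, hL]
    linear_combination -h6
  have hLd : ∀ z : ℂ, z ≠ 0 → DifferentiableAt ℝ L z := fun z hz =>
    ((hinv z hz).const_mul _).add (((hinv z hz).mul (hinv z hz)).const_mul _)
  have hLF : FarO (m + 2) (-1) 0 L :=
    (FarO.inv_id.const_mul b₀).add ((hI2.const_mul b₁).weaken (.inl (by norm_num)))
  have hLz : ∀ z : ℂ, z ≠ 0 → dzbar L z = 0 := by
    intro z hz
    have h1 := hinv z hz
    have h2 := wirt_inv Complex.I hz
    have e1 := wirt_mul Complex.I h1 h1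
    have e : dzbar L z = b₀ * wirt Complex.I (fun z : ℂ => z⁻¹) z +
        b₁ * wirt Complex.I (fun z : ℂ => z⁻¹ * z⁻¹) z := by
      simp only [dzbar, wirt, hL]
      rw [fderiv_fun_add (h1.const_mul _) ((h1.fun_mul h1).const_mul _), fderiv_const_mul h1,
        fderiv_const_mul (h1.fun_mul h1)]
      simp only [_root_.add_apply, _root_.smul_apply, smul_eq_mul]
      ring
    rw [e, e1, h2, Complex.I_mul_I]
    ring
  have hLz' : FarO (m + 1) (-2) 0 (dz L) := by
    have := hLF.wirt (-Complex.I)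
    rwa [show (-1 : ℝ) - 1 = -2 by norm_num] at this
  -- Second use of the Schauder estimate, now for w - b₀/z - b₁/z². The subtracted part is
  -- holomorphic, so only μ times its ∂-derivative and the conjugate, again of order -4, join the
  -- right-hand side.
  have hdrF : FarO (m + 1) (1 - k) (q + 1) (dz r) := by
    have h1 := (hμ.mul hLz').weaken (p' := 1 - k - 1) (q' := q + 1)
      (.inr ⟨by linarith, by linarith⟩)
    have h2 := (hh.weaken (p' := 1 - k - 1) (q' := q + 1) (.inr ⟨by linarith, by linarith⟩)).add
      (h1.add h1.conj)
    refine (FarO.of_beltrami hμ h2 hE ?_ ?_).congr hdr.symm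
    · filter_upwards [hVc, hLF.contDiffAt] with z h1 h2
      exact h1.sub (h2.of_le (by norm_cast; omega))
    · filter_upwards [heq, hne, hVd] with z h1 h2 h3
      have := beltrami_sub (μ := μ) h3 (hLd z h2)
      rw [this, h1, beltrami, hLz z h2]
      ring
  have hdrb : FarO (m + 1) (1 - k) (q + 1) (dzbar r) := by
    refine hdrF.conj.congr ?_
    filter_upwards [hrdiff] with z hz using (dzbar_of_real hz hrr).symm
  -- Fixes the constant of integration: the assumed asymptotics of v exclude an additive constant in
  -- r.
  have hr0 : Tendsto r (cobounded ℂ) (𝓝 0) := by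
    have h1 : r =O[cobounded ℂ] fun z => wt (-1) 0 ‖z‖ := by
      have h2 : FarO 0 (-1) 0 fun z : ℂ => (((-2 * b₁ * z⁻¹).re : ℝ) : ℂ) := by
        have := (FarO.inv_id (m := 0)).const_mul b₁
        refine (this.neg.sub this.conj).congr (Eventually.of_forall fun z => (hre z).symm)
      refine ((hvq.of_le zero_le_one).sub h2).isBigO.congr_left fun z => ?_
      simp only [hrd]; ring
    refine h1.trans_tendsto ?_
    have := (tendsto_rpow_neg_atTop one_pos).comp (tendsto_norm_cobounded_atTop (E := ℂ))
    simpa [wt_zero, Function.comp_def] using this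
  have e : 1 - k = 2 - k - 1 := by ring
  rw [e] at hdrF hdrb
  refine FarO.of_wirt hrdiff (isBigO_of_fderiv (by linarith) hrdiff ?_ hr0) hdrF hdrb
  have h1 : ∀ᶠ z in cobounded ℂ, ‖fderiv ℝ r z‖ ≤ 4 * ‖dz r z‖ := by
    filter_upwards [hrdiff] with z hz
    refine (norm_clm_le _).trans ?_
    have h2 : ∀ e : ℂ, ‖e‖ = 1 → ‖fderiv ℝ r z e‖ ≤ 2 * ‖dz r z‖ := fun e he => by
      rw [fderiv_apply_of_real hz hrr]
      refine (norm_add_le _ _).trans_eq ?_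
      rw [RCLike.norm_conj, norm_mul, he]; ring
    have := h2 1 norm_one
    have := h2 _ Complex.norm_I
    linarith
  exact (IsBigO.of_bound 4 h1).trans hdrF.isBigO

/-! ### Symbol classes through iterated derivatives -/

/-- The class `O_m(|x|^p (ln |x|)^q)` for functions between normed spaces. -/
def IterO {E F : Type*} [NormedAddCommGroup E] [NormedSpace ℝ E] [NormedAddCommGroup F]
    [NormedSpace ℝ F] (m : ℕ) (p q : ℝ) (f : E → F) : Prop :=
  (∀ᶠ x in cobounded E, ContDiffAt ℝ m f x) ∧
    ∀ j : ℕ, j ≤ m →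
      (fun x => iteratedFDeriv ℝ j f x) =O[cobounded E] fun x => wt (p - j) q ‖x‖

section IterO
variable {E E' F G : Type*} [NormedAddCommGroup E] [NormedSpace ℝ E] [NormedAddCommGroup E']
  [NormedSpace ℝ E'] [NormedAddCommGroup F] [NormedSpace ℝ F] [NormedAddCommGroup G]
  [NormedSpace ℝ G] {m : ℕ} {p q : ℝ}

lemma IterO.congr {f g : E → F} (h : IterO m p q f) (hfg : f =ᶠ[cobounded E] g) :
    IterO m p q g := by
  have hn := eventually_cobounded_nhds hfg
  refine ⟨?_, fun j hj => (h.2 j hj).congr' ?_ EventuallyEq.rfl⟩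
  · filter_upwards [h.1, hn] with x hx hx' using
      hx.congr_of_eventuallyEq (hx'.mono fun _ => Eq.symm)
  · filter_upwards [hn] with x hx
    exact (EventuallyEq.iteratedFDeriv ℝ hx j).eq_of_nhds

lemma wt_comp_equiv_isBigO (Φ : E' ≃L[ℝ] E) :
    (fun x => wt p q ‖Φ x‖) =O[cobounded E'] fun x => wt p q ‖x‖ := by
  set K := max 2 (max ‖(Φ : E' →L[ℝ] E)‖ ‖(Φ.symm : E →L[ℝ] E')‖) with hK
  have hK2 : 2 ≤ K := le_max_left _ _
  have hK0 : 0 < K := by linarith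
  refine IsBigO.of_bound (K ^ |p| * 2 ^ |q|) ?_
  filter_upwards [eventually_norm_gt E' (K ^ 2)] with x hx
  have h1 : ‖Φ x‖ ≤ K * ‖x‖ := ((Φ : E' →L[ℝ] E).le_opNorm x).trans
    (by gcongr; exact (le_max_left _ _).trans (le_max_right _ _))
  have h2 : ‖x‖ / K ≤ ‖Φ x‖ := by
    rw [div_le_iff₀ hK0, mul_comm]
    have := (Φ.symm : E →L[ℝ] E').le_opNorm (Φ x)
    simp only [ContinuousLinearEquiv.coe_coe, ContinuousLinearEquiv.symm_apply_apply] at this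
    exact this.trans (by gcongr; exact (le_max_right _ _).trans (le_max_right _ _))
  have h3 : 1 < ‖Φ x‖ := by
    refine lt_of_lt_of_le ?_ h2
    rw [lt_div_iff₀ hK0]; nlinarith
  rw [Real.norm_of_nonneg (wt_pos h3).le, Real.norm_of_nonneg (wt_pos (by nlinarith)).le]
  exact wt_le hK2 hx.le h2 h1

lemma tendsto_equiv_cobounded (Φ : E' ≃L[ℝ] E) : Tendsto Φ (cobounded E') (cobounded E) := by
  rw [← tendsto_norm_atTop_iff_cobounded]
  refine tendsto_atTop.2 fun R => ?_
  filter_upwards [eventually_norm_gt E' (‖(Φ.symm : E →L[ℝ] E')‖ * |R|)] with x hx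
  have := (Φ.symm : E →L[ℝ] E').le_opNorm (Φ x)
  simp only [ContinuousLinearEquiv.coe_coe, ContinuousLinearEquiv.symm_apply_apply] at this
  by_contra! h
  have : ‖(Φ.symm : E →L[ℝ] E')‖ * ‖Φ x‖ ≤ ‖(Φ.symm : E →L[ℝ] E')‖ * |R| := by
    gcongr
    exact h.le.trans (le_abs_self R)
  linarith

lemma IterO.comp_equiv {f : E → F} (h : IterO m p q f) (Φ : E' ≃L[ℝ] E) :
    IterO m p q fun x => f (Φ x) := by
  have ht := tendsto_equiv_cobounded Φ
  refine ⟨(ht.eventually h.1).mono fun x hx => hx.comp x Φ.contDiff.contDiffAt, fun j hj => ?_⟩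
  have h1 : (fun x => iteratedFDeriv ℝ j f (Φ x)) =O[cobounded E'] fun x => wt (p - j) q ‖x‖ :=
    ((h.2 j hj).comp_tendsto ht).trans (wt_comp_equiv_isBigO Φ)
  refine IsBigO.trans (IsBigO.of_bound (‖(Φ : E' →L[ℝ] E)‖ ^ j) (Eventually.of_forall fun x => ?_)) h1
  have e := Φ.iteratedFDerivWithin_comp_right f uniqueDiffOn_univ (mem_univ (Φ x)) j
  rw [preimage_univ, iteratedFDerivWithin_univ, iteratedFDerivWithin_univ] at e
  rw [show (fun x => f (Φ x)) = f ∘ Φ from rfl, e]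
  refine (ContinuousMultilinearMap.norm_compContinuousLinearMap_le _ _).trans_eq ?_
  simp [mul_comm]

lemma IterO.clm_comp {f : E → F} (h : IterO m p q f) (T : F →L[ℝ] G) :
    IterO m p q fun x => T (f x) := by
  refine ⟨h.1.mono fun x hx => T.contDiff.contDiffAt.comp x hx, fun j hj => ?_⟩
  refine IsBigO.trans (IsBigO.of_bound ‖T‖ ?_) (h.2 j hj)
  filter_upwards [h.1] with x hx
  rw [show (fun x => T (f x)) = T ∘ f from rfl,
    T.iteratedFDeriv_comp_left hx (by exact_mod_cast hj)]
  exact T.norm_compContinuousMultilinearMap_le _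

lemma IterO.add {f g : E → F} (hf : IterO m p q f) (hg : IterO m p q g) :
    IterO m p q fun x => f x + g x := by
  refine ⟨by filter_upwards [hf.1, hg.1] with x h h' using h.add h', fun j hj => ?_⟩
  refine ((hf.2 j hj).add (hg.2 j hj)).congr' ?_ EventuallyEq.rfl
  filter_upwards [hf.1, hg.1] with x h h'
  have h1 : ContDiffAt ℝ j f x := h.of_le (by exact_mod_cast hj)
  have h2 : ContDiffAt ℝ j g x := h'.of_le (by exact_mod_cast hj)
  rw [← iteratedFDeriv_add_apply h1 h2]
  rfl

lemma IterO.fderiv {f : E → F} (h : IterO (m + 1) p q f) : IterO m (p - 1) q (fderiv ℝ f) := by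
  refine ⟨h.1.mono fun x hx => hx.fderiv_right (by simp), fun j hj => ?_⟩
  have h1 := (h.2 (j + 1) (by omega)).norm_left
  simp only [← norm_iteratedFDeriv_fderiv] at h1
  have e : p - ((j + 1 : ℕ) : ℝ) = p - 1 - j := by push_cast; ring
  rw [e] at h1
  exact h1.of_norm_left

lemma IterO.isBigO {f : E → F} (h : IterO m p q f) :
    f =O[cobounded E] fun x => wt p q ‖x‖ := by
  have h1 := (h.2 0 (Nat.zero_le m)).norm_left
  simp only [norm_iteratedFDeriv_zero, Nat.cast_zero, sub_zero] at h1
  exact h1.of_norm_left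

lemma IterO.of_fderiv {f : E → F} (hf : f =O[cobounded E] fun x => wt p q ‖x‖)
    (hd : ∀ᶠ x in cobounded E, DifferentiableAt ℝ f x) (h : IterO m (p - 1) q (_root_.fderiv ℝ f)) :
    IterO (m + 1) p q f := by
  refine ⟨?_, fun j hj => ?_⟩
  · filter_upwards [h.1, eventually_cobounded_nhds hd] with x h1 h2
    rw [Nat.cast_succ, contDiffAt_succ_iff_hasFDerivAt]
    exact ⟨_root_.fderiv ℝ f, ⟨_, h2, fun y hy => hy.hasFDerivAt⟩, h1⟩
  · refine IsBigO.of_norm_left ?_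
    cases j with
    | zero => simpa [norm_iteratedFDeriv_zero] using hf
    | succ j =>
      have h1 := (h.2 j (by omega)).norm_left
      simp only [norm_iteratedFDeriv_fderiv] at h1
      have e : p - ((j + 1 : ℕ) : ℝ) = p - 1 - j := by push_cast; ring
      rwa [e]

lemma iterO_zero_iff {F : ℂ → ℂ} : IterO 0 p q F ↔ FarO 0 p q F := by
  constructor
  · exact fun h => ⟨h.1.mono fun z hz => hz.continuousAt, h.isBigO⟩
  · refine fun h => ⟨h.contDiffAt, fun j hj => ?_⟩
    obtain rfl : j = 0 := by omega
    refine IsBigO.of_norm_left ?_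
    simpa [norm_iteratedFDeriv_zero] using h.isBigO

/-- A real-linear map on ℂ is recovered from its values at 1 and i by bounded linear operations, so
the recursive description by partial derivatives matches the one by iterated derivatives. -/
lemma iterO_iff_farO {F : ℂ → ℂ} : IterO m p q F ↔ FarO m p q F := by
  induction m generalizing F p with
  | zero => exact iterO_zero_iff
  | succ m ih =>
    constructor
    · intro h
      refine ⟨h.1.mono fun z hz => hz.differentiableAt (by simp), h.isBigO, ?_, ?_⟩
      · exact ih.1 (h.fderiv.clm_comp (ContinuousLinearMap.apply ℝ ℂ (1 : ℂ)))
      · exact ih.1 (h.fderiv.clm_comp (ContinuousLinearMap.apply ℝ ℂ Complex.I))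
    · intro h
      refine IterO.of_fderiv h.isBigO h.1 ?_
      have h1 := (ih.2 h.2.2.1).clm_comp (ContinuousLinearMap.smulRightL ℝ ℂ ℂ Complex.reCLM)
      have h2 := (ih.2 h.2.2.2).clm_comp (ContinuousLinearMap.smulRightL ℝ ℂ ℂ Complex.imCLM)
      exact (h1.add h2).congr (Eventually.of_forall fun z => (clm_eq_smulRight _).symm)

lemma IterO.farO {f : Plane → ℝ} (h : IterO m p q f) (Φ : ℂ ≃L[ℝ] Plane) :
    FarO m p q fun z => (f (Φ z) : ℂ) :=
  iterO_iff_farO.1 ((h.comp_equiv Φ).clm_comp Complex.ofRealCLM)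

lemma FarO.iterO {f : Plane → ℝ} (Φ : ℂ ≃L[ℝ] Plane) (h : FarO m p q fun z => (f (Φ z) : ℂ)) :
    IterO m p q f := by
  have := ((iterO_iff_farO.2 h).clm_comp Complex.reCLM).comp_equiv Φ.symm
  simpa using this

end IterO

/-! ### Reduction to the normalized equation -/

lemma fderiv_apply_wirt (f : ℂ → ℂ) (z e : ℂ) :
    fderiv ℝ f z e = e * dz f z + conj e * dzbar f z := by
  have h2 : fderiv ℝ f z e = e.re * fderiv ℝ f z 1 + e.im * fderiv ℝ f z Complex.I := by
    rw [← Complex.real_smul, ← Complex.real_smul, ← map_smul, ← map_smul, ← map_add]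
    congr 1
    simp [Complex.re_add_im]
  have e1 : e = e.re + e.im * Complex.I := (Complex.re_add_im e).symm
  have e2 : conj e = e.re - e.im * Complex.I := by
    apply Complex.ext <;> simp
  rw [h2, e2]
  nth_rewrite 3 [e1]
  simp only [wirt]
  linear_combination (e.im * fderiv ℝ f z Complex.I) * Complex.I_sq

/-- Second derivatives of a real function through its Wirtinger derivatives. -/
lemma fderiv_fderiv_of_real {U : ℂ → ℂ} {z : ℂ} (hU : ContDiffAt ℝ 2 U z)
    (hr : ∀ z, conj (U z) = U z) (a b : ℂ) :
    fderiv ℝ (fun w => fderiv ℝ U w a) z b = a * b * dz (dz U) z + conj (a * b * dz (dz U) z) +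
      (a * conj b + conj a * b) * dzbar (dz U) z := by
  have hd : ∀ᶠ w in 𝓝 z, DifferentiableAt ℝ U w := by
    filter_upwards [hU.eventually (by simp)] with w hw using hw.differentiableAt two_ne_zero
  have hV : DifferentiableAt ℝ (dz U) z := by
    have h1 : ∀ e, DifferentiableAt ℝ (fun w => fderiv ℝ U w e) z := fun e =>
      differentiableAt_fderiv_apply hU e
    show DifferentiableAt ℝ (fun z => (fderiv ℝ U z 1 + -Complex.I * fderiv ℝ U z Complex.I) / 2) z
    simp only [div_eq_mul_inv]
    exact ((h1 1).fun_add ((h1 Complex.I).const_mul (-Complex.I))).mul_const (2⁻¹ : ℂ)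
  have key : ∀ a b : ℂ, fderiv ℝ (fun w => fderiv ℝ U w a) z b =
      a * (b * dz (dz U) z + conj b * dzbar (dz U) z) +
        conj (a * (b * dz (dz U) z + conj b * dzbar (dz U) z)) := by
    intro a b
    have h1 : (fun w => fderiv ℝ U w a) =ᶠ[𝓝 z] fun w => a * dz U w + conj (a * dz U w) := by
      filter_upwards [hd] with w hw using fderiv_apply_of_real hw hr a
    have h2 : DifferentiableAt ℝ (fun w => a * dz U w) z := hV.const_mul a
    have h3 : DifferentiableAt ℝ (fun w => conj (a * dz U w)) z :=
      Complex.conjCLE.differentiableAt.comp z h2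
    rw [h1.fderiv_eq, fderiv_fun_add h2 h3, _root_.add_apply, fderiv_conj_apply h2,
      fderiv_const_mul hV, _root_.smul_apply, smul_eq_mul, fderiv_apply_wirt]
  -- The mixed derivative ∂̄∂U is a quarter of the Laplacian of a real function; its reality is
  -- extracted from the symmetry of second derivatives.
  have hreal : conj (dzbar (dz U) z) = dzbar (dz U) z := by
    have h1 := fderiv_fderiv_apply_comm hU 1 Complex.I
    rw [key, key] at h1
    simp only [map_mul, map_add, map_one, Complex.conj_I, map_neg] at h1
    have h2 : 2 * Complex.I * (conj (dzbar (dz U) z) - dzbar (dz U) z) = 0 := by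
      linear_combination h1
    have h3 : (2 * Complex.I : ℂ) ≠ 0 := by simp
    exact sub_eq_zero.1 ((mul_eq_zero.1 h2).resolve_left h3)
  rw [key]
  simp only [map_mul, map_add, hreal, Complex.conj_conj]
  ring

/-- The linear change of variables with matrix `S⁻¹` from `ℂ` to the plane. -/
noncomputable def planeEquiv (S : Matrix (Fin 2) (Fin 2) ℝ) (hS : IsUnit S.det) : ℂ ≃L[ℝ] Plane :=
  LinearEquiv.toContinuousLinearEquiv
    { toFun := fun z => WithLp.toLp 2 (S⁻¹ *ᵥ ![z.re, z.im])
      invFun := fun x => ⟨(S *ᵥ x.ofLp) 0, (S *ᵥ x.ofLp) 1⟩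
      map_add' := fun z w => by
        rw [← WithLp.toLp_add, ← Matrix.mulVec_add]
        simp
      map_smul' := fun t z => by
        rw [RingHom.id_apply, ← WithLp.toLp_smul, ← Matrix.mulVec_smul]
        simp
      left_inv := fun z => by
        have : S *ᵥ (S⁻¹ *ᵥ ![z.re, z.im]) = ![z.re, z.im] := by
          rw [Matrix.mulVec_mulVec, Matrix.mul_nonsing_inv _ hS, Matrix.one_mulVec]
        exact Complex.ext (congrFun this 0) (congrFun this 1)
      right_inv := fun x => by
        have : ![(S *ᵥ x.ofLp) 0, (S *ᵥ x.ofLp) 1] = S *ᵥ x.ofLp := by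
          ext i; fin_cases i <;> rfl
        show WithLp.toLp 2 (S⁻¹ *ᵥ ![(S *ᵥ x.ofLp) 0, (S *ᵥ x.ofLp) 1]) = x
        rw [this, Matrix.mulVec_mulVec, Matrix.nonsing_inv_mul _ hS, Matrix.one_mulVec] }

lemma planeEquiv_symm_apply (S : Matrix (Fin 2) (Fin 2) ℝ) (hS : IsUnit S.det) (x : Plane) :
    (planeEquiv S hS).symm x = ⟨(S *ᵥ x.ofLp) 0, (S *ᵥ x.ofLp) 1⟩ := rfl

lemma planeEquiv_symm_single (S : Matrix (Fin 2) (Fin 2) ℝ) (hS : IsUnit S.det) (i : Fin 2) :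
    (planeEquiv S hS).symm (EuclideanSpace.single i 1) = ⟨S 0 i, S 1 i⟩ := by
  rw [planeEquiv_symm_apply]
  simp

lemma mulVec_planeEquiv (S : Matrix (Fin 2) (Fin 2) ℝ) (hS : IsUnit S.det) (z : ℂ) :
    S *ᵥ (planeEquiv S hS z).ofLp = ![z.re, z.im] := by
  show S *ᵥ (S⁻¹ *ᵥ ![z.re, z.im]) = _
  rw [Matrix.mulVec_mulVec, Matrix.mul_nonsing_inv _ hS, Matrix.one_mulVec]

lemma partial2_eq {v : Plane → ℝ} (Φ : ℂ ≃L[ℝ] Plane) {z : ℂ} (hv : ContDiffAt ℝ 2 v (Φ z))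
    (i j : Fin 2) : (partial2 v i j (Φ z) : ℂ) =
      fderiv ℝ (fun w => fderiv ℝ (fun z => (v (Φ z) : ℂ)) w (Φ.symm (EuclideanSpace.single j 1))) z
        (Φ.symm (EuclideanSpace.single i 1)) := by
  set U : ℂ → ℂ := fun z => (v (Φ z) : ℂ) with hU
  have hvΦ : ContDiffAt ℝ 2 (v ∘ Φ) z := hv.comp z Φ.contDiff.contDiffAt
  have hUc : ContDiffAt ℝ 2 U z := Complex.ofRealCLM.contDiff.contDiffAt.comp z hvΦ
  have e1 : iteratedFDeriv ℝ 2 U z = Complex.ofRealCLM.compContinuousMultilinearMap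
      (iteratedFDeriv ℝ 2 (v ∘ Φ) z) :=
    Complex.ofRealCLM.iteratedFDeriv_comp_left hvΦ le_rfl
  have e2 := Φ.iteratedFDerivWithin_comp_right v uniqueDiffOn_univ (mem_univ (Φ z)) 2
  rw [preimage_univ, iteratedFDerivWithin_univ, iteratedFDerivWithin_univ] at e2
  have e3 : iteratedFDeriv ℝ 2 U z ![Φ.symm (EuclideanSpace.single i 1),
      Φ.symm (EuclideanSpace.single j 1)] = (partial2 v i j (Φ z) : ℂ) := by
    rw [e1, e2, partial2]
    simp only [ContinuousLinearMap.compContinuousMultilinearMap_coe, Function.comp_apply,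
      ContinuousMultilinearMap.compContinuousLinearMap_apply, Complex.ofRealCLM_apply]
    congr 2
    funext k
    fin_cases k <;> simp
  rw [← e3, iteratedFDeriv_two_apply]
  have h1 : DifferentiableAt ℝ (fderiv ℝ U) z :=
    (hUc.fderiv_right (m := 1) (by norm_num)).differentiableAt one_ne_zero
  rw [fderiv_clm_apply h1 (differentiableAt_const _)]
  simp

/-- The equation for the Wirtinger derivative in the new coordinates. -/
lemma beltrami_of_elliptic {U : ℂ → ℂ} {z : ℂ} (hU : ContDiffAt ℝ 2 U z)
    (hr : ∀ z, conj (U z) = U z) {a : Fin 2 → Fin 2 → ℝ} {f : Fin 2 → ℂ} {g : ℝ} {μ h : ℂ → ℂ} {M : ℂ}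
    (hM : M = ∑ i, ∑ j, (a i j : ℂ) * (f i * conj (f j) + conj (f i) * f j)) (hM0 : M ≠ 0)
    (hμ : μ z = -(∑ i, ∑ j, (a i j : ℂ) * (f i * f j)) * M⁻¹) (hh : h z = g * M⁻¹)
    (heq : ∑ i, ∑ j, (a i j : ℂ) * fderiv ℝ (fun w => fderiv ℝ U w (f j)) z (f i) = g) :
    beltrami μ (dz U) z = h z := by
  have hMc : conj M = M := by
    rw [hM]
    simp only [map_sum, map_mul, map_add, Complex.conj_conj, Complex.conj_ofReal]
    refine Finset.sum_congr rfl fun i _ => Finset.sum_congr rfl fun j _ => by ring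
  set N : ℂ := ∑ i, ∑ j, (a i j : ℂ) * (f i * f j) with hN
  set X := dz (dz U) z with hX
  set Y := dzbar (dz U) z with hY
  have e : N * X + conj (N * X) + M * Y = g := by
    rw [← heq, hN, hM]
    simp only [fderiv_fderiv_of_real hU hr, Fin.sum_univ_two, map_mul, map_add,
      Complex.conj_ofReal]
    rw [← hX, ← hY]
    ring
  rw [beltrami, hμ, hh, ← hX, ← hY]
  simp only [map_mul, map_neg, map_inv₀, hMc] at e ⊢
  field_simp
  linear_combination e

/-! ### Normalization of the limit operator and quadratic forms -/

section Coefficients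
variable {S A : Matrix (Fin 2) (Fin 2) ℝ}

/-- With the columns of `S` read as complex numbers, the sums are the coefficients of ∂∂ and ∂∂̄ in
the transformed limit operator. That operator is the Laplacian 4∂∂̄. -/
lemma normalized_coeff (hS : S 0 1 = S 1 0) (hSA : S * A * S = 1) {f : Fin 2 → ℂ}
    (hf : ∀ i, f i = ⟨S 0 i, S 1 i⟩) :
    ∑ i, ∑ j, (A i j : ℂ) * (f i * f j) = 0 ∧
      ∑ i, ∑ j, (A i j : ℂ) * (f i * conj (f j) + conj (f i) * f j) = 4 := by
  have h00 := congrFun (congrFun hSA 0) 0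
  have h01 := congrFun (congrFun hSA 0) 1
  have h10 := congrFun (congrFun hSA 1) 0
  have h11 := congrFun (congrFun hSA 1) 1
  simp only [Matrix.mul_apply, Fin.sum_univ_two, hS, Matrix.one_apply_eq, ne_eq, zero_ne_one,
    one_ne_zero, not_false_eq_true, Matrix.one_apply_ne] at h00 h01 h10 h11
  constructor
  · apply Complex.ext
    · simp [Fin.sum_univ_two, hf, hS]
      linarith
    · simp [Fin.sum_univ_two, hf, hS]
      linarith
  · apply Complex.ext
    · simp [Fin.sum_univ_two, hf, hS]
      linarith
    · simp [Fin.sum_univ_two, hf, hS]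
      ring

end Coefficients

lemma normalizing_sqrt {A : Matrix (Fin 2) (Fin 2) ℝ} (hA : A.PosDef) :
    0 ≤ CFC.sqrt A⁻¹ ∧ CFC.sqrt A⁻¹ * CFC.sqrt A⁻¹ = A⁻¹ ∧
      CFC.sqrt A⁻¹ 0 1 = CFC.sqrt A⁻¹ 1 0 ∧ IsUnit (CFC.sqrt A⁻¹).det ∧
      CFC.sqrt A⁻¹ * A * CFC.sqrt A⁻¹ = 1 := by
  have hinv : A⁻¹.PosDef := hA.inv
  have h0 : 0 ≤ CFC.sqrt A⁻¹ := CFC.sqrt_nonneg _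
  have hSS : CFC.sqrt A⁻¹ * CFC.sqrt A⁻¹ = A⁻¹ :=
    CFC.sqrt_mul_sqrt_self A⁻¹ (Matrix.nonneg_iff_posSemidef.2 hinv.posSemidef)
  have hAu : IsUnit A.det := hA.det_pos.ne'.isUnit
  refine ⟨h0, hSS, ?_, ?_, ?_⟩
  · have := (Matrix.nonneg_iff_posSemidef.1 h0).isHermitian.apply 0 1
    simpa using this.symm
  · have h : (CFC.sqrt A⁻¹).det * (CFC.sqrt A⁻¹).det = A⁻¹.det := by rw [← Matrix.det_mul, hSS]
    exact isUnit_of_mul_isUnit_left (h ▸ hinv.det_pos.ne'.isUnit)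
  · rw [Matrix.mul_assoc, mul_eq_one_comm, Matrix.mul_assoc, hSS, Matrix.mul_nonsing_inv _ hAu]

section QuadForm
variable {Q S : Matrix (Fin 2) (Fin 2) ℝ}

lemma quadForm_apply (Q : Matrix (Fin 2) (Fin 2) ℝ) (x : Plane) : quadForm Q x =
    Q 0 0 * x 0 ^ 2 + (Q 0 1 + Q 1 0) * x 0 * x 1 + Q 1 1 * x 1 ^ 2 := by
  simp only [quadForm, dotProduct, Matrix.mulVec, Fin.sum_univ_two]
  ring

lemma quadForm_smul_matrix (c : ℝ) (Q : Matrix (Fin 2) (Fin 2) ℝ) (x : Plane) :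
    quadForm (c • Q) x = c * quadForm Q x := by
  simp only [quadForm_apply, Matrix.smul_apply, smul_eq_mul]
  ring

lemma quadForm_pos (hQ : Q.PosDef) {x : Plane} (hx : x ≠ 0) : 0 < quadForm Q x := by
  have h : x.ofLp ≠ 0 := fun h => hx (by ext i; simp [h])
  simpa [quadForm] using hQ.dotProduct_mulVec_pos h

lemma eq_of_quadForm_eq {Q Q' : Matrix (Fin 2) (Fin 2) ℝ} (hQ : Q.IsHermitian)
    (hQ' : Q'.IsHermitian) (h : ∀ x, quadForm Q x = quadForm Q' x) : Q = Q' := by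
  have s := hQ.apply 0 1
  have s' := hQ'.apply 0 1
  have h0 := h !₂[1, 0]
  have h1 := h !₂[0, 1]
  have h2 := h !₂[1, 1]
  simp [quadForm_apply] at s s' h0 h1 h2
  ext i j
  fin_cases i <;> fin_cases j <;> simp <;> linarith

/-- A positive definite form in linear coordinates on `ℂ`. -/
lemma quadForm_comp_equiv (hQ : Q.PosDef) (Φ : ℂ ≃L[ℝ] Plane) : ∃ A B C : ℝ, 0 < A ∧ 0 < C ∧
    0 < A * C - B ^ 2 ∧ ∀ z, quadForm Q (Φ z) = qf A B C z := by
  set u := Φ 1 with hu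
  set w := Φ Complex.I with hw
  have hz : ∀ z : ℂ, Φ z = z.re • u + z.im • w := fun z => by
    rw [hu, hw, ← map_smul, ← map_smul, ← map_add]
    congr 1
    simp [Complex.re_add_im]
  have s := hQ.isHermitian.apply 0 1
  rw [star_trivial] at s
  set B := Q 0 0 * (u 0 * w 0) + Q 0 1 * (u 0 * w 1 + u 1 * w 0) + Q 1 1 * (u 1 * w 1) with hB
  have e : ∀ z, quadForm Q (Φ z) = qf (quadForm Q u) B (quadForm Q w) z := fun z => by
    rw [hz, qf, hB]
    simp only [quadForm_apply, PiLp.add_apply, PiLp.smul_apply, smul_eq_mul, s]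
    ring
  have hpos : ∀ z : ℂ, z ≠ 0 → 0 < quadForm Q (Φ z) := fun z hz =>
    quadForm_pos hQ (by simpa using hz)
  have hA : 0 < quadForm Q u := hpos 1 one_ne_zero
  refine ⟨_, B, _, hA, hpos _ Complex.I_ne_zero, ?_, e⟩
  -- At the point (-B, A) the form equals A(AC - B²), so its positivity gives that of the
  -- determinant.
  have h := hpos ⟨-B, quadForm Q u⟩ fun h => hA.ne' (congrArg Complex.im h)
  rw [e, qf] at h
  simp only at h
  refine pos_of_mul_pos_right (a := quadForm Q u) ?_ hA.le
  linarith

lemma quadForm_planeEquiv (hS : IsUnit S.det) (hs : S 0 1 = S 1 0) (hSS : S * S = Q) (z : ℂ) :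
    quadForm Q (planeEquiv S hS z) = ‖z‖ ^ 2 := by
  have h := mulVec_planeEquiv S hS z
  have h0 := congrFun h 0
  have h1 := congrFun h 1
  simp only [Matrix.mulVec, dotProduct, Fin.sum_univ_two, Matrix.cons_val_zero,
    Matrix.cons_val_one] at h0 h1
  rw [Complex.sq_norm, Complex.normSq_apply, ← h0, ← h1, quadForm_apply, ← hSS]
  simp only [Matrix.mul_apply, Fin.sum_univ_two, hs]
  ring

/-- The leading part of the expansion in the normalized coordinates. -/
lemma expansion_planeEquiv (hS : IsUnit S.det) (hs : S 0 1 = S 1 0) (h0 : 0 ≤ S) (hSS : S * S = Q)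
    {c : ℝ} (hc : 0 < c) (d : ℝ) (b : ℂ) {z : ℂ} (hz : z ≠ 0) :
    expansion (c • Q) d (√c * b.re) (√c * b.im) (planeEquiv S hS z) =
      d * Real.log (c * ‖z‖ ^ 2) + (b * z⁻¹).re := by
  have hn : 0 < ‖z‖ := norm_pos_iff.2 hz
  have hsc : 0 < √c := Real.sqrt_pos.2 hc
  -- The angle is therefore unaffected by c. The factor √c survives only in the radial power and is
  -- compensated in the two coefficients.
  have hsqrt : CFC.sqrt (c • Q) = √c • S := by
    refine CFC.sqrt_unique ?_ (smul_nonneg hsc.le h0)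
    rw [smul_mul_smul_comm, Real.mul_self_sqrt hc.le, hSS]
  have e1 : (c * ‖z‖ ^ 2) ^ (1 / 2 : ℝ) = √c * ‖z‖ := by
    rw [← Real.sqrt_eq_rpow, Real.sqrt_mul hc.le, Real.sqrt_sq hn.le]
  have e2 : (c * ‖z‖ ^ 2) ^ (-(1 / 2) : ℝ) = (√c * ‖z‖)⁻¹ := by
    rw [Real.rpow_neg (by positivity), e1]
  rw [expansion, direction, hsqrt, quadForm_smul_matrix, quadForm_planeEquiv hS hs hSS, e1, e2,
    Matrix.smul_mulVec, mulVec_planeEquiv]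
  simp only [Pi.smul_apply, smul_eq_mul, Matrix.cons_val_zero, Matrix.cons_val_one, Complex.mul_re,
    Complex.inv_re, Complex.inv_im, Complex.normSq_eq_norm_sq]
  congr 1
  field_simp
  ring

end QuadForm

/-- The Beltrami equation satisfied by the Wirtinger derivative of a solution in the normalized
coordinates. -/
lemma exists_beltrami {l : ℕ} {k q : ℝ} {a : Plane → Matrix (Fin 2) (Fin 2) ℝ}
    {A S : Matrix (Fin 2) (Fin 2) ℝ} (hS : IsUnit S.det) (hs : S 0 1 = S 1 0) (hSA : S * A * S = 1)
    (ha : ∀ i j, IsBigOm l (-2) 0 fun x => a x i j - A i j) {g : Plane → ℝ}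
    (hg : IsBigOm l (-k) q g) {v : Plane → ℝ} (hv : IsClassicalSolution a g v) :
    ∃ μ h : ℂ → ℂ, FarO l (-2) 0 μ ∧ FarO l (-k) q h ∧ ∀ᶠ z in cobounded ℂ,
      ContDiffAt ℝ 2 (fun z => (v (planeEquiv S hS z) : ℂ)) z ∧
      beltrami μ (dz fun z => (v (planeEquiv S hS z) : ℂ)) z = h z := by
  set Φ := planeEquiv S hS with hΦ
  set U : ℂ → ℂ := fun z => (v (Φ z) : ℂ) with hU
  set f : Fin 2 → ℂ := fun i => ⟨S 0 i, S 1 i⟩ with hf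
  obtain ⟨hN0, hM0⟩ := normalized_coeff hs hSA (f := f) fun i => rfl
  have hE : ∀ i j, FarO l (-2) 0 fun z => ((a (Φ z) i j - A i j : ℝ) : ℂ) := fun i j =>
    IterO.farO (ha i j) Φ
  have hsum : ∀ c : Fin 2 → Fin 2 → ℂ, FarO l (-2) 0 fun z =>
      ∑ i, ∑ j, ((a (Φ z) i j - A i j : ℝ) : ℂ) * c i j := fun c => by
    simp only [Fin.sum_univ_two]
    have h1 : ∀ i j, FarO l (-2) 0 fun z => ((a (Φ z) i j - A i j : ℝ) : ℂ) * c i j := fun i j => by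
      simpa only [mul_comm] using (hE i j).const_mul (c i j)
    exact ((h1 0 0).add (h1 0 1)).add ((h1 1 0).add (h1 1 1))
  have hsplit : ∀ (c : Fin 2 → Fin 2 → ℂ) z, ∑ i, ∑ j, (a (Φ z) i j : ℂ) * c i j =
      ∑ i, ∑ j, ((a (Φ z) i j - A i j : ℝ) : ℂ) * c i j + ∑ i, ∑ j, (A i j : ℂ) * c i j :=
    fun c z => by
      simp only [Fin.sum_univ_two]; push_cast; ring
  set N : ℂ → ℂ := fun z => ∑ i, ∑ j, (a (Φ z) i j : ℂ) * (f i * f j) with hN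
  set M : ℂ → ℂ := fun z => ∑ i, ∑ j, (a (Φ z) i j : ℂ) * (f i * conj (f j) + conj (f i) * f j)
    with hM
  -- The limit matrix contributes nothing to the ∂∂ coefficient in normalized coordinates, so only
  -- the decaying deviation remains and μ = -N/M decays.
  have hNO : FarO l (-2) 0 N := by
    have : N = fun z => ∑ i, ∑ j, ((a (Φ z) i j - A i j : ℝ) : ℂ) * (f i * f j) := by
      funext z
      exact (hsplit (fun i j => f i * f j) z).trans (by rw [hN0, add_zero])
    rw [this]
    exact hsum fun i j => f i * f j
  set R : ℂ → ℂ := fun z => ∑ i, ∑ j, ((a (Φ z) i j - A i j : ℝ) : ℂ) *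
    (f i * conj (f j) + conj (f i) * f j) with hR
  have hRO : FarO l (-2) 0 R := hsum fun i j => f i * conj (f j) + conj (f i) * f j
  have hMR : M = fun z => R z + 4 := by
    funext z
    exact (hsplit (fun i j => f i * conj (f j) + conj (f i) * f j) z).trans (by rw [hM0])
  have hMO : FarO l 0 0 M := by
    rw [hMR]
    exact (hRO.weaken (.inl (by norm_num))).add (FarO.const 4)
  have hR0 : Tendsto R (cobounded ℂ) (𝓝 0) := by
    refine hRO.isBigO.trans_tendsto ?_
    simp only [wt_zero]
    exact (tendsto_rpow_neg_atTop two_pos).comp tendsto_norm_cobounded_atTop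
  have hM1 : ∀ᶠ z in cobounded ℂ, 1 ≤ ‖M z‖ := by
    filter_upwards [hR0.eventually (Metric.ball_mem_nhds 0 one_pos)] with z hz
    rw [dist_zero_right] at hz
    rw [hMR]
    have h4 : ‖(4 : ℂ)‖ = 4 := by simp
    have := norm_sub_norm_le (4 : ℂ) (-R z)
    rw [norm_neg, sub_neg_eq_add, add_comm (4 : ℂ), h4] at this
    simp only
    linarith
  have hMi : FarO l 0 0 fun z => (M z)⁻¹ := by
    simpa using hMO.inv one_pos (by simpa using hM1)
  refine ⟨fun z => -N z * (M z)⁻¹, fun z => (g (Φ z) : ℂ) * (M z)⁻¹, by simpa using hNO.neg.mul hMi,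
    by simpa using (IterO.farO hg Φ).mul hMi, ?_⟩
  filter_upwards [hM1, (tendsto_equiv_cobounded Φ).eventually (eventually_norm_gt Plane 1)]
    with z hz1 hz
  have hvz : ContDiffAt ℝ 2 v (Φ z) :=
    hv.1.contDiffAt ((isOpen_lt continuous_const continuous_norm).mem_nhds hz)
  have hUz : ContDiffAt ℝ 2 U z := Complex.ofRealCLM.contDiff.contDiffAt.comp z
    (hvz.comp z Φ.contDiff.contDiffAt)
  refine ⟨hUz, beltrami_of_elliptic hUz (fun z => Complex.conj_ofReal _) (a := fun i j => a (Φ z) i j)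
    (f := f) (g := g (Φ z))
    (μ := fun z => -N z * (M z)⁻¹) (h := fun z => (g (Φ z) : ℂ) * (M z)⁻¹) rfl (norm_pos_iff.1 (one_pos.trans_le hz1)) rfl rfl ?_⟩
  rw [← hv.2 (Φ z) hz]
  push_cast
  refine Finset.sum_congr rfl fun i _ => Finset.sum_congr rfl fun j _ => ?_
  rw [partial2_eq Φ hvz, hΦ, planeEquiv_symm_single, planeEquiv_symm_single]

theorem proposition3p3
    (l : ℕ) (hl : 1 ≤ l) (k₁ k₂ : ℝ) (hk₁ : 3 < k₁) (hk₂ : 0 ≤ k₂)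
    (a : Plane → Matrix (Fin 2) (Fin 2) ℝ) (A : Matrix (Fin 2) (Fin 2) ℝ) (hA : A.PosDef)
    (ha : ∀ i j, IsBigOm l (-2) 0 (fun x => a x i j - A i j))
    (g : Plane → ℝ) (hg : IsBigOm l (-k₁) k₂ g)
    (v : Plane → ℝ) (hv : IsClassicalSolution a g v)
    (d : ℝ) (Q : Matrix (Fin 2) (Fin 2) ℝ) (hQ : Q.PosDef)
    (hvQ : IsBigOm l (-1) 0 (fun x => v x - d * Real.log (quadForm Q x))) :
    ∃ c : ℝ, 0 < c ∧ (d ≠ 0 → Q = c • A⁻¹) ∧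
      ∃ d₁ d₂ : ℝ,
        (k₁ ≤ 4 → IsBigOm (l + 1) (2 - k₁) (k₂ + 1)
          (fun x => v x - expansion (c • A⁻¹) d d₁ d₂ x)) ∧
        (4 < k₁ → IsBigOm (l + 1) (-2) 1
          (fun x => v x - expansion (c • A⁻¹) d d₁ d₂ x)) := by
  obtain ⟨h0, hSS, hs, hS, hSA⟩ := normalizing_sqrt hA
  set S := CFC.sqrt A⁻¹ with hSdef
  obtain ⟨μ, h, hμ, hh, hbel⟩ := exists_beltrami hS hs hSA ha hg hv
  set Φ := planeEquiv S hS with hΦ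
  obtain ⟨A', B', C', hA', hC', hD, hqf⟩ := quadForm_comp_equiv hQ Φ
  obtain ⟨m, rfl⟩ : ∃ m, l = m + 1 := ⟨l - 1, by omega⟩
  have hvq : FarO 1 (-1) 0 fun z =>
      (v (Φ z) : ℂ) - d * Real.log (qf A' B' C' z) := by
    refine ((IterO.farO hvQ Φ).of_le (by omega)).congr (Eventually.of_forall fun z => ?_)
    simp only [hqf]
    push_cast
    rfl
  -- Stated for general exponents: used with the given ones if k₁ ≤ 4, and with k = 4, q = 0
  -- otherwise. The latter yields the error |x|^-2 ln|x|.
  have main : ∀ k q, 3 < k → k ≤ 4 → 0 ≤ q → FarO (m + 1) (-k) q h →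
      (d ≠ 0 → A' = C' ∧ B' = 0) ∧ ∃ b : ℂ, FarO (m + 2) (2 - k) (q + 1) fun z =>
        (v (Φ z) : ℂ) - (d * Real.log (qf A' B' C' z) + (b * z⁻¹).re) := fun k q hk hk4 hq hh =>
    planar_expansion hk hk4 hq hμ hh (fun z => Complex.conj_ofReal _)
      (hbel.mono fun z hz => hz.1) (hbel.mono fun z hz => hz.2) hA' hC' hD hvq
  have hround : d ≠ 0 → A' = C' ∧ B' = 0 := by
    rcases le_or_gt k₁ 4 with h4 | h4
    · exact (main k₁ k₂ hk₁ h4 hk₂ hh).1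
    · exact (main 4 0 (by norm_num) le_rfl le_rfl (hh.weaken (.inl (by linarith)))).1
  have hΦA : ∀ z, quadForm A⁻¹ (Φ z) = ‖z‖ ^ 2 := quadForm_planeEquiv hS hs hSS
  have hQA : d ≠ 0 → ∀ z, quadForm Q (Φ z) = A' * ‖z‖ ^ 2 := fun hd z => by
    obtain ⟨h1, h2⟩ := hround hd
    rw [hqf, qf, ← h1, h2, Complex.sq_norm, Complex.normSq_apply]
    ring
  obtain ⟨c, hc, hcQ, hlog⟩ : ∃ c : ℝ, 0 < c ∧ (d ≠ 0 → Q = c • A⁻¹) ∧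
      ∀ z, d * Real.log (qf A' B' C' z) = d * Real.log (c * ‖z‖ ^ 2) := by
    -- For d = 0 the logarithm is absent and any positive c serves. For d ≠ 0 the form is A'|z|² in
    -- normalized coordinates, which forces c = A'.
    rcases eq_or_ne d 0 with hd | hd
    · exact ⟨1, one_pos, fun h => (h hd).elim, fun z => by simp [hd]⟩
    · refine ⟨A', hA', fun _ => ?_, fun z => by rw [← hqf, hQA hd]⟩
      have hinv : A⁻¹.IsHermitian := hA.inv.isHermitian
      refine eq_of_quadForm_eq hQ.isHermitian (hinv.smul (IsSelfAdjoint.all A')) fun x => ?_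
      obtain ⟨z, rfl⟩ := Φ.surjective x
      rw [hQA hd, quadForm_smul_matrix, hΦA]
  have transfer : ∀ {p q : ℝ} {b : ℂ}, (FarO (m + 2) p q fun z =>
      (v (Φ z) : ℂ) - (d * Real.log (qf A' B' C' z) + (b * z⁻¹).re)) →
      IsBigOm (m + 2) p q fun x => v x - expansion (c • A⁻¹) d (√c * b.re) (√c * b.im) x :=
    fun {p q b} hF => by
      refine FarO.iterO Φ (hF.congr ?_)
      filter_upwards [eventually_ne_zero] with z hz
      rw [expansion_planeEquiv hS hs h0 hSS hc d b hz, ← hlog]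
      push_cast
      rfl
  refine ⟨c, hc, hcQ, ?_⟩
  rcases le_or_gt k₁ 4 with h4 | h4
  · obtain ⟨b, hb⟩ := (main k₁ k₂ hk₁ h4 hk₂ hh).2
    exact ⟨_, _, fun _ => transfer hb, fun h => absurd h4 h.not_ge⟩
  · obtain ⟨b, hb⟩ := (main 4 0 (by norm_num) le_rfl le_rfl (hh.weaken (.inl (by linarith)))).2
    refine ⟨_, _, fun h => absurd h4 h.not_gt, fun _ => transfer (b := b) ?_⟩
    convert hb using 1 <;> norm_num
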